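/- For $\varepsilon,R>0$ let $V_\varepsilon=\{z\in\mathbb C: 0<|z|<\varepsilon,\ |\operatorname{Arg}z-\pi|<\pi/8\}$ and $U_R=\{\zeta\in\mathbb C:|\zeta|>R,\ |\operatorname{Arg}\zeta-\pi|<\pi/8\}$. Let $F=(F_1,F_2)$ be a holomorphic automorphism of $\mathbb C^2$ whose germ at the origin is $$F(z,w)=\bigl(z+z^2+O(z^3,z^2w),\ w-zw^2+O(z^4,z^3w,z^2w^2,zw^3)\bigr),$$ where $O(m_1,m_2,\dots)$ denotes an element of the ideal generated by the monomials $m_i$ in the ring of holomorphic germs at $0$. Put $g(u)=1-\tfrac12\,\partial_z^2F_1(0,u)$ and $h(u)=-u^{-2}\,\partial_zF_2(0,u)-1$ for $u\ne0$; thus, for fixed $w\neq 0$ and $z\to0$, $1/F_1(z,w)=1/z-1+g(w)+O(z)$ and $1/F_2(z,w)=1/w+z(1+h(w))+O(z^2)$. (1) There are $\varepsilon_0>0$ and $\gamma:\overline{V_{\varepsilon_0}}\to\mathbb C$, holomorphic on $V_{\varepsilon_0}$ and continuous on $\overline{V_{\varepsilon_0}}$, with $\gamma(0)=0$, such that the graph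 $\mathcal C=\{(z,\gamma(z)):z\in V_{\varepsilon_0}\}$ satisfies $F(\mathcal C)\subset\mathcal C$ and $F^n(p)\to0$ for all $p\in\mathcal C$, and $|\gamma(z)|\le C_1|z|^3$, $|\gamma'(z)|\le C_2|z|^2$ on $V_{\varepsilon_0}$ for some constants $C_1,C_2$. (2) There are $R_0>0$ and a holomorphic $\beta:U_{R_0}\to\mathbb C$ with $$\bigl(1+h(1/y)\bigr)\beta'(y)-\bigl(1-g(1/y)\bigr)\beta(y)=-g(1/y)\qquad(y\in U_{R_0}),$$ $\beta(y)=O(1/y)$ and $\beta'(y)=O(1/y^2)$ on $U_{R_0}$. (3) Let $(\varepsilon_0,\gamma)$ be any pair as in (1), $(R_0,\beta)$ any pair as in (2), and $\log$ any branch of the logarithm on $U_{R_0}$. Then there are constants $r,s\in\mathbb C$ and $0<\varepsilon_1\le\min(\varepsilon_0,1/R_0)$ such that for every $0<\varepsilon\le\varepsilon_1$ the following holds on $$D_{(z,w)}=\{(z,w)\in\mathbb C^2: z\in V_\varepsilon,\ w-\gamma(z)\in V_\varepsilon,\ |z|<|w-\gamma(z)|\}.$$ With $(z_n,w_n)=F^n(z,w)$,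 $x_n=1/z_n$, $y_n=1/(w_n-\gamma(z_n))$, the functions $$x_n+n+r\log x_n+s\log y_n+x_n\beta(y_n)$$ (which on each compact subset of $D_{(z,w)}$ are defined for all large $n$) converge locally uniformly on $D_{(z,w)}$, as $n\to\infty$, to a function $\psi$. The limit defining $\psi$ also exists at $F(p)$, and $\psi(F(p))=\psi(p)-1$, for all $p\in D_{(z,w)}$. The map $$\Theta(z,w)=\Bigl(\psi(z,w),\ \frac1{w-\gamma(z)}\Bigr)$$ is injective on the open set $D_{(z,w)}$ and is a biholomorphism from $D_{(z,w)}$ onto its open image $D_{(t,y)}=\Theta(D_{(z,w)})$. -/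

import Mathlib

open Filter Topology Set

noncomputable section

/-- A holomorphic automorphism of `ℂ²`. -/
def IsAutC2 (F : ℂ × ℂ → ℂ × ℂ) : Prop :=
  Differentiable ℂ F ∧
    ∃ G : ℂ × ℂ → ℂ × ℂ, Differentiable ℂ G ∧ Function.LeftInverse G F ∧
      Function.RightInverse G F

/-- The germ of `F` at the origin is
`(z + z² + O(z³, z²w), w - z w² + O(z⁴, z³w, z²w², zw³))`,
where `O(m₁, m₂, …)` is an element of the ideal generated by the monomials `m₁, m₂, …` in the ring
of germs of holomorphic functions. -/
def HasGerm (F : ℂ × ℂ → ℂ × ℂ) : Prop :=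
  ∃ a₁ a₂ b₁ b₂ b₃ b₄ : ℂ × ℂ → ℂ,
    AnalyticAt ℂ a₁ 0 ∧ AnalyticAt ℂ a₂ 0 ∧ AnalyticAt ℂ b₁ 0 ∧ AnalyticAt ℂ b₂ 0 ∧
    AnalyticAt ℂ b₃ 0 ∧ AnalyticAt ℂ b₄ 0 ∧
    ∀ᶠ p : ℂ × ℂ in 𝓝 0,
      (F p).1 = p.1 + p.1 ^ 2 + p.1 ^ 3 * a₁ p + p.1 ^ 2 * p.2 * a₂ p ∧
      (F p).2 = p.2 - p.1 * p.2 ^ 2 + p.1 ^ 4 * b₁ p + p.1 ^ 3 * p.2 * b₂ p +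
        p.1 ^ 2 * p.2 ^ 2 * b₃ p + p.1 * p.2 ^ 3 * b₄ p

/-- `V_ε = {z : 0 < |z| < ε, |Arg z - π| < π/8}`; the argument condition is written as
`|Arg (-z)| < π/8` with the principal argument. -/
def sectorV (ε : ℝ) : Set ℂ :=
  {z | 0 < ‖z‖ ∧ ‖z‖ < ε ∧ |Complex.arg (-z)| < Real.pi / 8}

/-- `U_R = {ζ : |ζ| > R, |Arg ζ - π| < π/8}` (used for `R > 0`). -/
def sectorU (R : ℝ) : Set ℂ :=
  {ζ | R < ‖ζ‖ ∧ |Complex.arg (-ζ)| < Real.pi / 8}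

/-- `γ : V_ε → ℂ` parametrizes a parabolic curve `{(z, γ z) : z ∈ V_ε}` of `F`, attracted to the
origin along `(1, 0)`. -/
structure IsParabolicCurve (F : ℂ × ℂ → ℂ × ℂ) (ε : ℝ) (γ : ℂ → ℂ) : Prop where
  pos : 0 < ε
  holo : DifferentiableOn ℂ γ (sectorV ε)
  cont : ContinuousOn γ (closure (sectorV ε))
  zero : γ 0 = 0
  invariant : ∀ z ∈ sectorV ε, ∃ z' ∈ sectorV ε, F (z, γ z) = (z', γ z')
  attracted : ∀ z ∈ sectorV ε, Tendsto (fun n : ℕ => F^[n] (z, γ z)) atTop (𝓝 0)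
  bound : ∃ C : ℝ, ∀ z ∈ sectorV ε, ‖γ z‖ ≤ C * ‖z‖ ^ 3
  bound_deriv : ∃ C : ℝ, ∀ z ∈ sectorV ε, ‖deriv γ z‖ ≤ C * ‖z‖ ^ 2

/-- `D_{(z,w)} = {(z,w) : z ∈ V_ε, w - γ(z) ∈ V_ε, |z| < |w - γ(z)|}`. -/
def domainD (γ : ℂ → ℂ) (ε : ℝ) : Set (ℂ × ℂ) :=
  {p | p.1 ∈ sectorV ε ∧ p.2 - γ p.1 ∈ sectorV ε ∧ ‖p.1‖ < ‖p.2 - γ p.1‖}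

/-- The function `g` in `1/z₁ = 1/z - 1 + g(w) + O(z)`, where `z₁` is the first coordinate of
`F (z, w)`: since `z₁ = z + z² (1 - g(w)) + O(z³)`, it is `1 - (1/2) ∂²z₁/∂z² (0, w)`. -/
def gFun (F : ℂ × ℂ → ℂ × ℂ) (u : ℂ) : ℂ :=
  1 - iteratedDeriv 2 (fun z : ℂ => (F (z, u)).1) 0 / 2

/-- The function `h` in `1/w₁ = 1/w + z (1 + h(w)) + O(z²)` (for fixed `w ≠ 0`), where `w₁` is the
second coordinate of `F (z, w)`: since `w₁ = w - w² (1 + h(w)) z + O(z²)`, it is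
`-∂w₁/∂z (0, w) / w² - 1`. Only its values at `u ≠ 0` are used. -/
def hFun (F : ℂ × ℂ → ℂ × ℂ) (u : ℂ) : ℂ :=
  -deriv (fun z : ℂ => (F (z, u)).2) 0 / u ^ 2 - 1

/-- `β` is a holomorphic solution on `U_R` of
`(1 + h(1/y)) β'(y) - (1 - g(1/y)) β(y) = -g(1/y)`
with `β(y) = O(1/y)` and `β'(y) = O(1/y²)`. -/
structure IsBeta (F : ℂ × ℂ → ℂ × ℂ) (R : ℝ) (β : ℂ → ℂ) : Prop where
  pos : 0 < R
  holo : DifferentiableOn ℂ β (sectorU R)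
  ode : ∀ y ∈ sectorU R,
    (1 + hFun F y⁻¹) * deriv β y - (1 - gFun F y⁻¹) * β y = -gFun F y⁻¹
  bound : ∃ C : ℝ, ∀ y ∈ sectorU R, ‖β y‖ ≤ C / ‖y‖
  bound_deriv : ∃ C : ℝ, ∀ y ∈ sectorU R, ‖deriv β y‖ ≤ C / ‖y‖ ^ 2

/-- `l` is a branch of the logarithm on `U_R`. -/
def IsLogBranch (R : ℝ) (l : ℂ → ℂ) : Prop :=
  ContinuousOn l (sectorU R) ∧ ∀ ζ ∈ sectorU R, Complex.exp (l ζ) = ζ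

/-- The approximate Abel-Fatou coordinate
`x_n + n + r log x_n + s log y_n + x_n β(y_n)`, as a function of `(z, w)`, where
`(z_n, w_n) = Fⁿ(z, w)`, `x_n = 1/z_n` and `y_n = 1/(w_n - γ(z_n))`. -/
def psiApprox (F : ℂ × ℂ → ℂ × ℂ) (γ β l : ℂ → ℂ) (r s : ℂ) (n : ℕ) (p : ℂ × ℂ) : ℂ :=
  let x : ℂ := 1 / (F^[n] p).1
  let y : ℂ := 1 / ((F^[n] p).2 - γ (F^[n] p).1)
  x + n + r * l x + s * l y + x * β y

/-- The Abel-Fatou coordinate `ψ`: the pointwise limit of `psiApprox` (the theorem asserts that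
the limit exists). -/
def psi (F : ℂ × ℂ → ℂ × ℂ) (γ β l : ℂ → ℂ) (r s : ℂ) (p : ℂ × ℂ) : ℂ :=
  limUnder atTop (fun n : ℕ => psiApprox F γ β l r s n p)

/-- `Θ(z, w) = (ψ(z, w), 1/(w - γ(z)))`. -/
def Theta (F : ℂ × ℂ → ℂ × ℂ) (γ β l : ℂ → ℂ) (r s : ℂ) (p : ℂ × ℂ) : ℂ × ℂ :=
  (psi F γ β l r s p, 1 / (p.2 - γ p.1))

/-- `f` restricts to a biholomorphism from the open set `D` onto the open set `f(D)`. -/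
def IsBiholomorphismOntoImage (f : ℂ × ℂ → ℂ × ℂ) (D : Set (ℂ × ℂ)) : Prop :=
  IsOpen D ∧ DifferentiableOn ℂ f D ∧ InjOn f D ∧ IsOpen (f '' D) ∧
    ∃ k : ℂ × ℂ → ℂ × ℂ, DifferentiableOn ℂ k (f '' D) ∧ ∀ p ∈ D, k (f p) = p

end

/-!
In the coordinates `x = 1/z`, `y = 1/w` the germ of `F` reads
`x₁ = x - 1 + g(1/y) + O(1/x)`, `y₁ = y + (1 + h(1/y)) / x + O(1/x²)`
(`HasGerm.exists_isNormalForm`), so `F` is a perturbation of `(x, y) ↦ (x - 1, y + 1/x)`. Everything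
below is read off from this normal form.

*The parabolic curve.* A point `(1/x, w)` lies on the curve when its orbit satisfies
`x_n ≈ x - n`, `w_n = O((|x| + n)⁻²)`; such an orbit is a fixed point of the operator which computes
`x_n` by summing increments from the initial value `x` and `w_n` by summing increments from
infinity, where `w` vanishes. In a weighted distance this operator halves distances, so there is
exactly one such orbit for each `x`, it depends holomorphically on `x`, and uniqueness makes the
curve invariant (`PerronBounds.isClose_perronMap`, `PerronBounds.exists_curve`,
`IsNormalForm.exists_isParabolicCurve`).

*The function `β`.* The equation is linear, `β' = a(1/y) β - c(1/y)` with `a(0) = 1`, and its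
homogeneous solutions behave like powers of `y` times `e^y`. They are small on sectors about the
negative axis and grow along rays of direction `1 + 2i`, which avoid the origin; integrating along
these rays to infinity gives a solution of order `1/y` on a sector of half-angle `π/4`
(`exists_solution`). Any other solution differs from it by a homogeneous one, so a given `β` on the
sector of half-angle `π/8` extends to a wider sector with the same decay
(`IsNormalForm.exists_wideBeta`), which leaves room for Cauchy estimates.

*Convergence.* The wedge of small `z`, `w` in cones of slopes `1/2` and `3/4` with `|z| < 2 |w|` is
forward invariant (`IsNearModel.step`). Put `Φ = x (1 + β(y)) + r log x + s log y`, with `y = 1/w`.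
In `Φ ∘ F - Φ + 1` the equation for `β` cancels all terms depending on `y` alone, and a choice of
`r` and `s` cancels the terms in `z` and `z w`; what is left is `O(|z|² + |z| |w|²)`
(`IsNormalForm.exists_fatouApprox`). This is at most a constant times the decrease of `|z| + |w|` in
one step (`IsNearModel.wedgeError_le`), so the errors telescope along orbits, and `Φ ∘ Fⁿ + n`
converges locally uniformly to a holomorphic `Ψ` with `|Ψ - Φ| = O(|z| + |w|)`
(`exists_abel_limit`, `IsNormalForm.exists_isFatouLimit`). As `γ(z) = O(z³)`, replacing `1/w` by
`1/(w - γ(z))` changes `Φ` by a quantity that tends to zero along orbits, and orbits are absorbed by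
narrower cones, where the given `γ`, `β` and branch of the logarithm are defined
(`IsWideBeta.exists_norm_sub_fatouApprox_le`, `IsNearModel.exists_iterate_mem_smallWedge`). Hence
`ψ = Ψ`.

*Injectivity.* On discs of radius comparable to `|x|` the difference `Ψ - x` varies by a small
proportion of `|x|`, so by Cauchy's estimate the derivative of `Ψ` with respect to `x` along a
translate `w = v + γ(z)` of the curve is within `1/2` of `1`
(`IsFatouLimit.exists_norm_fderiv_add_one_le`). Since the relevant `x` lie in a convex set, `Ψ` is
injective along each translate (`IsNearlyStraight.norm_sub_le`), while the second component of `Θ`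
determines the translate. Thus `Θ` is injective with injective derivative
(`IsNearlyStraight.isBiholomorphismOntoImage`).
-/

/-! ### Cones about the negative real axis -/

/-- The open cone `{ζ : |Im ζ| < -t Re ζ}` about the negative real axis, with half-angle
`arctan t`. -/
def cone (t : ℝ) : Set ℂ := {ζ | |ζ.im| < -t * ζ.re}

/-- The part of `cone t` outside the closed disc of radius `R`. -/
def sector (t R : ℝ) : Set ℂ := {ζ | ζ ∈ cone t ∧ R < ‖ζ‖}

lemma re_neg_of_mem_cone {t : ℝ} (ht : 0 < t) {ζ : ℂ} (h : ζ ∈ cone t) : ζ.re < 0 := by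
  have h1 : |ζ.im| < -t * ζ.re := h
  have := abs_nonneg ζ.im
  nlinarith

lemma ne_zero_of_mem_cone {t : ℝ} {ζ : ℂ} (h : ζ ∈ cone t) : ζ ≠ 0 := by
  rintro rfl
  simp [cone] at h

lemma cone_mono {t t' : ℝ} (ht : 0 < t) (htt' : t ≤ t') : cone t ⊆ cone t' := by
  intro ζ h
  have h0 := re_neg_of_mem_cone ht h
  have h1 : |ζ.im| < -t * ζ.re := h
  change |ζ.im| < -t' * ζ.re
  nlinarith

lemma sector_mono {t t' R R' : ℝ} (ht : 0 < t) (htt' : t ≤ t') (hR : R' ≤ R) :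
    sector t R ⊆ sector t' R' :=
  fun _ h => ⟨cone_mono ht htt' h.1, hR.trans_lt h.2⟩

lemma add_mem_cone {t : ℝ} {ζ ω : ℂ} (h : ζ ∈ cone t) (h' : ω ∈ cone t) : ζ + ω ∈ cone t := by
  have h1 : |ζ.im| < -t * ζ.re := h
  have h2 : |ω.im| < -t * ω.re := h'
  change |(ζ + ω).im| < -t * (ζ + ω).re
  rw [Complex.add_im, Complex.add_re]
  have := abs_add_le ζ.im ω.im
  linarith

lemma smul_mem_cone {t : ℝ} {ζ : ℂ} (h : ζ ∈ cone t) {a : ℝ} (ha : 0 < a) :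
    (a : ℂ) * ζ ∈ cone t := by
  have h1 : |ζ.im| < -t * ζ.re := h
  change |((a : ℂ) * ζ).im| < -t * ((a : ℂ) * ζ).re
  rw [Complex.re_ofReal_mul, Complex.im_ofReal_mul, abs_mul, abs_of_pos ha]
  nlinarith

lemma inv_mem_cone {t : ℝ} {ζ : ℂ} (h : ζ ∈ cone t) : ζ⁻¹ ∈ cone t := by
  have h1 : |ζ.im| < -t * ζ.re := h
  have h2 : 0 < Complex.normSq ζ := Complex.normSq_pos.2 (ne_zero_of_mem_cone h)
  change |(ζ⁻¹).im| < -t * (ζ⁻¹).re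
  rw [Complex.inv_re, Complex.inv_im, abs_div, abs_neg, abs_of_pos h2, mul_div_assoc']
  gcongr

lemma inv_mem_cone_iff {t : ℝ} {ζ : ℂ} : ζ⁻¹ ∈ cone t ↔ ζ ∈ cone t :=
  ⟨fun h => by simpa using inv_mem_cone h, inv_mem_cone⟩

lemma isOpen_cone (t : ℝ) : IsOpen (cone t) := by
  apply isOpen_lt <;> fun_prop

lemma isOpen_sector (t R : ℝ) : IsOpen (sector t R) :=
  (isOpen_cone t).inter (isOpen_lt continuous_const continuous_norm)

lemma convex_cone (t : ℝ) : Convex ℝ (cone t) := by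
  apply convex_iff_forall_pos.2
  intro x hx y hy a b ha hb _
  simpa using add_mem_cone (smul_mem_cone hx ha) (smul_mem_cone hy hb)

lemma norm_le_two_mul_neg_re {t : ℝ} (ht : 0 < t) (ht1 : t ≤ 1) {ζ : ℂ} (h : ζ ∈ cone t) :
    ‖ζ‖ ≤ 2 * -ζ.re := by
  have h1 : |ζ.im| < -t * ζ.re := h
  have h0 := re_neg_of_mem_cone ht h
  have h2 := Complex.norm_le_abs_re_add_abs_im ζ
  rw [abs_of_neg h0] at h2
  nlinarith

/-- Perturbing a point of a cone by a small proportion of its modulus stays in a wider cone. -/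
lemma mem_cone_of_norm_sub_le {t t' κ : ℝ} (ht : 0 < t) (ht1 : t ≤ 1) (ht' : 0 < t')
    (hκ : t + 2 * κ ≤ t' * (1 - 2 * κ)) {ζ ω : ℂ} (h : ζ ∈ cone t) (hω : ‖ω - ζ‖ ≤ κ * ‖ζ‖) :
    ω ∈ cone t' := by
  have h1 : |ζ.im| < -t * ζ.re := h
  have h0 := re_neg_of_mem_cone ht h
  have h2 := norm_le_two_mul_neg_re ht ht1 h
  have hκ0 : 0 ≤ κ := by
    by_contra hneg
    have := norm_pos_iff.2 (ne_zero_of_mem_cone h)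
    have := norm_nonneg (ω - ζ)
    nlinarith
  have h3 := (Complex.abs_re_le_norm (ω - ζ)).trans hω
  have h4 := (Complex.abs_im_le_norm (ω - ζ)).trans hω
  rw [Complex.sub_re] at h3
  rw [Complex.sub_im] at h4
  have h5 : |ω.im| ≤ |ζ.im| + κ * ‖ζ‖ := by
    have := abs_add_le ζ.im (ω.im - ζ.im)
    rw [add_sub_cancel] at this
    linarith
  have h6 : ω.re ≤ ζ.re + κ * ‖ζ‖ := by
    have := (le_abs_self _).trans h3
    linarith
  have h7 : κ * ‖ζ‖ ≤ κ * (2 * -ζ.re) := by gcongr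
  change |ω.im| < -t' * ω.re
  have h8 : -ζ.re * (1 - 2 * κ) ≤ -ω.re := by nlinarith
  have h9 : t' * (-ζ.re * (1 - 2 * κ)) ≤ t' * -ω.re := by gcongr
  nlinarith

/-- In this cone the real parts have the same sign and dominate, so addition increases moduli. -/
lemma norm_add_ge_of_mem_cone {ζ ω : ℂ} (h : ζ ∈ cone (3 / 4)) (h' : ω ∈ cone (3 / 4)) :
    ‖ζ‖ + ‖ω‖ / 4 ≤ ‖ζ + ω‖ := by
  have h1 : |ζ.im| < -(3 / 4) * ζ.re := h
  have h2 : |ω.im| < -(3 / 4) * ω.re := h'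
  have hζ := re_neg_of_mem_cone (by norm_num) h
  have hω := re_neg_of_mem_cone (by norm_num) h'
  -- in this cone the modulus is at most `5 / 4` times the absolute value of the real part
  have aux : ∀ u : ℂ, u.re < 0 → |u.im| < -(3 / 4) * u.re → ‖u‖ ≤ 5 / 4 * -u.re := by
    intro u hu hu'
    apply le_of_sq_le_sq _ (by nlinarith)
    rw [Complex.sq_norm, Complex.normSq_apply]
    have := sq_abs u.im
    have := abs_nonneg u.im
    nlinarith
  have hn1 := aux ζ hζ h1
  have hn2 := aux ω hω h2
  have him : -(9 / 16 * (ζ.re * ω.re)) ≤ ζ.im * ω.im := by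
    have h3 : |ζ.im * ω.im| ≤ (-(3 / 4) * ζ.re) * (-(3 / 4) * ω.re) := by
      rw [abs_mul]
      have := abs_nonneg ω.im
      exact mul_le_mul h1.le h2.le this (by nlinarith)
    have := (abs_le.1 h3).1
    linarith
  have hprod : ‖ζ‖ * ‖ω‖ ≤ (5 / 4 * -ζ.re) * (5 / 4 * -ω.re) :=
    mul_le_mul hn1 hn2 (norm_nonneg _) (by nlinarith)
  have hpos : 0 < ζ.re * ω.re := mul_pos_of_neg_of_neg hζ hω
  apply le_of_sq_le_sq _ (norm_nonneg _)
  have e1 : ‖ζ + ω‖ ^ 2 = ‖ζ‖ ^ 2 + ‖ω‖ ^ 2 + 2 * (ζ.re * ω.re + ζ.im * ω.im) := by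
    simp only [Complex.sq_norm, Complex.normSq_apply, Complex.add_re, Complex.add_im]
    ring
  have := norm_nonneg ω
  nlinarith [sq_nonneg ‖ω‖]

/-- The tangent of the half-angle `π / 8` of the sectors in the theorem. -/
noncomputable def tanEighth : ℝ := Real.tan (Real.pi / 8)

lemma tanEighth_bounds : 2 / 5 < tanEighth ∧ tanEighth < 5 / 12 := by
  have hpi := Real.pi_pos
  have hpos : 0 < tanEighth := Real.tan_pos_of_pos_of_lt_pi_div_two (by linarith) (by linarith)
  have hlt : tanEighth < 1 := by
    rw [← Real.tan_pi_div_four]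
    exact Real.tan_lt_tan_of_lt_of_lt_pi_div_two (by linarith) (by linarith) (by linarith)
  have h : (1 : ℝ) = 2 * tanEighth / (1 - tanEighth ^ 2) := by
    have := Real.tan_two_mul (x := Real.pi / 8)
    rwa [show 2 * (Real.pi / 8) = Real.pi / 4 by ring, Real.tan_pi_div_four] at this
  have h1 : 0 < 1 - tanEighth ^ 2 := by nlinarith
  rw [eq_div_iff h1.ne'] at h
  constructor <;> nlinarith

lemma tanEighth_pos : 0 < tanEighth := by linarith [tanEighth_bounds.1]

lemma abs_arg_lt_pi_div_eight_iff {u : ℂ} (hu : u ≠ 0) :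
    |u.arg| < Real.pi / 8 ↔ |u.im| < tanEighth * u.re := by
  have hpi := Real.pi_pos
  have key : 0 < u.re → (|u.arg| < Real.pi / 8 ↔ |u.im| < tanEighth * u.re) := by
    intro hre
    have h1 : |u.arg| < Real.pi / 2 := Complex.abs_arg_lt_pi_div_two_iff.2 (Or.inl hre)
    have h2 := abs_lt.1 h1
    have hm := Real.strictMonoOn_tan
    have e1 : Real.tan u.arg = u.im / u.re := Complex.tan_arg u
    have e2 : Real.tan (-(Real.pi / 8)) = -tanEighth := by rw [Real.tan_neg, tanEighth]
    rw [abs_lt, abs_lt, ← hm.lt_iff_lt ⟨by linarith, by linarith⟩ ⟨h2.1, h2.2⟩,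
      ← hm.lt_iff_lt ⟨h2.1, h2.2⟩ ⟨by linarith, by linarith⟩, e1, e2, ← tanEighth,
      lt_div_iff₀ hre, div_lt_iff₀ hre, neg_mul]
  refine ⟨fun h => ?_, fun h => ?_⟩
  · have h1 : |u.arg| < Real.pi / 2 := by linarith
    rcases Complex.abs_arg_lt_pi_div_two_iff.1 h1 with h2 | h2
    · exact (key h2).1 h
    · exact absurd h2 hu
  · refine (key ?_).2 h
    have := abs_nonneg u.im
    nlinarith [tanEighth_pos]

lemma sectorU_eq_sector {R : ℝ} (hR : 0 ≤ R) : sectorU R = sector tanEighth R := by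
  ext ζ
  simp only [sectorU, sector, mem_ofPred_eq]
  have : R < ‖ζ‖ → (|Complex.arg (-ζ)| < Real.pi / 8 ↔ ζ ∈ cone tanEighth) := by
    intro h
    have hne : -ζ ≠ 0 := by
      rw [neg_ne_zero, ← norm_pos_iff]
      linarith
    rw [abs_arg_lt_pi_div_eight_iff hne, cone, mem_ofPred_eq]
    simp
  tauto

lemma mem_sectorV_iff {ε : ℝ} {z : ℂ} : z ∈ sectorV ε ↔ z ∈ cone tanEighth ∧ ‖z‖ < ε := by
  simp only [sectorV, mem_ofPred_eq]
  have h1 : z ∈ cone tanEighth → 0 < ‖z‖ := fun h => norm_pos_iff.2 (ne_zero_of_mem_cone h)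
  have : 0 < ‖z‖ → (|Complex.arg (-z)| < Real.pi / 8 ↔ z ∈ cone tanEighth) := by
    intro h
    rw [abs_arg_lt_pi_div_eight_iff (neg_ne_zero.2 (norm_pos_iff.1 h)), cone, mem_ofPred_eq]
    simp
  tauto

lemma isOpen_sectorV (ε : ℝ) : IsOpen (sectorV ε) := by
  have : sectorV ε = cone tanEighth ∩ {z | ‖z‖ < ε} := by
    ext z
    exact mem_sectorV_iff
  rw [this]
  exact (isOpen_cone _).inter (isOpen_lt continuous_norm continuous_const)

lemma isPreconnected_sector {t R : ℝ} (hR : 0 ≤ R) : IsPreconnected (sector t R) := by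
  rcases hR.eq_or_lt with rfl | hR
  · have : sector t 0 = cone t := by
      ext ζ
      exact ⟨fun h => h.1, fun h => ⟨h, norm_pos_iff.2 (ne_zero_of_mem_cone h)⟩⟩
    rw [this]
    exact (convex_cone t).isPreconnected
  -- the image of `(R, ∞) × {slopes}` under a continuous parametrization by modulus and direction
  have : sector t R = (fun p : ℝ × ℂ => ((p.1 / ‖p.2‖ : ℝ) : ℂ) * p.2) '' (Ioi R ×ˢ cone t) := by
    ext ζ
    constructor
    · rintro ⟨h1, h2⟩
      refine ⟨(‖ζ‖, ζ), ⟨h2, h1⟩, ?_⟩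
      have : ‖ζ‖ ≠ 0 := by linarith
      simp [div_self this]
    · rintro ⟨⟨ρ, ω⟩, ⟨h1, h2⟩, rfl⟩
      have h3 : 0 < ‖ω‖ := norm_pos_iff.2 (ne_zero_of_mem_cone h2)
      have h1' : R < ρ := h1
      have h4 : 0 < ρ := hR.trans h1'
      refine ⟨smul_mem_cone h2 (by positivity), ?_⟩
      simp only [norm_mul, Complex.norm_real, Real.norm_eq_abs]
      rw [abs_of_pos (by positivity), div_mul_cancel₀ _ h3.ne']
      exact h1'
  rw [this]
  apply ((convex_Ioi R).prod (convex_cone t)).isPreconnected.image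
  intro p hp
  have h3 : ‖p.2‖ ≠ 0 := (norm_pos_iff.2 (ne_zero_of_mem_cone hp.2)).ne'
  apply ContinuousAt.continuousWithinAt
  apply ContinuousAt.mul _ continuousAt_snd
  exact Complex.continuous_ofReal.continuousAt.comp
    (ContinuousAt.div continuousAt_fst continuousAt_snd.norm h3)

/-! ### Cauchy estimates in several variables -/

section Cauchy

variable {E F : Type*} [NormedAddCommGroup E] [NormedSpace ℂ E]
  [NormedAddCommGroup F] [NormedSpace ℂ F]

/-- Cauchy's estimate for the derivative of a bounded holomorphic map between normed spaces, from
the one-variable estimate on complex lines. -/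
lemma norm_fderiv_le_of_norm_le {f : E → F} {c : E} {r M : ℝ} (hr : 0 < r)
    (hf : DifferentiableOn ℂ f (Metric.ball c r)) (hM : ∀ p ∈ Metric.ball c r, ‖f p‖ ≤ M) :
    ‖fderiv ℂ f c‖ ≤ M / r := by
  have hM0 : 0 ≤ M := (norm_nonneg _).trans (hM c (Metric.mem_ball_self hr))
  refine ContinuousLinearMap.opNorm_le_bound _ (by positivity) fun v => ?_
  rcases eq_or_ne v 0 with rfl | hv
  · simp
  have hv' : 0 < ‖v‖ := norm_pos_iff.2 hv
  have hmaps : ∀ ρ < r, ∀ ζ ∈ Metric.closedBall (0 : ℂ) (ρ / ‖v‖), c + ζ • v ∈ Metric.ball c r := by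
    intro ρ hρ ζ hζ
    rw [mem_closedBall_zero_iff, le_div_iff₀ hv'] at hζ
    rw [mem_ball_iff_norm, add_sub_cancel_left, norm_smul]
    linarith
  have hc : DifferentiableAt ℂ f c := hf.differentiableAt (Metric.ball_mem_nhds c hr)
  have hline : HasDerivAt (fun ζ : ℂ => c + ζ • v) v 0 := by
    simpa using ((hasDerivAt_id (0 : ℂ)).smul_const v).const_add c
  have hd : HasDerivAt (fun ζ : ℂ => f (c + ζ • v)) (fderiv ℂ f c v) 0 := by
    have h0 : HasFDerivAt f (fderiv ℂ f c) (c + (0 : ℂ) • v) := by simpa using hc.hasFDerivAt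
    exact h0.comp_hasDerivAt (0 : ℂ) hline
  have hρ : ∀ ρ, 0 < ρ → ρ < r → ‖fderiv ℂ f c v‖ ≤ M * ‖v‖ / ρ := by
    intro ρ hρ0 hρr
    rw [← hd.deriv]
    have hdiff : DifferentiableOn ℂ (fun ζ : ℂ => f (c + ζ • v))
        (Metric.closedBall 0 (ρ / ‖v‖)) := by
      apply hf.comp
      · exact (differentiable_const c).differentiableOn.add
          (differentiable_id.smul_const v).differentiableOn
      · exact hmaps ρ hρr
    have hpos : 0 < ρ / ‖v‖ := by positivity
    have := Complex.norm_deriv_le_of_forall_mem_sphere_norm_le (C := M) hpos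
      (hdiff.diffContOnCl_ball subset_rfl)
      (fun ζ hζ => hM _ (hmaps ρ hρr ζ (Metric.sphere_subset_closedBall hζ)))
    calc _ ≤ _ := this
      _ = _ := by field_simp
  have hlim : Tendsto (fun ρ : ℝ => M * ‖v‖ / ρ) (𝓝[<] r) (𝓝 (M * ‖v‖ / r)) :=
    (tendsto_const_nhds.div tendsto_id hr.ne').mono_left nhdsWithin_le_nhds
  have hev : ∀ᶠ ρ in 𝓝[<] r, ‖fderiv ℂ f c v‖ ≤ M * ‖v‖ / ρ := by
    filter_upwards [Ioo_mem_nhdsLT hr] with ρ hρ'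
    exact hρ ρ hρ'.1 hρ'.2
  have := ge_of_tendsto hlim hev
  rwa [div_mul_eq_mul_div]

lemma norm_fderiv_le_of_mem_ball {f : E → F} {c : E} {r M : ℝ}
    (hf : DifferentiableOn ℂ f (Metric.ball c r)) (hM : ∀ p ∈ Metric.ball c r, ‖f p‖ ≤ M)
    {s : ℝ} (hs : s < r) {p : E} (hp : p ∈ Metric.ball c s) :
    ‖fderiv ℂ f p‖ ≤ M / (r - s) := by
  have hsub : Metric.ball p (r - s) ⊆ Metric.ball c r := by
    apply Metric.ball_subset_ball'
    have := Metric.mem_ball.1 hp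
    linarith
  exact norm_fderiv_le_of_norm_le (by linarith) (hf.mono hsub) fun q hq => hM q (hsub hq)

/-- A bounded holomorphic map is Lipschitz on smaller balls. -/
lemma norm_sub_le_of_mem_ball {f : E → F} {c : E} {r M : ℝ}
    (hf : DifferentiableOn ℂ f (Metric.ball c r)) (hM : ∀ p ∈ Metric.ball c r, ‖f p‖ ≤ M)
    {s : ℝ} (hs : s < r) {p q : E} (hp : p ∈ Metric.ball c s) (hq : q ∈ Metric.ball c s) :
    ‖f p - f q‖ ≤ M / (r - s) * ‖p - q‖ := by
  let _ : NormedSpace ℝ E := NormedSpace.restrictScalars ℝ ℂ E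
  refine (convex_ball c s).norm_image_sub_le_of_norm_fderiv_le (𝕜 := ℂ) ?_ ?_ hq hp
  · intro u hu
    exact hf.differentiableAt (Metric.isOpen_ball.mem_nhds (Metric.ball_subset_ball hs.le hu))
  · intro u hu
    exact norm_fderiv_le_of_mem_ball hf hM hs hu

/-- A holomorphic map on an open subset of a normed space has a continuous derivative, hence is
strictly differentiable, wherever it is locally bounded. -/
lemma hasStrictFDerivAt_of_differentiableOn {f : E → F} {U : Set E} (hU : IsOpen U)
    (hf : DifferentiableOn ℂ f U) {c : E} (hc : c ∈ U) : HasStrictFDerivAt f (fderiv ℂ f c) c := by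
  -- continuity at `c` makes `f` bounded on a ball of radius `4 r`
  obtain ⟨r, hr, M, hball, hM⟩ : ∃ r > 0, ∃ M, Metric.ball c (4 * r) ⊆ U ∧
      ∀ p ∈ Metric.ball c (4 * r), ‖f p‖ ≤ M := by
    have hcont : ContinuousAt f c := (hf.differentiableAt (hU.mem_nhds hc)).continuousAt
    have h1 : ∀ᶠ p in 𝓝 c, ‖f p‖ < ‖f c‖ + 1 :=
      hcont.norm.eventually_lt continuousAt_const (by simp)
    obtain ⟨r, hr, h⟩ := Metric.eventually_nhds_iff_ball.1 (h1.and (hU.mem_nhds hc))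
    refine ⟨r / 4, by positivity, ‖f c‖ + 1, ?_⟩
    rw [mul_div_cancel₀ _ (by norm_num)]
    exact ⟨fun p hp => (h p hp).2, fun p hp => (h p hp).1.le⟩
  have hf' := hf.mono hball
  have hM0 : 0 ≤ M := (norm_nonneg _).trans (hM c (Metric.mem_ball_self (by positivity)))
  apply hasStrictFDerivAt_of_hasFDerivAt_of_continuousAt
  · filter_upwards [hU.mem_nhds hc] with p hp
    exact (hf.differentiableAt (hU.mem_nhds hp)).hasFDerivAt
  -- Cauchy's estimate applied to `p ↦ f (p + v) - f p` bounds the variation of the derivative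
  have key : ∀ v : E, ‖v‖ < r → ‖fderiv ℂ f (c + v) - fderiv ℂ f c‖ ≤ M / r * ‖v‖ / r := by
    intro v hv
    have hmem : ∀ p ∈ Metric.ball c r, p + v ∈ Metric.ball c (3 * r) := by
      intro p hp
      rw [mem_ball_iff_norm] at hp ⊢
      have : p + v - c = p - c + v := by abel
      rw [this]
      linarith [norm_add_le (p - c) v]
    have hat : ∀ p ∈ Metric.ball c (3 * r), DifferentiableAt ℂ f p := fun p hp =>
      hf'.differentiableAt
        (Metric.isOpen_ball.mem_nhds (Metric.ball_subset_ball (by linarith) hp))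
    have hd : DifferentiableOn ℂ (fun p => f (p + v) - f p) (Metric.ball c r) := by
      intro p hp
      have h1 : DifferentiableAt ℂ (fun p => f (p + v)) p :=
        (hat _ (hmem p hp)).comp p (differentiableAt_id.add_const v)
      exact (h1.sub (hat p (Metric.ball_subset_ball (by linarith) hp))).differentiableWithinAt
    have hb : ∀ p ∈ Metric.ball c r, ‖f (p + v) - f p‖ ≤ M / r * ‖v‖ := by
      intro p hp
      have := norm_sub_le_of_mem_ball hf' hM (s := 3 * r) (by linarith) (hmem p hp)
        (Metric.ball_subset_ball (by linarith) hp)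
      rwa [show 4 * r - 3 * r = r by ring, add_sub_cancel_left] at this
    have := norm_fderiv_le_of_norm_le hr hd hb
    have hcv : HasFDerivAt (fun p => f (p + v) - f p) (fderiv ℂ f (c + v) - fderiv ℂ f c) c := by
      have h1 : HasFDerivAt (fun p => f (p + v)) (fderiv ℂ f (c + v)) c := by
        rw [hasFDerivAt_comp_add_right]
        exact (hat _ (hmem c (Metric.mem_ball_self hr))).hasFDerivAt
      exact h1.sub (hat c (Metric.mem_ball_self (by positivity))).hasFDerivAt
    rwa [hcv.fderiv] at this
  have hlim : Tendsto (fun p => M / r * ‖p - c‖ / r) (𝓝 c) (𝓝 0) := by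
    have : Continuous fun p => M / r * ‖p - c‖ / r := by fun_prop
    simpa using this.tendsto c
  rw [ContinuousAt, tendsto_iff_norm_sub_tendsto_zero]
  apply squeeze_zero' (Eventually.of_forall fun _ => norm_nonneg _) _ hlim
  filter_upwards [Metric.ball_mem_nhds c hr] with p hp
  have := key (p - c) (mem_ball_iff_norm.1 hp)
  rwa [add_sub_cancel] at this

/-- Locally uniform limits of holomorphic maps in several variables are holomorphic. -/
lemma differentiableOn_of_tendstoLocallyUniformlyOn [ProperSpace E] [CompleteSpace F]
    {f : ℕ → E → F} {g : E → F}
    {U : Set E} (hU : IsOpen U) (hf : ∀ n, DifferentiableOn ℂ (f n) U)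
    (hlim : TendstoLocallyUniformlyOn f g atTop U) : DifferentiableOn ℂ g U := by
  intro c hc
  obtain ⟨r, hr, hsub, hunif⟩ : ∃ r > 0, Metric.ball c (2 * r) ⊆ U ∧
      UniformCauchySeqOn f atTop (Metric.ball c (2 * r)) := by
    obtain ⟨r, hr, h⟩ := Metric.nhds_basis_closedBall.mem_iff.1 (hU.mem_nhds hc)
    refine ⟨r / 2, by positivity, ?_, ?_⟩ <;> rw [mul_div_cancel₀ _ (by norm_num)]
    · exact Metric.ball_subset_closedBall.trans h
    · have := (tendstoLocallyUniformlyOn_iff_forall_isCompact hU).1 hlim _ h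
        (isCompact_closedBall c r)
      exact (this.mono Metric.ball_subset_closedBall).uniformCauchySeqOn
  have hd : ∀ n, ∀ p ∈ Metric.ball c r, HasFDerivAt (f n) (fderiv ℂ (f n) p) p := fun n p hp =>
    ((hf n).differentiableAt (hU.mem_nhds
      (hsub (Metric.ball_subset_ball (by linarith) hp)))).hasFDerivAt
  -- by Cauchy's estimate the derivatives are uniformly Cauchy on the smaller ball
  have hcauchy : UniformCauchySeqOn (fun n => fderiv ℂ (f n)) atTop (Metric.ball c r) := by
    rw [Metric.uniformCauchySeqOn_iff] at hunif ⊢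
    intro ε hε
    obtain ⟨N, hN⟩ := hunif (ε / 2 * r) (by positivity)
    refine ⟨N, fun m hm n hn p hp => ?_⟩
    have h1 : DifferentiableOn ℂ (fun q => f m q - f n q) (Metric.ball c (2 * r)) :=
      ((hf m).mono hsub).sub ((hf n).mono hsub)
    have h2 : ∀ q ∈ Metric.ball c (2 * r), ‖f m q - f n q‖ ≤ ε / 2 * r := by
      intro q hq
      rw [← dist_eq_norm]
      exact (hN m hm n hn q hq).le
    have h3 := norm_fderiv_le_of_mem_ball h1 h2 (s := r) (by linarith) hp
    have h4 : HasFDerivAt (fun q => f m q - f n q) _ p := (hd m p hp).sub (hd n p hp)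
    rw [h4.fderiv] at h3
    rw [dist_eq_norm]
    calc _ ≤ ε / 2 * r / (2 * r - r) := h3
      _ = ε / 2 := by field_simp; ring
      _ < ε := by linarith
  have hex : ∀ p ∈ Metric.ball c r, ∃ L, Tendsto (fun n => fderiv ℂ (f n) p) atTop (𝓝 L) :=
    fun p hp => cauchySeq_tendsto_of_complete (hcauchy.cauchySeq hp)
  choose! g' hg' using hex
  have hderiv := hcauchy.tendstoUniformlyOn_of_tendsto hg'
  have hcr : c ∈ Metric.ball c r := Metric.mem_ball_self hr
  exact (hasFDerivAt_of_tendstoUniformlyOn Metric.isOpen_ball hderiv hd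
    (fun p hp => hlim.tendsto_at (hsub (Metric.ball_subset_ball (by linarith) hp)))
    hcr).differentiableAt.differentiableWithinAt

end Cauchy

/-- The first-order Taylor remainder of a bounded holomorphic function. -/
lemma norm_sub_sub_deriv_mul_le {f : ℂ → ℂ} {c h : ℂ} {r M : ℝ} (hr : 0 < r)
    (hf : DifferentiableOn ℂ f (Metric.ball c r)) (hM : ∀ p ∈ Metric.ball c r, ‖f p‖ ≤ M)
    (hh : ‖h‖ < r / 4) : ‖f (c + h) - f c - deriv f c * h‖ ≤ 8 * M / r ^ 2 * ‖h‖ ^ 2 := by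
  have hM0 : 0 ≤ M := (norm_nonneg _).trans (hM c (Metric.mem_ball_self hr))
  have hd1 : ∀ p ∈ Metric.ball c (r / 2), ‖deriv f p‖ ≤ 2 * M / r := by
    intro p hp
    have := norm_fderiv_le_of_mem_ball hf hM (s := r / 2) (by linarith) hp
    rw [← norm_deriv_eq_norm_fderiv] at this
    calc _ ≤ _ := this
      _ = _ := by field_simp; ring
  have hsub : Metric.ball c (r / 2) ⊆ Metric.ball c r := Metric.ball_subset_ball (by linarith)
  have hd2 : DifferentiableOn ℂ (deriv f) (Metric.ball c (r / 2)) :=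
    (hf.mono hsub).deriv Metric.isOpen_ball
  have hc4 : c ∈ Metric.ball c (r / 4) := Metric.mem_ball_self (by positivity)
  have hd3 : ∀ p ∈ Metric.closedBall c ‖h‖,
      ‖deriv f p - deriv f c‖ ≤ 8 * M / r ^ 2 * ‖h‖ := by
    intro p hp
    have hp' : p ∈ Metric.ball c (r / 4) := (Metric.mem_closedBall.1 hp).trans_lt hh
    calc _ ≤ 2 * M / r / (r / 2 - r / 4) * ‖p - c‖ :=
          norm_sub_le_of_mem_ball hd2 hd1 (by linarith) hp' hc4
      _ = 8 * M / r ^ 2 * ‖p - c‖ := by field_simp; ring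
      _ ≤ _ := by
          gcongr
          exact mem_closedBall_iff_norm.1 hp
  have hder : ∀ p ∈ Metric.closedBall c ‖h‖,
      HasDerivWithinAt (fun p => f p - deriv f c * p) (deriv f p - deriv f c)
        (Metric.closedBall c ‖h‖) p := by
    intro p hp
    have hp' : p ∈ Metric.ball c r := (Metric.mem_closedBall.1 hp).trans_lt (by linarith)
    have h1 := (hf.differentiableAt (Metric.isOpen_ball.mem_nhds hp')).hasDerivAt
    have h2 : HasDerivAt (fun p => deriv f c * p) (deriv f c) p := by
      simpa using (hasDerivAt_id p).const_mul (deriv f c)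
    exact (h1.sub h2).hasDerivWithinAt
  have := (convex_closedBall c ‖h‖).norm_image_sub_le_of_norm_hasDerivWithin_le hder hd3
    (Metric.mem_closedBall_self (norm_nonneg h)) (y := c + h) (by simp)
  calc _ = ‖f (c + h) - deriv f c * (c + h) - (f c - deriv f c * c)‖ := by congr 1; ring
    _ ≤ _ := this
    _ = _ := by rw [add_sub_cancel_left]; ring

lemma AnalyticAt.exists_ball_bound {E F : Type*} [NormedAddCommGroup E] [NormedSpace ℂ E]
    [NormedAddCommGroup F] [NormedSpace ℂ F] [CompleteSpace F] {f : E → F} {c : E}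
    (hf : AnalyticAt ℂ f c) : ∃ r > 0, ∃ M > 0, DifferentiableOn ℂ f (Metric.ball c r) ∧
      ∀ p ∈ Metric.ball c r, ‖f p‖ ≤ M := by
  have h1 : ∀ᶠ p in 𝓝 c, ‖f p‖ < ‖f c‖ + 1 :=
    hf.continuousAt.norm.eventually_lt continuousAt_const (by simp)
  obtain ⟨r, hr, h⟩ := Metric.eventually_nhds_iff_ball.1 (h1.and hf.eventually_analyticAt)
  exact ⟨r, hr, ‖f c‖ + 1, by positivity,
    fun p hp => (h p hp).2.differentiableAt.differentiableWithinAt, fun p hp => (h p hp).1.le⟩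

lemma AnalyticAt.exists_norm_sub_sub_le {f : ℂ → ℂ} (hf : AnalyticAt ℂ f 0) :
    ∃ C, ∀ᶠ w in 𝓝 0, ‖f w - f 0 - deriv f 0 * w‖ ≤ C * ‖w‖ ^ 2 := by
  obtain ⟨r, hr, M, -, hd, hM⟩ := hf.exists_ball_bound
  refine ⟨8 * M / r ^ 2, ?_⟩
  filter_upwards [Metric.ball_mem_nhds (0 : ℂ) (show 0 < r / 4 by positivity)] with w hw
  have := norm_sub_sub_deriv_mul_le hr hd hM (h := w) (by simpa using hw)
  rwa [zero_add] at this

/-- The expansion of a germ in the first variable, where the coefficient of the linear term is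
itself expanded to first order in the second variable. -/
lemma AnalyticAt.exists_expansion_fst {A : ℂ × ℂ → ℂ} (hA : AnalyticAt ℂ A 0) :
    ∃ α₀ α₁ : ℂ, ∃ C, ∀ᶠ p : ℂ × ℂ in 𝓝 0,
      ‖A p - A (0, p.2) - p.1 * (α₀ + α₁ * p.2)‖ ≤ C * (‖p.1‖ ^ 2 + ‖p.1‖ * ‖p.2‖ ^ 2) := by
  set B : ℂ × ℂ → ℂ := fun p => fderiv ℂ A p (1, 0) with hBdef
  have hB : AnalyticAt ℂ B 0 :=
    ((ContinuousLinearMap.apply ℂ ℂ ((1, 0) : ℂ × ℂ)).analyticAt _).comp hA.fderiv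
  have hb : AnalyticAt ℂ (fun w : ℂ => B (0, w)) 0 := by
    have h1 : AnalyticAt ℂ (fun w : ℂ => ((0 : ℂ), w)) 0 := analyticAt_const.prod analyticAt_id
    exact AnalyticAt.comp (g := B) (f := fun w : ℂ => ((0 : ℂ), w)) hB h1
  obtain ⟨C, hC⟩ := hb.exists_norm_sub_sub_le
  obtain ⟨r, hr, M, hM0, hBd, hBM⟩ := hB.exists_ball_bound
  obtain ⟨s, hs, hsC⟩ := Metric.eventually_nhds_iff_ball.1 hC
  obtain ⟨s', hs', hsA⟩ := Metric.eventually_nhds_iff_ball.1 hA.eventually_analyticAt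
  refine ⟨B 0, deriv (fun w : ℂ => B (0, w)) 0, M / (r - r / 2) + |C|, ?_⟩
  have hpos : 0 < min (r / 2) (min s s') := by positivity
  filter_upwards [Metric.ball_mem_nhds (0 : ℂ × ℂ) hpos] with p hp
  obtain ⟨z, w⟩ := p
  simp only [mem_ball_zero_iff, Prod.norm_def, max_lt_iff, lt_min_iff] at hp
  obtain ⟨⟨hz1, hw1⟩, ⟨-, hw2⟩, hz3, hw3⟩ := hp
  set α₁ := deriv (fun w : ℂ => B (0, w)) 0
  have hder : ∀ ζ ∈ Metric.closedBall (0 : ℂ) ‖z‖,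
      HasDerivWithinAt (fun ζ => A (ζ, w) - ζ * (B 0 + α₁ * w)) (B (ζ, w) - (B 0 + α₁ * w))
        (Metric.closedBall (0 : ℂ) ‖z‖) ζ := by
    intro ζ hζ
    rw [mem_closedBall_zero_iff] at hζ
    have h1 : DifferentiableAt ℂ A (ζ, w) := by
      apply (hsA (ζ, w) _).differentiableAt
      simp only [mem_ball_zero_iff, Prod.norm_def, max_lt_iff]
      exact ⟨hζ.trans_lt hz3, hw3⟩
    have h2 : HasDerivAt (fun ζ : ℂ => (ζ, w)) ((1 : ℂ), (0 : ℂ)) ζ :=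
      (hasDerivAt_id ζ).prodMk (hasDerivAt_const ζ w)
    have h3 : HasDerivAt (fun ζ => A (ζ, w)) (B (ζ, w)) ζ :=
      h1.hasFDerivAt.comp_hasDerivAt ζ h2
    have h4 : HasDerivAt (fun ζ : ℂ => ζ * (B 0 + α₁ * w)) (B 0 + α₁ * w) ζ := by
      simpa using (hasDerivAt_id ζ).mul_const (B 0 + α₁ * w)
    exact (h3.sub h4).hasDerivWithinAt
  have hbd : ∀ ζ ∈ Metric.closedBall (0 : ℂ) ‖z‖,
      ‖B (ζ, w) - (B 0 + α₁ * w)‖ ≤ (M / (r - r / 2) + |C|) * (‖z‖ + ‖w‖ ^ 2) := by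
    intro ζ hζ
    rw [mem_closedBall_zero_iff] at hζ
    have h1 : ‖B (ζ, w) - B (0, w)‖ ≤ M / (r - r / 2) * ‖(ζ, w) - ((0 : ℂ), w)‖ := by
      apply norm_sub_le_of_mem_ball hBd hBM (by linarith) <;>
        simp only [mem_ball_zero_iff, Prod.norm_def, max_lt_iff]
      · exact ⟨hζ.trans_lt hz1, hw1⟩
      · exact ⟨by simpa using hr, hw1⟩
    have e1 : ‖(ζ, w) - ((0 : ℂ), w)‖ = ‖ζ‖ := by simp [Prod.norm_def]
    rw [e1] at h1
    have h2 : ‖B (0, w) - B 0 - α₁ * w‖ ≤ C * ‖w‖ ^ 2 := hsC w (by simpa using hw2)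
    have h3 : C * ‖w‖ ^ 2 ≤ |C| * ‖w‖ ^ 2 := by gcongr; exact le_abs_self C
    have h4 : 0 ≤ M / (r - r / 2) := div_nonneg hM0.le (by linarith)
    calc ‖B (ζ, w) - (B 0 + α₁ * w)‖ = ‖(B (ζ, w) - B (0, w)) + (B (0, w) - B 0 - α₁ * w)‖ := by
          congr 1; ring
      _ ≤ M / (r - r / 2) * ‖ζ‖ + |C| * ‖w‖ ^ 2 := (norm_add_le _ _).trans (by linarith)
      _ ≤ M / (r - r / 2) * ‖z‖ + |C| * ‖w‖ ^ 2 := by gcongr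
      _ ≤ _ := by
          have := mul_nonneg h4 (sq_nonneg ‖w‖)
          have := mul_nonneg (abs_nonneg C) (norm_nonneg z)
          linarith
  have := (convex_closedBall (0 : ℂ) ‖z‖).norm_image_sub_le_of_norm_hasDerivWithin_le hder hbd
    (Metric.mem_closedBall_self (norm_nonneg z)) (y := z) (by simp)
  calc _ = ‖A (z, w) - z * (B 0 + α₁ * w) - (A (0, w) - 0 * (B 0 + α₁ * w))‖ := by
        congr 1; ring
    _ ≤ _ := this
    _ = _ := by rw [sub_zero]; ring

/-! ### The normal form of the germ -/

/-- The information on the germ of `F` at the origin that governs the dynamics: in the coordinate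
`1 / z` the first component is the translation by the germ `A`, which restricts to `-1 + g` on
`{z = 0}`, and the second component is `w - z w² (1 + h(w))` up to an error of order four which is
divisible by `z²`. -/
structure IsNormalForm (F : ℂ × ℂ → ℂ × ℂ) (A : ℂ × ℂ → ℂ) (g h : ℂ → ℂ) : Prop where
  analyticAt_A : AnalyticAt ℂ A 0
  analyticAt_g : AnalyticAt ℂ g 0
  analyticAt_h : AnalyticAt ℂ h 0
  g_zero : g 0 = 0
  h_zero : h 0 = 0
  A_zero : ∀ᶠ w in 𝓝 (0 : ℂ), A (0, w) = -1 + g w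
  fst : ∀ᶠ p : ℂ × ℂ in 𝓝 0, p.1 ≠ 0 → (F p).1 ≠ 0 ∧ ((F p).1)⁻¹ = p.1⁻¹ + A p
  snd : ∃ C, ∀ᶠ p : ℂ × ℂ in 𝓝 0,
    ‖(F p).2 - (p.2 - p.1 * p.2 ^ 2 * (1 + h p.2))‖ ≤ C * (‖p.1‖ ^ 2 * (‖p.1‖ + ‖p.2‖) ^ 2)

lemma iteratedDeriv_two_of_eq {f φ : ℂ → ℂ} (hφ : AnalyticAt ℂ φ 0)
    (hf : ∀ᶠ z in 𝓝 0, f z = z + z ^ 2 * φ z) : iteratedDeriv 2 f 0 = 2 * φ 0 := by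
  have h1 : deriv f =ᶠ[𝓝 0] fun z => 1 + z * (2 * φ z + z * deriv φ z) := by
    filter_upwards [hf.eventually_nhds, hφ.eventually_analyticAt] with z hz hφz
    rw [EventuallyEq.deriv_eq (f := fun z => z + z ^ 2 * φ z) hz]
    have h2 := (hasDerivAt_id z).add (((hasDerivAt_id z).pow 2).mul
      hφz.differentiableAt.hasDerivAt)
    have h3 : HasDerivAt (fun z => z + z ^ 2 * φ z) _ z := h2
    rw [h3.deriv]
    simp
    ring
  rw [iteratedDeriv_succ, iteratedDeriv_one, h1.deriv_eq]
  have h4 := (hasDerivAt_id (0 : ℂ)).mul ((hφ.differentiableAt.hasDerivAt.const_mul 2).add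
    ((hasDerivAt_id (0 : ℂ)).mul hφ.deriv.differentiableAt.hasDerivAt))
  have h5 : HasDerivAt (fun z => 1 + z * (2 * φ z + z * deriv φ z)) _ 0 := h4.const_add 1
  rw [h5.deriv]
  simp

lemma deriv_of_eq_add_mul {f φ : ℂ → ℂ} {c : ℂ} (hφ : AnalyticAt ℂ φ 0)
    (hf : ∀ᶠ z in 𝓝 0, f z = c + z * φ z) : deriv f 0 = φ 0 := by
  rw [EventuallyEq.deriv_eq (f := fun z => c + z * φ z) hf]
  have h1 : HasDerivAt (fun z => c + z * φ z) _ 0 :=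
    ((hasDerivAt_id (0 : ℂ)).mul hφ.differentiableAt.hasDerivAt).const_add c
  rw [h1.deriv]
  simp

lemma AnalyticAt.comp_prodMk_left {f : ℂ × ℂ → ℂ} {z w : ℂ} (hf : AnalyticAt ℂ f (z, w)) :
    AnalyticAt ℂ (fun ζ => f (ζ, w)) z :=
  AnalyticAt.comp (g := f) (f := fun ζ : ℂ => (ζ, w)) hf (analyticAt_id.prod analyticAt_const)

lemma AnalyticAt.comp_prodMk_right {f : ℂ × ℂ → ℂ} {z w : ℂ} (hf : AnalyticAt ℂ f (z, w)) :
    AnalyticAt ℂ (fun ζ => f (z, ζ)) w :=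
  AnalyticAt.comp (g := f) (f := fun ζ : ℂ => (z, ζ)) hf (analyticAt_const.prod analyticAt_id)

lemma AnalyticAt.exists_norm_sub_le {f : ℂ × ℂ → ℂ} (hf : AnalyticAt ℂ f 0) :
    ∃ C > 0, ∀ᶠ p : ℂ × ℂ in 𝓝 0, ‖f p‖ ≤ C ∧ ‖f p - f (0, p.2)‖ ≤ C * ‖p.1‖ := by
  obtain ⟨r, hr, M, hM0, hd, hM⟩ := hf.exists_ball_bound
  refine ⟨M + M / (r - r / 2), by rw [sub_half]; positivity, ?_⟩
  have hpos : 0 ≤ M / (r - r / 2) := by rw [sub_half]; positivity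
  filter_upwards [Metric.ball_mem_nhds (0 : ℂ × ℂ) (half_pos hr)] with p hp
  have hp' : ((0 : ℂ), p.2) ∈ Metric.ball (0 : ℂ × ℂ) (r / 2) := by
    simp only [mem_ball_zero_iff, Prod.norm_def, max_lt_iff] at hp ⊢
    exact ⟨by simpa using hr, hp.2⟩
  refine ⟨?_, ?_⟩
  · have := hM p (Metric.ball_subset_ball (by linarith) hp)
    linarith
  · have := norm_sub_le_of_mem_ball hd hM (by linarith) hp hp'
    have e : ‖p - (0, p.2)‖ = ‖p.1‖ := by simp [Prod.norm_def]
    rw [e] at this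
    nlinarith [norm_nonneg p.1]

/-- As `F₁ = z (1 + z u)`, the germ `A` is `-u / (1 + z u)`. The values of `b₄` on `{z = 0}` enter
`h`; all other error terms of the second component are divisible by `z²` and of order four. -/
lemma HasGerm.exists_isNormalForm {F : ℂ × ℂ → ℂ × ℂ} (hF : HasGerm F) :
    ∃ A g h, IsNormalForm F A g h ∧ (∀ᶠ u in 𝓝 0, gFun F u = g u) ∧
      ∀ᶠ u in 𝓝 0, u ≠ 0 → hFun F u = h u := by
  obtain ⟨a₁, a₂, b₁, b₂, b₃, b₄, ha₁, ha₂, hb₁, hb₂, hb₃, hb₄, hF⟩ := hF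
  set u : ℂ × ℂ → ℂ := fun p => 1 + p.1 * a₁ p + p.2 * a₂ p with hu
  have hu_an : AnalyticAt ℂ u 0 :=
    (analyticAt_const.add (analyticAt_fst.mul ha₁)).add (analyticAt_snd.mul ha₂)
  set d : ℂ × ℂ → ℂ := fun p => 1 + p.1 * u p with hd
  have hd_an : AnalyticAt ℂ d 0 := analyticAt_const.add (analyticAt_fst.mul hu_an)
  have hd0 : d 0 = 1 := by simp [hd]
  have hslice : Tendsto (fun w : ℂ => ((0 : ℂ), w)) (𝓝 0) (𝓝 0) := by
    have : Continuous fun w : ℂ => ((0 : ℂ), w) := by fun_prop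
    exact this.tendsto' 0 0 rfl
  have hg_an : AnalyticAt ℂ (fun w : ℂ => -(w * a₂ (0, w))) 0 :=
    (analyticAt_id.mul (ha₂.comp_prodMk_right (z := 0) (w := 0))).neg
  have hh_an : AnalyticAt ℂ (fun w : ℂ => -(w * b₄ (0, w))) 0 :=
    (analyticAt_id.mul (hb₄.comp_prodMk_right (z := 0) (w := 0))).neg
  refine ⟨fun p => -(u p / d p), fun w => -(w * a₂ (0, w)), fun w => -(w * b₄ (0, w)),
    ⟨(hu_an.div hd_an (by simp [hd0])).neg, hg_an, hh_an, by simp, by simp, ?_, ?_, ?_⟩, ?_, ?_⟩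
  · filter_upwards with w
    simp [hu, hd]
    ring
  · have hdne : ∀ᶠ p in 𝓝 0, d p ≠ 0 := hd_an.continuousAt.eventually_ne (by simp [hd0])
    filter_upwards [hF, hdne] with p hp hdp hp0
    have e : (F p).1 = p.1 * d p := by rw [hp.1, hd, hu]; ring
    have e' : p.1 * u p = d p - 1 := by simp [hd]
    rw [e]
    refine ⟨mul_ne_zero hp0 hdp, ?_⟩
    field_simp
    linear_combination e'
  · obtain ⟨C₁, hC₁, h₁⟩ := hb₁.exists_norm_sub_le
    obtain ⟨C₂, hC₂, h₂⟩ := hb₂.exists_norm_sub_le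
    obtain ⟨C₃, hC₃, h₃⟩ := hb₃.exists_norm_sub_le
    obtain ⟨C₄, hC₄, h₄⟩ := hb₄.exists_norm_sub_le
    refine ⟨C₁ + C₂ + C₃ + C₄, ?_⟩
    filter_upwards [hF, h₁, h₂, h₃, h₄, Metric.ball_mem_nhds (0 : ℂ × ℂ) one_pos]
      with p hp h₁ h₂ h₃ h₄ hp1
    rw [mem_ball_zero_iff] at hp1
    have hw1 : ‖p.2‖ ≤ 1 := (norm_snd_le p).trans hp1.le
    have e : (F p).2 - (p.2 - p.1 * p.2 ^ 2 * (1 + -(p.2 * b₄ (0, p.2)))) =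
        p.1 ^ 4 * b₁ p + p.1 ^ 3 * p.2 * b₂ p + p.1 ^ 2 * p.2 ^ 2 * b₃ p +
          p.1 * p.2 ^ 3 * (b₄ p - b₄ (0, p.2)) := by
      rw [hp.2]; ring
    rw [e]
    set z := ‖p.1‖
    set w := ‖p.2‖
    have hz : 0 ≤ z := norm_nonneg _
    have hw : 0 ≤ w := norm_nonneg _
    have t₁ : ‖p.1 ^ 4 * b₁ p‖ ≤ C₁ * (z ^ 2 * (z + w) ^ 2) := by
      rw [norm_mul, norm_pow]
      calc z ^ 4 * ‖b₁ p‖ ≤ z ^ 4 * C₁ := by gcongr; exact h₁.1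
        _ = C₁ * (z ^ 2 * (z + 0) ^ 2) := by ring
        _ ≤ _ := by gcongr
    have t₂ : ‖p.1 ^ 3 * p.2 * b₂ p‖ ≤ C₂ * (z ^ 2 * (z + w) ^ 2) := by
      rw [norm_mul, norm_mul, norm_pow]
      calc z ^ 3 * w * ‖b₂ p‖ ≤ z ^ 3 * w * C₂ := by gcongr; exact h₂.1
        _ = C₂ * (z ^ 2 * (z * w)) := by ring
        _ ≤ _ := by gcongr; nlinarith
    have t₃ : ‖p.1 ^ 2 * p.2 ^ 2 * b₃ p‖ ≤ C₃ * (z ^ 2 * (z + w) ^ 2) := by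
      rw [norm_mul, norm_mul, norm_pow, norm_pow]
      calc z ^ 2 * w ^ 2 * ‖b₃ p‖ ≤ z ^ 2 * w ^ 2 * C₃ := by gcongr; exact h₃.1
        _ = C₃ * (z ^ 2 * (0 + w) ^ 2) := by ring
        _ ≤ _ := by gcongr
    have t₄ : ‖p.1 * p.2 ^ 3 * (b₄ p - b₄ (0, p.2))‖ ≤ C₄ * (z ^ 2 * (z + w) ^ 2) := by
      rw [norm_mul, norm_mul, norm_pow]
      calc z * w ^ 3 * ‖b₄ p - b₄ (0, p.2)‖ ≤ z * w ^ 3 * (C₄ * z) := by gcongr; exact h₄.2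
        _ = C₄ * (z ^ 2 * (w ^ 2 * w)) := by ring
        _ ≤ C₄ * (z ^ 2 * (w ^ 2 * 1)) := by gcongr
        _ = C₄ * (z ^ 2 * (0 + w) ^ 2) := by ring
        _ ≤ _ := by gcongr
    calc _ ≤ _ := norm_add_le _ _
      _ ≤ _ := add_le_add_left (norm_add₃_le) _
      _ ≤ _ := by linarith
  · filter_upwards [hslice.eventually hF.eventually_nhds, hslice.eventually
      ha₁.eventually_analyticAt, hslice.eventually ha₂.eventually_analyticAt] with w hw hw₁ hw₂
    have hline : Tendsto (fun z : ℂ => (z, w)) (𝓝 0) (𝓝 (0, w)) := by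
      have : Continuous fun z : ℂ => (z, w) := by fun_prop
      exact this.tendsto 0
    have := iteratedDeriv_two_of_eq (f := fun z => (F (z, w)).1)
      (φ := fun z => 1 + z * a₁ (z, w) + w * a₂ (z, w))
      ((analyticAt_const.add (analyticAt_id.mul hw₁.comp_prodMk_left)).add
        (analyticAt_const.mul hw₂.comp_prodMk_left)) (by
        filter_upwards [hline.eventually hw] with z hz
        rw [hz.1]; ring)
    rw [gFun, this]
    ring
  · filter_upwards [hslice.eventually hF.eventually_nhds, hslice.eventually
      hb₁.eventually_analyticAt, hslice.eventually hb₂.eventually_analyticAt,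
      hslice.eventually hb₃.eventually_analyticAt,
      hslice.eventually hb₄.eventually_analyticAt] with w hw hw₁ hw₂ hw₃ hw₄ hw0
    have hline : Tendsto (fun z : ℂ => (z, w)) (𝓝 0) (𝓝 (0, w)) := by
      have : Continuous fun z : ℂ => (z, w) := by fun_prop
      exact this.tendsto 0
    have := deriv_of_eq_add_mul (f := fun z => (F (z, w)).2) (c := w)
      (φ := fun z => -w ^ 2 + z ^ 3 * b₁ (z, w) + z ^ 2 * w * b₂ (z, w) + z * w ^ 2 * b₃ (z, w) +
        w ^ 3 * b₄ (z, w))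
      ((((analyticAt_const.add ((analyticAt_id.pow 3).mul hw₁.comp_prodMk_left)).add
        (((analyticAt_id.pow 2).mul analyticAt_const).mul hw₂.comp_prodMk_left)).add
        ((analyticAt_id.mul analyticAt_const).mul hw₃.comp_prodMk_left)).add
        (analyticAt_const.mul hw₄.comp_prodMk_left)) (by
        filter_upwards [hline.eventually hw] with z hz
        rw [hz.2]; ring)
    rw [hFun, this]
    field_simp
    ring

/-! ### Estimates near the parabolic curve -/

/-- Points `(1 / x, w)` with `|x| ≥ N / 5` and `|w| ≤ 100 / N²`. -/
def perronRegion (N : ℝ) : Set (ℂ × ℂ) := {q | N / 5 ≤ ‖q.1‖ ∧ ‖q.2‖ ≤ 100 / N ^ 2}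

/-- Estimates for `F` in the coordinates `(x, w) = (1 / z, w)` on the regions `perronRegion N` with
`N ≥ R`, normalized so that the Perron operator is a contraction: two points are regarded as
`d`-close if their coordinates differ by at most `d N` and `d / N²`. -/
structure PerronBounds (F : ℂ × ℂ → ℂ × ℂ) (A : ℂ × ℂ → ℂ) (R K : ℝ) : Prop where
  one_le : 1 ≤ R
  nonneg : 0 ≤ K
  six_mul_le : 6 * K ≤ R
  fst : ∀ N ≥ R, ∀ q ∈ perronRegion N,
    (F (q.1⁻¹, q.2)).1 ≠ 0 ∧ (F (q.1⁻¹, q.2)).1⁻¹ = q.1 + A (q.1⁻¹, q.2)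
  norm_A_add_one_le : ∀ N ≥ R, ∀ q ∈ perronRegion N, ‖A (q.1⁻¹, q.2) + 1‖ ≤ 1 / 20
  differentiableAt_A : ∀ N ≥ R, ∀ q ∈ perronRegion N, DifferentiableAt ℂ A (q.1⁻¹, q.2)
  norm_A_sub_le : ∀ N ≥ R, ∀ q ∈ perronRegion N, ∀ q' ∈ perronRegion N, ∀ d, 0 ≤ d →
    ‖q.1 - q'.1‖ ≤ d * N → ‖q.2 - q'.2‖ ≤ d / N ^ 2 →
    ‖A (q.1⁻¹, q.2) - A (q'.1⁻¹, q'.2)‖ ≤ d / 2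
  norm_E_le : ∀ N ≥ R, ∀ q ∈ perronRegion N, ‖(F (q.1⁻¹, q.2)).2 - q.2‖ ≤ K / N ^ 4
  norm_E_sub_le : ∀ N ≥ R, ∀ q ∈ perronRegion N, ∀ q' ∈ perronRegion N, ∀ d, 0 ≤ d →
    ‖q.1 - q'.1‖ ≤ d * N → ‖q.2 - q'.2‖ ≤ d / N ^ 2 →
    ‖((F (q.1⁻¹, q.2)).2 - q.2) - ((F (q'.1⁻¹, q'.2)).2 - q'.2)‖ ≤ K * d / N ^ 4

lemma norm_inv_sub_inv_le {x x' : ℂ} {N d : ℝ} (hN : 0 < N) (hx : N / 5 ≤ ‖x‖)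
    (hx' : N / 5 ≤ ‖x'‖) (hd : ‖x - x'‖ ≤ d * N) : ‖x⁻¹ - x'⁻¹‖ ≤ 25 * d / N := by
  have h1 : 0 < ‖x‖ := by linarith [show 0 < N / 5 by positivity]
  have h2 : 0 < ‖x'‖ := by linarith [show 0 < N / 5 by positivity]
  rw [inv_sub_inv (norm_pos_iff.1 h1) (norm_pos_iff.1 h2), norm_div, norm_mul, norm_sub_rev]
  calc ‖x - x'‖ / (‖x‖ * ‖x'‖) ≤ d * N / (N / 5 * (N / 5)) := by
        gcongr
        exact (norm_nonneg _).trans hd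
    _ = 25 * d / N := by field_simp; ring

/-- The Lipschitz estimate for the second component comes from Cauchy's estimate after the rescaling
`z = p₁ / N`, `w = p₂ / N²`, in which the increment of `w` is of size `N⁻⁴` on a fixed polydisc. -/
lemma IsNormalForm.exists_perronBounds {F : ℂ × ℂ → ℂ × ℂ} {A : ℂ × ℂ → ℂ} {g h : ℂ → ℂ}
    (hF : Differentiable ℂ F) (hN : IsNormalForm F A g h) : ∃ R K, PerronBounds F A R K := by
  obtain ⟨C, hC⟩ := hN.snd
  obtain ⟨r, hr, M, hM0, hAd, hAM⟩ := hN.analyticAt_A.exists_ball_bound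
  have hA1 : ∀ᶠ p in 𝓝 (0 : ℂ × ℂ), ‖A p + 1‖ < 1 / 20 := by
    have h0 : A 0 = -1 := by
      have h := hN.A_zero.self_of_nhds
      rwa [hN.g_zero, add_zero] at h
    have : Tendsto (fun p => ‖A p + 1‖) (𝓝 0) (𝓝 0) := by
      have := (hN.analyticAt_A.continuousAt.add (continuousAt_const (y := (1 : ℂ)))).norm.tendsto
      simpa [h0] using this
    exact this.eventually_lt_const (by norm_num)
  have hh1 : ∀ᶠ p in 𝓝 (0 : ℂ × ℂ), ‖1 + h p.2‖ < 2 := by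
    have : Tendsto (fun p : ℂ × ℂ => ‖1 + h p.2‖) (𝓝 0) (𝓝 1) := by
      have h2 : ContinuousAt (fun p : ℂ × ℂ => h p.2) 0 :=
        ContinuousAt.comp (g := h) (f := Prod.snd) hN.analyticAt_h.continuousAt continuousAt_snd
      simpa [hN.h_zero] using (h2.const_add (1 : ℂ)).norm.tendsto
    exact this.eventually_lt_const (by norm_num)
  obtain ⟨s, hs, hsall⟩ := Metric.eventually_nhds_iff_ball.1
    (((hC.and hA1).and hh1).and hN.fst)
  set K₀ : ℝ := 2 * 200 ^ 3 + |C| * (200 ^ 2 * 400 ^ 2) with hK₀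
  have hK₀' : 0 ≤ K₀ := by positivity
  -- all points in question lie in a small ball about the origin
  obtain ⟨R, hR1, hRr, hRs, hRA, hRK⟩ : ∃ R : ℝ, 1 ≤ R ∧ 200 / R < r / 2 ∧ 200 / R < s ∧
      M / (r - r / 2) * (25 / R) ≤ 1 / 2 ∧ 6 * K₀ ≤ R := by
    have t1 : Tendsto (fun R : ℝ => 200 / R) atTop (𝓝 0) := tendsto_const_nhds.div_atTop tendsto_id
    have t2 : Tendsto (fun R : ℝ => M / (r - r / 2) * (25 / R)) atTop (𝓝 0) := by
      simpa using (tendsto_const_nhds.div_atTop tendsto_id :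
        Tendsto (fun R : ℝ => 25 / R) atTop (𝓝 0)).const_mul (M / (r - r / 2))
    exact ((eventually_ge_atTop 1).and ((t1.eventually_lt_const (half_pos hr)).and
      ((t1.eventually_lt_const hs).and ((t2.eventually_le_const (by norm_num)).and
        (eventually_ge_atTop (6 * K₀)))))).exists
  have hpos : ∀ N ≥ R, 0 < N := fun N hN => by linarith
  have hinv : ∀ N ≥ R, ∀ q ∈ perronRegion N, q.1 ≠ 0 ∧ ‖q.1⁻¹‖ ≤ 5 / N ∧ ‖q.2‖ ≤ 100 / N := by
    intro N hN q hq
    have h0 := hpos N hN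
    have h1 : 0 < ‖q.1‖ := lt_of_lt_of_le (by positivity) hq.1
    refine ⟨norm_pos_iff.1 h1, ?_, hq.2.trans ?_⟩
    · rw [norm_inv]
      calc ‖q.1‖⁻¹ ≤ (N / 5)⁻¹ := by gcongr; exact hq.1
        _ = 5 / N := by rw [inv_div]
    · gcongr
      nlinarith
  have hball : ∀ N ≥ R, ∀ q ∈ perronRegion N, ‖(q.1⁻¹, q.2)‖ < 200 / R := by
    intro N hN q hq
    obtain ⟨-, h1, h2⟩ := hinv N hN q hq
    have h0 := hpos N hN
    have h3 : 100 / N < 200 / R := by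
      rw [div_lt_div_iff₀ h0 (by linarith)]
      nlinarith
    have h4 : 5 / N ≤ 100 / N := by gcongr; norm_num
    rw [Prod.norm_def, max_lt_iff]
    exact ⟨by simpa using h1.trans_lt (h4.trans_lt h3), h2.trans_lt h3⟩
  have hbs : ∀ N ≥ R, ∀ q ∈ perronRegion N, (q.1⁻¹, q.2) ∈ Metric.ball (0 : ℂ × ℂ) s := by
    intro N hN q hq
    rw [mem_ball_zero_iff]
    exact (hball N hN q hq).trans hRs
  have hbr : ∀ N ≥ R, ∀ q ∈ perronRegion N,
      (q.1⁻¹, q.2) ∈ Metric.ball (0 : ℂ × ℂ) (r / 2) := by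
    intro N hN q hq
    rw [mem_ball_zero_iff]
    exact (hball N hN q hq).trans hRr
  -- the rescaled second component
  set e : ℝ → ℂ × ℂ → ℂ := fun N p =>
    (F ((N : ℂ)⁻¹ * p.1, ((N : ℂ) ^ 2)⁻¹ * p.2)).2 - ((N : ℂ) ^ 2)⁻¹ * p.2 with he
  have he_diff : ∀ N, Differentiable ℂ (e N) := by
    intro N
    have h1 : Differentiable ℂ fun p : ℂ × ℂ => ((N : ℂ)⁻¹ * p.1, ((N : ℂ) ^ 2)⁻¹ * p.2) := by
      fun_prop
    have h2 : Differentiable ℂ fun p : ℂ × ℂ => ((N : ℂ) ^ 2)⁻¹ * p.2 := by fun_prop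
    exact (hF.comp h1).snd.sub h2
  have he_bd : ∀ N ≥ R, ∀ p ∈ Metric.ball (0 : ℂ × ℂ) 200, ‖e N p‖ ≤ K₀ / N ^ 4 := by
    intro N hN p hp
    have h0 := hpos N hN
    have hN1 : 1 ≤ N := hR1.trans hN
    simp only [mem_ball_zero_iff, Prod.norm_def, max_lt_iff] at hp
    set z : ℂ := (N : ℂ)⁻¹ * p.1
    set w : ℂ := ((N : ℂ) ^ 2)⁻¹ * p.2
    have hz : ‖z‖ ≤ 200 / N := by
      rw [norm_mul, norm_inv, Complex.norm_real, Real.norm_eq_abs, abs_of_pos h0, div_eq_inv_mul]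
      gcongr
      exact hp.1.le
    have hw : ‖w‖ ≤ 200 / N ^ 2 := by
      rw [norm_mul, norm_inv, norm_pow, Complex.norm_real, Real.norm_eq_abs, abs_of_pos h0,
        div_eq_inv_mul]
      gcongr
      exact hp.2.le
    have hw' : ‖w‖ ≤ 200 / N := by
      apply hw.trans
      gcongr
      nlinarith
    have hmem : (z, w) ∈ Metric.ball (0 : ℂ × ℂ) s := by
      have h5 : 200 / N ≤ 200 / R := by gcongr
      rw [mem_ball_zero_iff, Prod.norm_def, max_lt_iff]
      exact ⟨(hz.trans h5).trans_lt hRs, (hw'.trans h5).trans_lt hRs⟩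
    obtain ⟨⟨⟨hC', -⟩, hh'⟩, -⟩ := hsall (z, w) hmem
    have e1 : e N p = ((F (z, w)).2 - (w - z * w ^ 2 * (1 + h w))) - z * w ^ 2 * (1 + h w) := by
      simp only [he]; ring
    rw [e1]
    have t1 : ‖z * w ^ 2 * (1 + h w)‖ ≤ 200 / N * (200 / N ^ 2) ^ 2 * 2 := by
      rw [norm_mul, norm_mul, norm_pow]
      gcongr
    have t2 : C * (‖z‖ ^ 2 * (‖z‖ + ‖w‖) ^ 2) ≤
        |C| * ((200 / N) ^ 2 * (200 / N + 200 / N) ^ 2) := by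
      gcongr
      exact le_abs_self C
    have t3 : 200 / N * (200 / N ^ 2) ^ 2 * 2 ≤ 2 * 200 ^ 3 / N ^ 4 := by
      have : 200 / N * (200 / N ^ 2) ^ 2 * 2 = 2 * 200 ^ 3 / N ^ 4 / N := by field_simp
      rw [this]
      exact div_le_self (by positivity) hN1
    calc _ ≤ _ := norm_sub_le _ _
      _ ≤ |C| * ((200 / N) ^ 2 * (200 / N + 200 / N) ^ 2) + 2 * 200 ^ 3 / N ^ 4 :=
        add_le_add (hC'.trans t2) (t1.trans t3)
      _ = K₀ / N ^ 4 := by rw [hK₀]; field_simp; ring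
  have hE : ∀ N ≥ R, ∀ q ∈ perronRegion N,
      ((N : ℂ) * q.1⁻¹, (N : ℂ) ^ 2 * q.2) ∈ Metric.ball (0 : ℂ × ℂ) 101 ∧
        e N ((N : ℂ) * q.1⁻¹, (N : ℂ) ^ 2 * q.2) = (F (q.1⁻¹, q.2)).2 - q.2 := by
    intro N hN q hq
    obtain ⟨-, h1, -⟩ := hinv N hN q hq
    have h0 := hpos N hN
    have hNc : (N : ℂ) ≠ 0 := by exact_mod_cast h0.ne'
    refine ⟨?_, ?_⟩
    · have e1 : N * (5 / N) < 101 := by rw [mul_div_cancel₀ _ h0.ne']; norm_num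
      have e2 : N ^ 2 * (100 / N ^ 2) < 101 := by
        rw [mul_div_cancel₀ _ (by positivity)]; norm_num
      simp only [mem_ball_zero_iff, Prod.norm_def, max_lt_iff, norm_mul, norm_pow,
        Complex.norm_real, Real.norm_eq_abs, abs_of_pos h0]
      exact ⟨lt_of_le_of_lt (by gcongr) e1, lt_of_le_of_lt (by gcongr; exact hq.2) e2⟩
    · simp only [he]
      rw [inv_mul_cancel_left₀ hNc, inv_mul_cancel_left₀ (pow_ne_zero 2 hNc)]
  refine ⟨R, K₀, hR1, hK₀', hRK, ?_, ?_, ?_, ?_, ?_, ?_⟩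
  · intro N hN q hq
    have := (hsall _ (hbs N hN q hq)).2 (inv_ne_zero (hinv N hN q hq).1)
    rwa [inv_inv] at this
  · intro N hN q hq
    exact (hsall _ (hbs N hN q hq)).1.1.2.le
  · intro N hN q hq
    exact hAd.differentiableAt (Metric.isOpen_ball.mem_nhds
      (Metric.ball_subset_ball (by linarith) (hbr N hN q hq)))
  · intro N hN q hq q' hq' d hd h1 h2
    have h0 := hpos N hN
    have hlip := norm_sub_le_of_mem_ball hAd hAM (by linarith) (hbr N hN q hq) (hbr N hN q' hq')
    have hinv' := norm_inv_sub_inv_le h0 hq.1 hq'.1 h1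
    have h3 : ‖(q.1⁻¹, q.2) - (q'.1⁻¹, q'.2)‖ ≤ 25 / R * d := by
      rw [Prod.mk_sub_mk, Prod.norm_def, max_le_iff]
      refine ⟨hinv'.trans ?_, h2.trans ?_⟩
      · rw [div_mul_eq_mul_div]
        gcongr
      · have hR2 : R ≤ N ^ 2 := by nlinarith
        calc d / N ^ 2 ≤ 25 * d / R := by gcongr; linarith
          _ = _ := by rw [div_mul_eq_mul_div]
    calc _ ≤ _ := hlip
      _ ≤ M / (r - r / 2) * (25 / R * d) := by
        have : 0 ≤ M / (r - r / 2) := div_nonneg hM0.le (by linarith)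
        gcongr
      _ = M / (r - r / 2) * (25 / R) * d := by ring
      _ ≤ 1 / 2 * d := by gcongr
      _ = d / 2 := by ring
  · intro N hN q hq
    obtain ⟨hmem, heq⟩ := hE N hN q hq
    rw [← heq]
    exact he_bd N hN _ (Metric.ball_subset_ball (by norm_num) hmem)
  · intro N hN q hq q' hq' d hd h1 h2
    have h0 := hpos N hN
    obtain ⟨hmem, heq⟩ := hE N hN q hq
    obtain ⟨hmem', heq'⟩ := hE N hN q' hq'
    rw [← heq, ← heq']
    have hlip := norm_sub_le_of_mem_ball (he_diff N).differentiableOn (he_bd N hN)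
      (show (101 : ℝ) < 200 by norm_num) hmem hmem'
    have hinv' := norm_inv_sub_inv_le h0 hq.1 hq'.1 h1
    have h3 : ‖((N : ℂ) * q.1⁻¹, (N : ℂ) ^ 2 * q.2) -
        ((N : ℂ) * q'.1⁻¹, (N : ℂ) ^ 2 * q'.2)‖ ≤ 25 * d := by
      rw [Prod.mk_sub_mk, Prod.norm_def, max_le_iff, ← mul_sub, ← mul_sub]
      simp only [norm_mul, norm_pow, Complex.norm_real, Real.norm_eq_abs, abs_of_pos h0]
      constructor
      · calc N * ‖q.1⁻¹ - q'.1⁻¹‖ ≤ N * (25 * d / N) := by gcongr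
          _ = 25 * d := by field_simp
      · calc N ^ 2 * ‖q.2 - q'.2‖ ≤ N ^ 2 * (d / N ^ 2) := by gcongr
          _ = d := by field_simp
          _ ≤ 25 * d := by linarith
    calc _ ≤ _ := hlip
      _ ≤ K₀ / N ^ 4 / (200 - 101) * (25 * d) := by gcongr
      _ = K₀ * d / N ^ 4 * (25 / 99) := by ring
      _ ≤ K₀ * d / N ^ 4 * 1 := by gcongr; norm_num
      _ = _ := mul_one _

/-! ### The Perron operator -/

/-- Sums of terms of size `c / (N + k)⁴` are dominated by `3 c / N³`. -/
lemma norm_tsum_le_of_norm_le_div_pow {f : ℕ → ℂ} {N c : ℝ} (hN : 1 ≤ N) (hc : 0 ≤ c)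
    (hf : ∀ k : ℕ, ‖f k‖ ≤ c / (N + k) ^ 4) :
    Summable f ∧ ‖∑' k, f k‖ ≤ 3 * c / N ^ 3 := by
  -- compare with the telescoping series of the differences of `3 c / (N + k)³`
  have hterm : ∀ k : ℕ, c / (N + k) ^ 4 ≤ 3 * c / (N + k) ^ 3 - 3 * c / (N + (k + 1 : ℕ)) ^ 3 := by
    intro k
    have hM : 1 ≤ N + k := by have : (0 : ℝ) ≤ k := k.cast_nonneg; linarith
    push_cast
    rw [← add_assoc]
    set x := N + (k : ℝ)
    have h1 : 0 < x := by linarith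
    rw [div_sub_div _ _ (by positivity) (by positivity),
      div_le_div_iff₀ (by positivity) (by positivity)]
    have : 0 ≤ c * x ^ 3 * (x * (3 * (x + 1) ^ 3 - 3 * x ^ 3) - (x + 1) ^ 3) := by
      have : 0 ≤ x * (3 * (x + 1) ^ 3 - 3 * x ^ 3) - (x + 1) ^ 3 := by
        nlinarith [mul_nonneg (sub_nonneg.2 hM) (sq_nonneg x), mul_nonneg (sub_nonneg.2 hM) h1.le]
      positivity
    linarith
  have hsum : ∀ n : ℕ, ∑ k ∈ Finset.range n, c / (N + k) ^ 4 ≤ 3 * c / N ^ 3 := by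
    intro n
    have h1 := Finset.sum_le_sum (s := Finset.range n) fun k _ => hterm k
    rw [Finset.sum_range_sub' (fun k : ℕ => 3 * c / (N + k) ^ 3)] at h1
    have : 0 ≤ 3 * c / (N + n) ^ 3 := by positivity
    simp only [Nat.cast_zero, add_zero] at h1
    linarith
  have hpos : ∀ k : ℕ, 0 ≤ c / (N + k) ^ 4 := fun k => by positivity
  have hs := summable_of_sum_range_le hpos hsum
  exact ⟨Summable.of_norm_bounded hs hf,
    (tsum_of_norm_bounded hs.hasSum hf).trans (Real.tsum_le_of_sum_range_le hpos hsum)⟩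

/-- Sequences `(x_n, w_n)` such that `x_n` is close to `x - n` and `w_n = O((|x| + n)⁻²)`. -/
def IsAdmissible (x : ℂ) (q : ℕ → ℂ × ℂ) : Prop :=
  ∀ n : ℕ, ‖(q n).1 - (x - n)‖ ≤ n / 20 ∧ ‖(q n).2‖ ≤ 100 / (‖x‖ + n) ^ 2

/-- The weighted distance on sequences for which the Perron operator is a contraction. -/
def IsClose (x : ℂ) (d : ℝ) (q q' : ℕ → ℂ × ℂ) : Prop :=
  ∀ n : ℕ, ‖(q n).1 - (q' n).1‖ ≤ d * (‖x‖ + n) ∧ ‖(q n).2 - (q' n).2‖ ≤ d / (‖x‖ + n) ^ 2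

/-- The Perron operator, whose fixed points are the orbits `(1 / x_n, w_n)` of `F` with `x_0 = x`
and `w_n → 0`. -/
noncomputable def perronMap (F : ℂ × ℂ → ℂ × ℂ) (A : ℂ × ℂ → ℂ) (x : ℂ) (q : ℕ → ℂ × ℂ) (n : ℕ) :
    ℂ × ℂ :=
  (x + ∑ k ∈ Finset.range n, A ((q k).1⁻¹, (q k).2),
    -∑' k : ℕ, ((F ((q (k + n)).1⁻¹, (q (k + n)).2)).2 - (q (k + n)).2))

lemma IsAdmissible.mem_cone {x : ℂ} {q : ℕ → ℂ × ℂ} (hq : IsAdmissible x q)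
    (hx : x ∈ cone (3 / 4)) (n : ℕ) : (q n).1 ∈ cone (3 / 4) ∧ (‖x‖ + n) / 5 ≤ ‖(q n).1‖ := by
  have h := (hq n).1
  rcases n.eq_zero_or_pos with rfl | hn
  · simp only [Nat.cast_zero, sub_zero, zero_div, norm_le_zero_iff, sub_eq_zero] at h
    rw [h]
    refine ⟨hx, ?_⟩
    have := norm_nonneg x
    simp only [Nat.cast_zero]
    linarith
  have hn' : (0 : ℝ) < n := by exact_mod_cast hn
  set u := (q n).1 - x with hu
  have e : (q n).1 = x + u := by rw [hu]; ring
  have hcone : (-(n : ℂ)) ∈ cone (1 / 2) := by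
    change |(-(n : ℂ)).im| < -(1 / 2) * (-(n : ℂ)).re
    simp
    linarith
  have hnn : ‖-(n : ℂ)‖ = n := by simp
  have hu1 : ‖u - -(n : ℂ)‖ ≤ 1 / 20 * ‖-(n : ℂ)‖ := by
    rw [hnn, show u - -(n : ℂ) = (q n).1 - (x - n) by rw [hu]; ring]
    linarith
  have hu2 : u ∈ cone (3 / 4) :=
    mem_cone_of_norm_sub_le (by norm_num) (by norm_num) (by norm_num) (by norm_num) hcone hu1
  have hu3 : 19 / 20 * (n : ℝ) ≤ ‖u‖ := by
    have := norm_sub_norm_le (-(n : ℂ)) u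
    rw [norm_sub_rev (-(n : ℂ)) u] at this
    rw [hnn] at this hu1
    linarith
  rw [e]
  refine ⟨add_mem_cone hx hu2, ?_⟩
  have := norm_add_ge_of_mem_cone hx hu2
  have := norm_nonneg x
  linarith

section Perron

variable {F : ℂ × ℂ → ℂ × ℂ} {A : ℂ × ℂ → ℂ} {R K : ℝ} {x : ℂ} {q q' : ℕ → ℂ × ℂ}

lemma IsAdmissible.mem_perronRegion (hq : IsAdmissible x q) (hx : x ∈ cone (3 / 4)) (n : ℕ) :
    q n ∈ perronRegion (‖x‖ + n) :=
  ⟨(hq.mem_cone hx n).2, (hq n).2⟩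

lemma PerronBounds.norm_E_tail_le (hB : PerronBounds F A R K) (hx : x ∈ sector (3 / 4) R)
    (hq : IsAdmissible x q) (n : ℕ) :
    Summable (fun k : ℕ => (F ((q (k + n)).1⁻¹, (q (k + n)).2)).2 - (q (k + n)).2) ∧
    ‖∑' k : ℕ, ((F ((q (k + n)).1⁻¹, (q (k + n)).2)).2 - (q (k + n)).2)‖
      ≤ 3 * K / (‖x‖ + n) ^ 3 := by
  have h1 := hB.one_le
  have h2 := hx.2
  have hn : (0 : ℝ) ≤ n := n.cast_nonneg
  apply norm_tsum_le_of_norm_le_div_pow (by linarith) hB.nonneg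
  intro k
  have hk : (0 : ℝ) ≤ k := k.cast_nonneg
  have := hB.norm_E_le (‖x‖ + (k + n : ℕ)) (by push_cast; linarith) _
    (hq.mem_perronRegion hx.1 (k + n))
  rwa [show ‖x‖ + ((k + n : ℕ) : ℝ) = ‖x‖ + n + k by push_cast; ring] at this

lemma PerronBounds.norm_perronMap_snd_le (hB : PerronBounds F A R K) (hx : x ∈ sector (3 / 4) R)
    (hq : IsAdmissible x q) (n : ℕ) : ‖(perronMap F A x q n).2‖ ≤ 1 / (‖x‖ + n) ^ 2 := by
  have h1 := hB.one_le
  have h2 := hx.2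
  have hn : (0 : ℝ) ≤ n := n.cast_nonneg
  have hpos : 0 < ‖x‖ + n := by linarith
  rw [perronMap, norm_neg]
  calc _ ≤ _ := (hB.norm_E_tail_le hx hq n).2
    _ = 3 * K / (‖x‖ + n) / (‖x‖ + n) ^ 2 := by rw [div_div]; ring
    _ ≤ 1 / (‖x‖ + n) ^ 2 := by
      gcongr
      rw [div_le_one hpos]
      have := hB.six_mul_le
      have := hB.nonneg
      linarith

lemma PerronBounds.isAdmissible_perronMap (hB : PerronBounds F A R K) (hx : x ∈ sector (3 / 4) R)
    (hq : IsAdmissible x q) : IsAdmissible x (perronMap F A x q) := by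
  have h1 := hB.one_le
  have h2 := hx.2
  intro n
  refine ⟨?_, (hB.norm_perronMap_snd_le hx hq n).trans (by gcongr; norm_num)⟩
  have e : (perronMap F A x q n).1 - (x - n) =
      ∑ k ∈ Finset.range n, (A ((q k).1⁻¹, (q k).2) + 1) := by
    rw [Finset.sum_add_distrib]
    simp [perronMap]
  rw [e]
  have : ∀ k ∈ Finset.range n, ‖A ((q k).1⁻¹, (q k).2) + 1‖ ≤ 1 / 20 := by
    intro k _
    have hk : (0 : ℝ) ≤ k := k.cast_nonneg
    exact hB.norm_A_add_one_le (‖x‖ + k) (by linarith) _ (hq.mem_perronRegion hx.1 k)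
  calc _ ≤ _ := norm_sum_le_of_le _ this
    _ = n / 20 := by simp; ring

/-- The Perron operator halves the weighted distance. -/
lemma PerronBounds.isClose_perronMap (hB : PerronBounds F A R K) (hx : x ∈ sector (3 / 4) R)
    (hq : IsAdmissible x q) (hq' : IsAdmissible x q') {d : ℝ} (hd : 0 ≤ d)
    (hqq' : IsClose x d q q') : IsClose x (d / 2) (perronMap F A x q) (perronMap F A x q') := by
  have h1 := hB.one_le
  have h2 := hx.2
  intro n
  have hn : (0 : ℝ) ≤ n := n.cast_nonneg
  have hpos : 0 < ‖x‖ + n := by linarith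
  constructor
  · have e : (perronMap F A x q n).1 - (perronMap F A x q' n).1 =
        ∑ k ∈ Finset.range n, (A ((q k).1⁻¹, (q k).2) - A ((q' k).1⁻¹, (q' k).2)) := by
      rw [Finset.sum_sub_distrib]
      simp [perronMap]
    rw [e]
    have : ∀ k ∈ Finset.range n, ‖A ((q k).1⁻¹, (q k).2) - A ((q' k).1⁻¹, (q' k).2)‖ ≤ d / 2 := by
      intro k _
      have hk : (0 : ℝ) ≤ k := k.cast_nonneg
      exact hB.norm_A_sub_le (‖x‖ + k) (by linarith) _ (hq.mem_perronRegion hx.1 k) _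
        (hq'.mem_perronRegion hx.1 k) d hd (hqq' k).1 (hqq' k).2
    calc _ ≤ _ := norm_sum_le_of_le _ this
      _ = d / 2 * n := by simp; ring
      _ ≤ d / 2 * (‖x‖ + n) := by
        gcongr
        linarith
  · have hs := (hB.norm_E_tail_le hx hq n).1
    have hs' := (hB.norm_E_tail_le hx hq' n).1
    simp only [perronMap]
    rw [neg_sub_neg, norm_sub_rev, ← hs.tsum_sub hs']
    have := hB.nonneg
    have hle := norm_tsum_le_of_norm_le_div_pow (N := ‖x‖ + n) (c := K * d) (by linarith)
      (by positivity) (f := fun k : ℕ =>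
        ((F ((q (k + n)).1⁻¹, (q (k + n)).2)).2 - (q (k + n)).2) -
        ((F ((q' (k + n)).1⁻¹, (q' (k + n)).2)).2 - (q' (k + n)).2)) (by
        intro k
        have hk : (0 : ℝ) ≤ k := k.cast_nonneg
        have := hB.norm_E_sub_le (‖x‖ + (k + n : ℕ)) (by push_cast; linarith) _
          (hq.mem_perronRegion hx.1 (k + n)) _ (hq'.mem_perronRegion hx.1 (k + n)) d hd
          (hqq' (k + n)).1 (hqq' (k + n)).2
        rwa [show ‖x‖ + ((k + n : ℕ) : ℝ) = ‖x‖ + n + k by push_cast; ring] at this)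
    calc _ ≤ _ := hle.2
      _ = 3 * K / (‖x‖ + n) * d / (‖x‖ + n) ^ 2 := by field_simp
      _ ≤ 1 / 2 * d / (‖x‖ + n) ^ 2 := by
        have h3 : 3 * K / (‖x‖ + n) ≤ 1 / 2 := by
          rw [div_le_div_iff₀ hpos (by norm_num)]
          have := hB.six_mul_le
          linarith
        gcongr
      _ = _ := by ring

lemma IsAdmissible.isClose (hx : 1 ≤ ‖x‖) (hq : IsAdmissible x q) (hq' : IsAdmissible x q') :
    IsClose x 200 q q' := by
  intro n
  have hn : (0 : ℝ) ≤ n := n.cast_nonneg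
  have h1 := hq n
  have h2 := hq' n
  constructor
  · have e : (q n).1 - (q' n).1 = ((q n).1 - (x - n)) - ((q' n).1 - (x - n)) := by ring
    rw [e]
    have := norm_sub_le ((q n).1 - (x - n)) ((q' n).1 - (x - n))
    linarith [h1.1, h2.1]
  · calc _ ≤ _ := norm_sub_le _ _
      _ ≤ 100 / (‖x‖ + n) ^ 2 + 100 / (‖x‖ + n) ^ 2 := add_le_add h1.2 h2.2
      _ = _ := by ring

/-- The limit of arbitrarily close sequences: `IsClose x d` for all small `d` means equality. -/
lemma eq_of_forall_isClose (h : ∀ j : ℕ, IsClose x (200 * (1 / 2) ^ j) q q') : q = q' := by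
  have hlim : Tendsto (fun j : ℕ => 200 * (1 / 2 : ℝ) ^ j) atTop (𝓝 0) := by
    simpa using (tendsto_pow_atTop_nhds_zero_of_lt_one (r := (1 / 2 : ℝ)) (by norm_num)
      (by norm_num)).const_mul 200
  funext n
  have h1 : ‖(q n).1 - (q' n).1‖ ≤ 0 := by
    have := hlim.mul_const (‖x‖ + n)
    rw [zero_mul] at this
    exact ge_of_tendsto' this fun j => (h j n).1
  have h2 : ‖(q n).2 - (q' n).2‖ ≤ 0 := by
    have := hlim.div_const ((‖x‖ + n) ^ 2)
    rw [zero_div] at this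
    exact ge_of_tendsto' this fun j => (h j n).2
  exact Prod.ext (sub_eq_zero.1 (norm_le_zero_iff.1 h1)) (sub_eq_zero.1 (norm_le_zero_iff.1 h2))

lemma PerronBounds.eq_of_fixed (hB : PerronBounds F A R K) (hx : x ∈ sector (3 / 4) R)
    (hq : IsAdmissible x q) (hq' : IsAdmissible x q') (hfix : perronMap F A x q = q)
    (hfix' : perronMap F A x q' = q') : q = q' := by
  have h1 := hB.one_le
  have h2 := hx.2
  apply eq_of_forall_isClose (x := x)
  intro j
  induction j with
  | zero => simpa using hq.isClose (by linarith) hq'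
  | succ j ih =>
    have := hB.isClose_perronMap hx hq hq' (by positivity) ih
    rw [hfix, hfix'] at this
    convert this using 1
    ring

/-- Fixed points of the Perron operator are orbits of `F`: the differences of consecutive entries of
the partial sums and of the tails are the increments prescribed by `F`. -/
lemma PerronBounds.orbit_of_fixed (hB : PerronBounds F A R K) (hx : x ∈ sector (3 / 4) R)
    (hq : IsAdmissible x q) (hfix : perronMap F A x q = q) (n : ℕ) :
    (q (n + 1)).1 = (q n).1 + A ((q n).1⁻¹, (q n).2) ∧
      F ((q n).1⁻¹, (q n).2) = ((q (n + 1)).1⁻¹, (q (n + 1)).2) := by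
  have h1 := hB.one_le
  have h2 := hx.2
  have hn : (0 : ℝ) ≤ n := n.cast_nonneg
  have hx1 : (q (n + 1)).1 = (q n).1 + A ((q n).1⁻¹, (q n).2) := by
    have e1 := congrArg Prod.fst (congrFun hfix (n + 1))
    have e2 := congrArg Prod.fst (congrFun hfix n)
    simp only [perronMap, Finset.sum_range_succ] at e1 e2
    rw [← e1, ← add_assoc, e2]
  refine ⟨hx1, ?_⟩
  have hfst := hB.fst (‖x‖ + n) (by linarith) _ (hq.mem_perronRegion hx.1 n)
  apply Prod.ext
  · rw [hx1, ← hfst.2, inv_inv]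
  · have e1 := congrArg Prod.snd (congrFun hfix (n + 1))
    have e2 := congrArg Prod.snd (congrFun hfix n)
    simp only [perronMap] at e1 e2
    rw [(hB.norm_E_tail_le hx hq n).1.tsum_eq_zero_add] at e2
    simp only [zero_add, show ∀ k : ℕ, k + 1 + n = k + (n + 1) from fun k => by ring] at e2
    rw [neg_add, e1] at e2
    linear_combination -e2

/-- Conversely, orbits of `F` are fixed points, since `w_n → 0` turns the sum of the increments of
`w` from `n` to infinity into `-w_n`. -/
lemma PerronBounds.fixed_of_orbit (hB : PerronBounds F A R K) (hx : x ∈ sector (3 / 4) R)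
    (hq : IsAdmissible x q) (h0 : (q 0).1 = x)
    (h1 : ∀ n, (q (n + 1)).1 = (q n).1 + A ((q n).1⁻¹, (q n).2))
    (h2 : ∀ n, (F ((q n).1⁻¹, (q n).2)).2 = (q (n + 1)).2) : perronMap F A x q = q := by
  have hR1 := hB.one_le
  have hR2 := hx.2
  funext n
  apply Prod.ext
  · simp only [perronMap]
    induction n with
    | zero => simp [h0]
    | succ n ih => rw [Finset.sum_range_succ, ← add_assoc, ih, h1]
  · simp only [perronMap]
    have hs := (hB.norm_E_tail_le hx hq n).1
    have hlim := hs.hasSum.tendsto_sum_nat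
    have hw : Tendsto (fun m => (q m).2) atTop (𝓝 0) := by
      apply squeeze_zero_norm (fun m => (hq m).2)
      have : Tendsto (fun m : ℕ => (‖x‖ + m) ^ 2) atTop atTop :=
        (tendsto_pow_atTop two_ne_zero).comp
          (tendsto_atTop_add_const_left _ _ tendsto_natCast_atTop_atTop)
      exact tendsto_const_nhds.div_atTop this
    have htele : ∀ m : ℕ, ∑ k ∈ Finset.range m,
        ((F ((q (k + n)).1⁻¹, (q (k + n)).2)).2 - (q (k + n)).2) = (q (m + n)).2 - (q n).2 := by
      intro m
      have := Finset.sum_range_sub (fun k => (q (k + n)).2) m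
      simp only [zero_add] at this
      rw [← this]
      refine Finset.sum_congr rfl fun k _ => ?_
      rw [h2, show k + n + 1 = k + 1 + n by ring]
    simp only [htele] at hlim
    have hlim' : Tendsto (fun m => (q (m + n)).2 - (q n).2) atTop (𝓝 (0 - (q n).2)) :=
      (hw.comp (tendsto_add_atTop_nat n)).sub_const _
    rw [tendsto_nhds_unique hlim hlim']
    ring

end Perron

/-! ### The parabolic curve -/

/-- The Picard iterates of the Perron operator, started at the orbit of the translation
`x ↦ x - 1` on `{w = 0}`. -/
noncomputable def perronIterate (F : ℂ × ℂ → ℂ × ℂ) (A : ℂ × ℂ → ℂ) : ℕ → ℂ → ℕ → ℂ × ℂ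
  | 0, x => fun n => (x - n, 0)
  | j + 1, x => perronMap F A x (perronIterate F A j x)

section Curve

variable {F : ℂ × ℂ → ℂ × ℂ} {A : ℂ × ℂ → ℂ} {R K : ℝ} {x : ℂ}

lemma PerronBounds.isAdmissible_perronIterate (hB : PerronBounds F A R K)
    (hx : x ∈ sector (3 / 4) R) (j : ℕ) : IsAdmissible x (perronIterate F A j x) := by
  induction j with
  | zero =>
    intro n
    simp only [perronIterate, sub_self, norm_zero]
    constructor <;> positivity
  | succ j ih => exact hB.isAdmissible_perronMap hx ih

lemma PerronBounds.isClose_perronIterate (hB : PerronBounds F A R K)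
    (hx : x ∈ sector (3 / 4) R) (j : ℕ) :
    IsClose x (200 * (1 / 2) ^ j) (perronIterate F A j x) (perronIterate F A (j + 1) x) := by
  have h1 := hB.one_le
  have h2 := hx.2
  induction j with
  | zero =>
    simpa using (hB.isAdmissible_perronIterate hx 0).isClose (by linarith)
      (hB.isAdmissible_perronIterate hx 1)
  | succ j ih =>
    have := hB.isClose_perronMap hx (hB.isAdmissible_perronIterate hx j)
      (hB.isAdmissible_perronIterate hx (j + 1)) (by positivity) ih
    rw [show 200 * (1 / 2 : ℝ) ^ (j + 1) = 200 * (1 / 2) ^ j / 2 by ring]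
    exact this

lemma PerronBounds.exists_fixed (hB : PerronBounds F A R K) (hx : x ∈ sector (3 / 4) R) :
    ∃ q, IsAdmissible x q ∧ perronMap F A x q = q ∧
      ∀ j, IsClose x (400 * (1 / 2) ^ j) (perronIterate F A j x) q := by
  have h1 := hB.one_le
  have h2 := hx.2
  have hd1 : ∀ n : ℕ, ∀ j, dist (perronIterate F A j x n).1 (perronIterate F A (j + 1) x n).1 ≤
      200 * (‖x‖ + n) * (1 / 2) ^ j := by
    intro n j
    rw [dist_eq_norm]
    calc _ ≤ _ := (hB.isClose_perronIterate hx j n).1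
      _ = _ := by ring
  have hd2 : ∀ n : ℕ, ∀ j, dist (perronIterate F A j x n).2 (perronIterate F A (j + 1) x n).2 ≤
      200 / (‖x‖ + n) ^ 2 * (1 / 2) ^ j := by
    intro n j
    rw [dist_eq_norm]
    calc _ ≤ _ := (hB.isClose_perronIterate hx j n).2
      _ = _ := by ring
  have hex1 := fun n => cauchySeq_tendsto_of_complete
    (cauchySeq_of_le_geometric _ _ (by norm_num : (1 / 2 : ℝ) < 1) (hd1 n))
  have hex2 := fun n => cauchySeq_tendsto_of_complete
    (cauchySeq_of_le_geometric _ _ (by norm_num : (1 / 2 : ℝ) < 1) (hd2 n))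
  choose X hX using hex1
  choose W hW using hex2
  set q : ℕ → ℂ × ℂ := fun n => (X n, W n) with hq
  have hclose : ∀ j, IsClose x (400 * (1 / 2) ^ j) (perronIterate F A j x) q := by
    intro j n
    have e1 := dist_le_of_le_geometric_of_tendsto _ _ (by norm_num : (1 / 2 : ℝ) < 1) (hd1 n)
      (hX n) j
    have e2 := dist_le_of_le_geometric_of_tendsto _ _ (by norm_num : (1 / 2 : ℝ) < 1) (hd2 n)
      (hW n) j
    rw [dist_eq_norm] at e1 e2
    constructor
    · calc _ ≤ _ := e1
        _ = _ := by ring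
    · calc _ ≤ _ := e2
        _ = _ := by ring
  have hadm : IsAdmissible x q := by
    intro n
    exact ⟨le_of_tendsto' ((hX n).sub_const _).norm
        fun j => (hB.isAdmissible_perronIterate hx j n).1,
      le_of_tendsto' (hW n).norm fun j => (hB.isAdmissible_perronIterate hx j n).2⟩
  refine ⟨q, hadm, ?_, hclose⟩
  -- both `perronMap q` and `q` are within `200 / 2 ^ j` of the iterate of index `j + 2`
  apply eq_of_forall_isClose (x := x)
  intro j n
  have e1 := hB.isClose_perronMap hx (hB.isAdmissible_perronIterate hx (j + 1)) hadm
    (by positivity) (hclose (j + 1)) n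
  have e2 := hclose (j + 2) n
  have e0 : perronIterate F A (j + 2) x = perronMap F A x (perronIterate F A (j + 1) x) := rfl
  rw [← e0] at e1
  constructor
  · calc _ ≤ _ := norm_sub_le_norm_sub_add_norm_sub _ (perronIterate F A (j + 2) x n).1 _
      _ ≤ _ := add_le_add ((norm_sub_rev _ _).trans_le e1.1) e2.1
      _ = _ := by ring
  · calc _ ≤ _ := norm_sub_le_norm_sub_add_norm_sub _ (perronIterate F A (j + 2) x n).2 _
      _ ≤ _ := add_le_add ((norm_sub_rev _ _).trans_le e1.2) e2.2
      _ = _ := by ring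

lemma PerronBounds.differentiableOn_perronIterate (hB : PerronBounds F A R K)
    (hF : Differentiable ℂ F) (j n : ℕ) :
    DifferentiableOn ℂ (fun x => (perronIterate F A j x n).1) (sector (3 / 4) R) ∧
      DifferentiableOn ℂ (fun x => (perronIterate F A j x n).2) (sector (3 / 4) R) := by
  have h1 := hB.one_le
  induction j generalizing n with
  | zero => exact ⟨by simp only [perronIterate]; fun_prop, by simp only [perronIterate]; fun_prop⟩
  | succ j ih =>
    have hreg : ∀ x ∈ sector (3 / 4) R, ∀ k : ℕ, R ≤ ‖x‖ + k ∧
        perronIterate F A j x k ∈ perronRegion (‖x‖ + k) := by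
      intro x hx k
      have hk : (0 : ℝ) ≤ k := k.cast_nonneg
      exact ⟨by linarith [hx.2],
        (hB.isAdmissible_perronIterate hx j).mem_perronRegion hx.1 k⟩
    have hpt : ∀ k : ℕ, DifferentiableOn ℂ (fun x => ((perronIterate F A j x k).1⁻¹,
        (perronIterate F A j x k).2)) (sector (3 / 4) R) := by
      intro k
      refine ((ih k).1.inv fun x hx => ?_).prodMk (ih k).2
      exact ne_zero_of_mem_cone ((hB.isAdmissible_perronIterate hx j).mem_cone hx.1 k).1
    constructor
    · simp only [perronIterate, perronMap]
      refine differentiableOn_id.add (DifferentiableOn.fun_sum fun k _ x hx => ?_)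
      exact (hB.differentiableAt_A _ (hreg x hx k).1 _ (hreg x hx k).2).comp_differentiableWithinAt
        x (hpt k x hx)
    · simp only [perronIterate, perronMap]
      refine DifferentiableOn.neg ?_
      have hsum := (norm_tsum_le_of_norm_le_div_pow (f := fun k : ℕ => ((K / (R + k) ^ 4 : ℝ) : ℂ))
        h1 hB.nonneg (fun k => by
          have := hB.nonneg
          rw [Complex.norm_real, Real.norm_eq_abs, abs_of_nonneg (by positivity)])).1
      refine Complex.differentiableOn_tsum_of_summable_norm (u := fun k : ℕ => K / (R + k) ^ 4)
        (by exact_mod_cast hsum) (fun k => ?_) (isOpen_sector _ _) (fun k x hx => ?_)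
      · exact ((hF.comp_differentiableOn (hpt (k + n))).snd).sub (ih (k + n)).2
      · have hk : (0 : ℝ) ≤ k := k.cast_nonneg
        have hn : (0 : ℝ) ≤ n := n.cast_nonneg
        have := hB.nonneg
        calc _ ≤ K / (‖x‖ + (k + n : ℕ)) ^ 4 :=
              hB.norm_E_le _ (hreg x hx (k + n)).1 _ (hreg x hx (k + n)).2
          _ ≤ K / (R + k) ^ 4 := by
              have := hx.2
              push_cast
              gcongr K / ?_ ^ 4
              linarith

/-- The second coordinate of the orbit with first coordinate `z` and `w_n → 0`, as a function of
`z`: it is holomorphic, its graph is invariant and attracted to the origin, and it is of order three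
as a sum of increments of size `(|x| + n)⁻⁴`. -/
lemma PerronBounds.exists_curve (hB : PerronBounds F A R K) (hF : Differentiable ℂ F) :
    ∃ γ : ℂ → ℂ, γ 0 = 0 ∧ DifferentiableOn ℂ γ {z | z⁻¹ ∈ sector (3 / 4) R} ∧
      (∀ z, z⁻¹ ∈ sector (3 / 4) R → ‖γ z‖ ≤ 3 * K * ‖z‖ ^ 3) ∧
      (∀ z, z⁻¹ ∈ sector (3 / 4) R → Tendsto (fun n : ℕ => F^[n] (z, γ z)) atTop (𝓝 0)) ∧
      ∀ z, z⁻¹ ∈ sector (3 / 4) R → z ∈ cone tanEighth →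
        ∃ z' ∈ cone tanEighth, ‖z'‖ ≤ ‖z‖ ∧ F (z, γ z) = (z', γ z') := by
  have h1 := hB.one_le
  have hex := fun x (hx : x ∈ sector (3 / 4) R) => hB.exists_fixed hx
  choose! Q hadm hfix hclose using hex
  set γ : ℂ → ℂ := fun z => if z = 0 then 0 else (Q z⁻¹ 0).2 with hγ
  have hz0 : ∀ z : ℂ, z⁻¹ ∈ sector (3 / 4) R → z ≠ 0 := by
    rintro z hz rfl
    rw [inv_zero] at hz
    exact ne_zero_of_mem_cone hz.1 rfl
  have hγz : ∀ z : ℂ, z⁻¹ ∈ sector (3 / 4) R → γ z = (Q z⁻¹ 0).2 := fun z hz => by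
    simp only [hγ, if_neg (hz0 z hz)]
  have hQ0 : ∀ x ∈ sector (3 / 4) R, (Q x 0).1 = x := by
    intro x hx
    rw [← hfix x hx]
    simp [perronMap]
  have hQdiff : DifferentiableOn ℂ (fun x => (Q x 0).2) (sector (3 / 4) R) := by
    have hunif : TendstoUniformlyOn (fun j x => (perronIterate F A j x 0).2)
        (fun x => (Q x 0).2) atTop (sector (3 / 4) R) := by
      rw [Metric.tendstoUniformlyOn_iff]
      intro ε hε
      have hlim : Tendsto (fun j : ℕ => 400 * (1 / 2 : ℝ) ^ j) atTop (𝓝 0) := by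
        simpa using (tendsto_pow_atTop_nhds_zero_of_lt_one (r := (1 / 2 : ℝ)) (by norm_num)
          (by norm_num)).const_mul 400
      filter_upwards [hlim.eventually_lt_const hε] with j hj x hx
      rw [dist_comm, dist_eq_norm]
      have := hx.2
      refine lt_of_le_of_lt ((hclose x hx j 0).2.trans ?_) hj
      apply div_le_self (by positivity)
      simp only [Nat.cast_zero, add_zero]
      nlinarith
    exact hunif.tendstoLocallyUniformlyOn.differentiableOn
      (Eventually.of_forall fun j => (hB.differentiableOn_perronIterate hF j 0).2)
      (isOpen_sector _ _)
  have hiter : ∀ z, z⁻¹ ∈ sector (3 / 4) R → ∀ n : ℕ,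
      F^[n] (z, γ z) = ((Q z⁻¹ n).1⁻¹, (Q z⁻¹ n).2) := by
    intro z hz n
    induction n with
    | zero => rw [Function.iterate_zero, id, hQ0 _ hz, inv_inv, hγz z hz]
    | succ n ih =>
      rw [Function.iterate_succ_apply', ih, (hB.orbit_of_fixed hz (hadm _ hz) (hfix _ hz) n).2]
  refine ⟨γ, by simp [hγ], ?_, ?_, ?_, ?_⟩
  · have : DifferentiableOn ℂ (fun z : ℂ => (Q z⁻¹ 0).2) {z | z⁻¹ ∈ sector (3 / 4) R} := by
      refine hQdiff.comp (fun z hz => ?_) fun z hz => hz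
      exact (differentiableAt_inv (hz0 z hz)).differentiableWithinAt
    exact this.congr fun z hz => hγz z hz
  · intro z hz
    have h2 := (hB.norm_E_tail_le hz (hadm _ hz) 0).2
    have h3 : ‖(perronMap F A z⁻¹ (Q z⁻¹) 0).2‖ ≤ 3 * K / (‖z⁻¹‖ + (0 : ℕ)) ^ 3 := by
      rw [perronMap, norm_neg]
      exact h2
    rw [hfix _ hz, ← hγz z hz] at h3
    simpa using h3
  · intro z hz
    simp only [hiter z hz]
    have hN : Tendsto (fun n : ℕ => ‖z⁻¹‖ + (n : ℝ)) atTop atTop :=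
      tendsto_atTop_add_const_left _ _ tendsto_natCast_atTop_atTop
    have t1 : Tendsto (fun n => (Q z⁻¹ n).1⁻¹) atTop (𝓝 0) := by
      apply tendsto_inv₀_cobounded.comp
      rw [← tendsto_norm_atTop_iff_cobounded]
      exact tendsto_atTop_mono (fun n => ((hadm _ hz).mem_cone hz.1 n).2)
        (hN.atTop_div_const (by norm_num))
    have t2 : Tendsto (fun n => (Q z⁻¹ n).2) atTop (𝓝 0) := by
      apply squeeze_zero_norm (fun n => (hadm _ hz n).2)
      exact tendsto_const_nhds.div_atTop ((tendsto_pow_atTop two_ne_zero).comp hN)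
    exact t1.prodMk_nhds t2
  · intro z hz hzc
    set x := z⁻¹ with hx
    have horb := hB.orbit_of_fixed hz (hadm _ hz) (hfix _ hz)
    have hA1 : ∀ n : ℕ, ‖A ((Q x n).1⁻¹, (Q x n).2) + 1‖ ≤ 1 / 20 := fun n =>
      hB.norm_A_add_one_le (‖x‖ + n)
        (by have : (0 : ℝ) ≤ n := n.cast_nonneg
            linarith [hz.2]) _ ((hadm _ hz).mem_perronRegion hz.1 n)
    set x₁ := (Q x 1).1 with hx₁
    have ex₁ : x₁ = x + A ((Q x 0).1⁻¹, (Q x 0).2) := by rw [hx₁, (horb 0).1, hQ0 _ hz]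
    set a := A ((Q x 0).1⁻¹, (Q x 0).2) with ha
    have hta := tanEighth_bounds
    have hacone : a ∈ cone tanEighth := by
      have h3 := (Complex.abs_re_le_norm (a + 1)).trans (hA1 0)
      have h4 := (Complex.abs_im_le_norm (a + 1)).trans (hA1 0)
      simp only [Complex.add_re, Complex.one_re, Complex.add_im, Complex.one_im, add_zero] at h3 h4
      have h5 := (abs_le.1 h3).2
      change |a.im| < -tanEighth * a.re
      nlinarith
    have hxc : x ∈ cone tanEighth := inv_mem_cone hzc
    have hx₁c : x₁ ∈ cone tanEighth := by rw [ex₁]; exact add_mem_cone hxc hacone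
    have hsub := cone_mono tanEighth_pos (by linarith : tanEighth ≤ 3 / 4)
    have hx₁n : ‖x‖ ≤ ‖x₁‖ := by
      have := norm_add_ge_of_mem_cone (hsub hxc) (hsub hacone)
      rw [ex₁]
      linarith [norm_nonneg a]
    have hx₁s : x₁ ∈ sector (3 / 4) R := ⟨hsub hx₁c, hz.2.trans_le hx₁n⟩
    have hx₁n' : ‖x₁‖ ≤ ‖x‖ + 2 := by
      have h3 := norm_sub_le (a + 1) 1
      rw [add_sub_cancel_right, norm_one] at h3
      rw [ex₁]
      linarith [norm_add_le x a, hA1 0]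
    refine ⟨x₁⁻¹, inv_mem_cone hx₁c, ?_, ?_⟩
    · rw [norm_inv, show z = x⁻¹ by rw [hx, inv_inv], norm_inv]
      have := norm_pos_iff.2 (ne_zero_of_mem_cone hxc)
      gcongr
    -- the shifted orbit is the orbit that defines `γ` at the image point
    have hshift_adm : IsAdmissible x₁ (fun n => Q x (n + 1)) := by
      intro n
      constructor
      · induction n with
        | zero => simp [hx₁]
        | succ n ih =>
          have e : (Q x (n + 1 + 1)).1 - (x₁ - (n + 1 : ℕ)) = ((Q x (n + 1)).1 - (x₁ - n)) +
              (A ((Q x (n + 1)).1⁻¹, (Q x (n + 1)).2) + 1) := by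
            rw [(horb (n + 1)).1]; push_cast; ring
          simp only [e]
          push_cast
          linarith [norm_add_le ((Q x (n + 1)).1 - (x₁ - n))
            (A ((Q x (n + 1)).1⁻¹, (Q x (n + 1)).2) + 1), hA1 (n + 1)]
      · have h3 := hB.norm_perronMap_snd_le hz (hadm _ hz) (n + 1)
        rw [hfix _ hz] at h3
        have hn : (0 : ℝ) ≤ n := n.cast_nonneg
        have hp : 1 ≤ ‖x‖ := by linarith [hz.2]
        refine h3.trans ?_
        push_cast
        have h0 : 0 < ‖x₁‖ + n := by linarith
        have h5 : (‖x₁‖ + n) ^ 2 ≤ (2 * (‖x‖ + (n + 1))) ^ 2 := by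
          gcongr
          linarith
        rw [div_le_div_iff₀ (by positivity) (pow_pos h0 2)]
        nlinarith
    have hshift := hB.fixed_of_orbit hx₁s hshift_adm rfl (fun n => (horb (n + 1)).1)
      (fun n => by rw [(horb (n + 1)).2])
    have heq := hB.eq_of_fixed hx₁s (hadm _ hx₁s) hshift_adm (hfix _ hx₁s) hshift
    have hs : (x₁⁻¹)⁻¹ ∈ sector (3 / 4) R := by rwa [inv_inv]
    have e1 : F (z, γ z) = (x₁⁻¹, (Q x 1).2) := hiter z hz 1
    rw [e1, hγz _ hs, inv_inv, heq]

end Curve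

lemma closure_sectorV_subset {ε : ℝ} : closure (sectorV ε) ⊆ insert 0 {z | z ∈ cone (3 / 4) ∧
    ‖z‖ ≤ ε} := by
  have hclosed : IsClosed {z : ℂ | |z.im| ≤ -tanEighth * z.re ∧ ‖z‖ ≤ ε} := by
    have h1 : Continuous fun z : ℂ => |z.im| := by fun_prop
    have h2 : Continuous fun z : ℂ => -tanEighth * z.re := by fun_prop
    exact (isClosed_le h1 h2).inter (isClosed_le continuous_norm continuous_const)
  have hsub : closure (sectorV ε) ⊆ {z : ℂ | |z.im| ≤ -tanEighth * z.re ∧ ‖z‖ ≤ ε} := by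
    apply closure_minimal _ hclosed
    intro z hz
    rw [mem_sectorV_iff] at hz
    have h1 : |z.im| < -tanEighth * z.re := hz.1
    exact ⟨h1.le, hz.2.le⟩
  intro z hz
  obtain ⟨h1, h2⟩ := hsub hz
  rcases eq_or_ne z 0 with rfl | hz0
  · exact mem_insert _ _
  refine mem_insert_of_mem _ ⟨?_, h2⟩
  have h3 := abs_nonneg z.im
  have h4 := tanEighth_bounds
  have h5 : z.re ≤ 0 := by nlinarith
  have h6 : z.re ≠ 0 := by
    intro h
    rw [h, mul_zero] at h1
    exact hz0 (Complex.ext h (abs_eq_zero.1 (le_antisymm h1 h3)))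
  have h7 : z.re < 0 := lt_of_le_of_ne h5 h6
  change |z.im| < -(3 / 4) * z.re
  nlinarith

/-- The curve is obtained on a cone wider than the given sector, so that Cauchy's estimate bounds
its derivative on the sector. -/
lemma IsNormalForm.exists_isParabolicCurve {F : ℂ × ℂ → ℂ × ℂ} {A : ℂ × ℂ → ℂ} {g h : ℂ → ℂ}
    (hF : Differentiable ℂ F) (hN : IsNormalForm F A g h) : ∃ ε γ, IsParabolicCurve F ε γ := by
  obtain ⟨R, K, hB⟩ := hN.exists_perronBounds hF
  obtain ⟨γ, hγ0, hγd, hγb, hγlim, hγinv⟩ := hB.exists_curve hF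
  have hR := hB.one_le
  have hK := hB.nonneg
  have hpos : (0 : ℝ) < 1 / (2 * R) := by positivity
  have ht := tanEighth_bounds
  -- all points of the closed sector, and discs about them, lie in the domain of `γ`
  have hmem : ∀ z : ℂ, z ∈ cone (3 / 4) → ‖z‖ < 1 / R → z⁻¹ ∈ sector (3 / 4) R := by
    intro z hz hzn
    refine ⟨inv_mem_cone hz, ?_⟩
    have := norm_pos_iff.2 (ne_zero_of_mem_cone hz)
    rw [norm_inv, lt_inv_comm₀ (by linarith) this]
    simpa using hzn
  have hlt : 1 / (2 * R) < 1 / R := by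
    apply one_div_lt_one_div_of_lt <;> linarith
  have hV : ∀ z ∈ sectorV (1 / (2 * R)), z⁻¹ ∈ sector (3 / 4) R := by
    intro z hz
    rw [mem_sectorV_iff] at hz
    exact hmem z (cone_mono tanEighth_pos (by linarith) hz.1) (hz.2.trans hlt)
  have hopen : IsOpen {z : ℂ | z ≠ 0 ∧ z⁻¹ ∈ sector (3 / 4) R} := by
    have h1 : ContinuousOn (fun z : ℂ => z⁻¹) {0}ᶜ := continuousOn_inv₀
    exact h1.isOpen_inter_preimage isOpen_compl_singleton (isOpen_sector _ _)
  have hnhds : ∀ z : ℂ, z⁻¹ ∈ sector (3 / 4) R → {z | z⁻¹ ∈ sector (3 / 4) R} ∈ 𝓝 z := by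
    intro z hz
    have hz0 : z ≠ 0 := by
      rintro rfl
      rw [inv_zero] at hz
      exact ne_zero_of_mem_cone hz.1 rfl
    exact mem_of_superset (hopen.mem_nhds ⟨hz0, hz⟩) fun _ h => h.2
  refine ⟨1 / (2 * R), γ, hpos, hγd.mono fun z hz => hV z hz, ?_, hγ0, ?_, ?_, ?_, ?_⟩
  · intro z hz
    rcases closure_sectorV_subset hz with rfl | hz'
    · -- at the vertex continuity follows from the cubic bound
      rw [ContinuousWithinAt, hγ0]
      have hlim : Tendsto (fun z : ℂ => 3 * K * ‖z‖ ^ 3) (𝓝[closure (sectorV (1 / (2 * R)))] 0)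
          (𝓝 0) := by
        have : Continuous fun z : ℂ => 3 * K * ‖z‖ ^ 3 := by fun_prop
        simpa using (this.tendsto 0).mono_left nhdsWithin_le_nhds
      apply squeeze_zero_norm' _ hlim
      filter_upwards [self_mem_nhdsWithin] with z hz
      rcases closure_sectorV_subset hz with rfl | hz'
      · simp [hγ0]
      · exact hγb z (hmem z hz'.1 (hz'.2.trans_lt hlt))
    · have := hmem z hz'.1 (hz'.2.trans_lt hlt)
      exact (hγd.differentiableAt (hnhds z this)).continuousAt.continuousWithinAt
  · intro z hz
    have hz' := mem_sectorV_iff.1 hz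
    obtain ⟨z', h1, h2, h3⟩ := hγinv z (hV z hz) hz'.1
    exact ⟨z', mem_sectorV_iff.2 ⟨h1, h2.trans_lt hz'.2⟩, h3⟩
  · exact fun z hz => hγlim z (hV z hz)
  · exact ⟨3 * K, fun z hz => hγb z (hV z hz)⟩
  · refine ⟨3 * K * 2 ^ 3 * 20, fun z hz => ?_⟩
    have hz' := mem_sectorV_iff.1 hz
    have hz0 := norm_pos_iff.2 (ne_zero_of_mem_cone hz'.1)
    have hball : ∀ u ∈ Metric.ball z (‖z‖ / 20), u⁻¹ ∈ sector (3 / 4) R ∧ ‖u‖ ≤ 2 * ‖z‖ := by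
      intro u hu
      rw [mem_ball_iff_norm] at hu
      have hu' : ‖u‖ < 2 * ‖z‖ := by
        have := norm_add_le (u - z) z
        rw [sub_add_cancel] at this
        linarith
      refine ⟨hmem u ?_ ?_, hu'.le⟩
      · exact mem_cone_of_norm_sub_le (κ := 1 / 20) tanEighth_pos (by linarith) (by norm_num)
          (by linarith) hz'.1 (by linarith)
      · calc ‖u‖ < 2 * ‖z‖ := hu'
          _ < 2 * (1 / (2 * R)) := by linarith [hz'.2]
          _ = 1 / R := by field_simp
    have := norm_fderiv_le_of_norm_le (M := 3 * K * (2 * ‖z‖) ^ 3)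
      (show 0 < ‖z‖ / 20 by positivity)
      (hγd.mono fun u hu => (hball u hu).1) fun u hu =>
        (hγb u (hball u hu).1).trans (by gcongr; exact (hball u hu).2)
    rw [← norm_deriv_eq_norm_fderiv] at this
    calc _ ≤ _ := this
      _ = _ := by field_simp

/-! ### The linear differential equation -/

/-- The half-plane `2 Re η - Im η < -κ`, which is invariant under translations by positive
multiples of `1 + 2i`. -/
def rayHalfPlane (κ : ℝ) : Set ℂ := {η | 2 * η.re - η.im < -κ}

/-- The point `y + t (1 + 2i)` of the ray along which solutions are obtained by integration. -/
noncomputable def rayPoint (y : ℂ) (t : ℝ) : ℂ := y + t * (1 + 2 * Complex.I)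

lemma rayHalfPlane_anti {κ κ' : ℝ} (h : κ ≤ κ') : rayHalfPlane κ' ⊆ rayHalfPlane κ := by
  intro η hη
  have h1 : 2 * η.re - η.im < -κ' := hη
  change 2 * η.re - η.im < -κ
  linarith

lemma three_mul_norm_ge (η : ℂ) : -(2 * η.re - η.im) ≤ 3 * ‖η‖ := by
  have h1 := neg_le_of_abs_le (Complex.abs_re_le_norm η)
  have h2 := le_of_abs_le (Complex.abs_im_le_norm η)
  linarith

lemma norm_of_mem_rayHalfPlane {κ : ℝ} {η : ℂ} (h : η ∈ rayHalfPlane κ) : κ / 3 < ‖η‖ := by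
  have h1 : 2 * η.re - η.im < -κ := h
  linarith [three_mul_norm_ge η]

lemma ne_zero_of_mem_rayHalfPlane {κ : ℝ} (hκ : 0 ≤ κ) {η : ℂ} (h : η ∈ rayHalfPlane κ) :
    η ≠ 0 := by
  have := norm_of_mem_rayHalfPlane h
  exact norm_pos_iff.1 (by linarith)

lemma neg_mem_slitPlane {κ : ℝ} (hκ : 0 ≤ κ) {η : ℂ} (h : η ∈ rayHalfPlane κ) :
    -η ∈ Complex.slitPlane := by
  have h1 : 2 * η.re - η.im < -κ := h
  rw [Complex.mem_slitPlane_iff]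
  by_cases him : η.im = 0
  · left
    rw [Complex.neg_re]
    linarith
  · right
    simpa using him

lemma re_rayPoint (y : ℂ) (t : ℝ) : (rayPoint y t).re = y.re + t := by
  simp [rayPoint]

lemma im_rayPoint (y : ℂ) (t : ℝ) : (rayPoint y t).im = y.im + 2 * t := by
  simp [rayPoint]
  ring

lemma rayPoint_mem {κ : ℝ} {y : ℂ} (hy : y ∈ rayHalfPlane κ) (t : ℝ) :
    rayPoint y t ∈ rayHalfPlane κ := by
  have h1 : 2 * y.re - y.im < -κ := hy
  change 2 * (rayPoint y t).re - (rayPoint y t).im < -κ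
  rw [re_rayPoint, im_rayPoint]
  linarith

lemma two_mul_re_sub_im_lt {y : ℂ} (hy : y ∈ cone 1) : 2 * y.re - y.im < -(‖y‖ / 2) := by
  have h1 : |y.im| < -1 * y.re := hy
  have h2 := norm_le_two_mul_neg_re one_pos le_rfl hy
  have h3 := neg_abs_le y.im
  linarith

lemma sector_subset_rayHalfPlane {κ : ℝ} : sector 1 (2 * κ) ⊆ rayHalfPlane κ := by
  intro y hy
  have h1 := two_mul_re_sub_im_lt hy.1
  have h2 := hy.2
  change 2 * y.re - y.im < -κ
  linarith

lemma norm_rayPoint_ge {y : ℂ} (hy : y ∈ cone 1) (t : ℝ) : ‖y‖ / 6 ≤ ‖rayPoint y t‖ := by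
  have h1 := two_mul_re_sub_im_lt hy
  have h2 := three_mul_norm_ge (rayPoint y t)
  rw [re_rayPoint, im_rayPoint] at h2
  linarith

lemma norm_rayPoint_le (y : ℂ) {t : ℝ} (ht : 0 ≤ t) : ‖rayPoint y t‖ ≤ ‖y‖ + 3 * t := by
  have h : ‖(1 + 2 * Complex.I : ℂ)‖ ≤ 3 := by
    refine (norm_add_le _ _).trans ?_
    simp
    norm_num
  calc _ ≤ ‖y‖ + ‖(t : ℂ) * (1 + 2 * Complex.I)‖ := norm_add_le _ _
    _ ≤ ‖y‖ + t * 3 := by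
      rw [norm_mul, Complex.norm_real, Real.norm_eq_abs, abs_of_nonneg ht]
      gcongr
    _ = _ := by ring

/-- Logarithms are dominated by linear functions of arbitrarily small slope. -/
lemma exists_mul_log_le {k : ℝ} (hk : 0 ≤ k) :
    ∃ C, ∀ t : ℝ, 0 ≤ t → k * Real.log (1 + 3 * t) ≤ t / 2 + C := by
  set s : ℝ := 6 * (k + 1) with hs
  have hs0 : 0 < s := by positivity
  refine ⟨k * (1 / s) + k * |Real.log s|, fun t ht => ?_⟩
  have h1 : Real.log (1 + 3 * t) ≤ (1 + 3 * t) / s + |Real.log s| := by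
    have h2 : 0 < (1 + 3 * t) / s := by positivity
    have h3 := Real.log_le_sub_one_of_pos h2
    rw [Real.log_div (by positivity) hs0.ne'] at h3
    linarith [le_abs_self (Real.log s)]
  calc k * Real.log (1 + 3 * t) ≤ k * ((1 + 3 * t) / s + |Real.log s|) := by gcongr
    _ = 3 * k / s * t + (k * (1 / s) + k * |Real.log s|) := by ring
    _ ≤ 1 / 2 * t + (k * (1 / s) + k * |Real.log s|) := by
      gcongr ?_ * t + _
      rw [div_le_div_iff₀ hs0 (by norm_num)]
      linarith
    _ = _ := by ring

lemma norm_log_neg_le {y : ℂ} : ‖Complex.log (-y)‖ ≤ |Real.log ‖y‖| + Real.pi := by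
  refine (Complex.norm_le_abs_re_add_abs_im _).trans ?_
  rw [Complex.log_re, Complex.log_im, norm_neg]
  have := Complex.abs_arg_le_pi (-y)
  linarith

/-- The homogeneous equation `E' = a(1/y) E` with `a(0) = 1` has the solution
`E = exp (y + a'(0) log(-y) - P(1/y))`, which grows like `e^{t}` along the rays. -/
lemma exists_homogeneous_solution {a : ℂ → ℂ} (ha : AnalyticAt ℂ a 0) (ha0 : a 0 = 1) :
    ∃ κ : ℝ, 1 ≤ κ ∧ ∃ E : ℂ → ℂ,
      (∀ y ∈ rayHalfPlane κ, E y ≠ 0 ∧ HasDerivAt E (a y⁻¹ * E y) y) ∧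
      (∃ C, ∀ y ∈ sector 1 (2 * κ), ‖E y‖ ≤ C / ‖y‖) ∧
      ∃ C, 0 ≤ C ∧ ∀ y ∈ sector 1 (2 * κ), ∀ t : ℝ, 0 ≤ t →
        ‖E y / E (rayPoint y t)‖ ≤ C * Real.exp (-(t / 2)) := by
  obtain ⟨ρ, hρ, M, -, had, -⟩ := ha.exists_ball_bound
  set a₁ : ℂ → ℂ := dslope a 0 with ha₁
  set a₂ : ℂ → ℂ := dslope a₁ 0 with ha₂
  have hd₁ : DifferentiableOn ℂ a₁ (Metric.ball 0 ρ) :=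
    (Complex.differentiableOn_dslope (Metric.ball_mem_nhds _ hρ)).2 had
  have hd₂ : DifferentiableOn ℂ a₂ (Metric.ball 0 ρ) :=
    (Complex.differentiableOn_dslope (Metric.ball_mem_nhds _ hρ)).2 hd₁
  have hexp : ∀ v, a v = 1 + a₁ 0 * v + v ^ 2 * a₂ v := by
    intro v
    have e1 := sub_smul_dslope a 0 v
    have e2 := sub_smul_dslope a₁ 0 v
    simp only [sub_zero, smul_eq_mul, ha0] at e1 e2
    rw [← ha₁] at e1
    rw [← ha₂] at e2
    linear_combination -e1 - v * e2
  obtain ⟨P, hP⟩ := hd₂.isExactOn_ball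
  have hPcont : ∀ᶠ v in 𝓝 (0 : ℂ), ‖P v‖ < ‖P 0‖ + 1 :=
    (hP 0 (Metric.mem_ball_self hρ)).continuousAt.norm.eventually_lt continuousAt_const (by simp)
  obtain ⟨ρ', hρ', hPb⟩ := Metric.eventually_nhds_iff_ball.1 hPcont
  set S := ‖P 0‖ + 1 with hS
  obtain ⟨κ, hκ1, hκρ, hκρ'⟩ : ∃ κ : ℝ, 1 ≤ κ ∧ 3 / κ < ρ ∧ 3 / κ < ρ' := by
    have t : Tendsto (fun κ : ℝ => 3 / κ) atTop (𝓝 0) := tendsto_const_nhds.div_atTop tendsto_id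
    exact ((eventually_ge_atTop 1).and ((t.eventually_lt_const hρ).and
      (t.eventually_lt_const hρ'))).exists
  have hinv : ∀ y ∈ rayHalfPlane κ, ‖y⁻¹‖ < 3 / κ := by
    intro y hy
    have h1 := norm_of_mem_rayHalfPlane hy
    rw [norm_inv, inv_lt_comm₀ (by linarith) (by positivity), inv_div]
    exact h1
  set L : ℂ → ℂ := fun y => y + a₁ 0 * Complex.log (-y) - P y⁻¹ with hL
  have hLP : ∀ y ∈ rayHalfPlane κ, ‖P y⁻¹‖ ≤ S := fun y hy =>
    (hPb _ (by simpa using (hinv y hy).trans hκρ')).le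
  refine ⟨κ, hκ1, fun y => Complex.exp (L y), ?_, ?_, ?_⟩
  · intro y hy
    refine ⟨Complex.exp_ne_zero _, ?_⟩
    have hy0 := ne_zero_of_mem_rayHalfPlane (by linarith) hy
    have h1 : HasDerivAt (fun y : ℂ => Complex.log (-y)) (y⁻¹) y := by
      have := (hasDerivAt_neg y).clog (neg_mem_slitPlane (by linarith) hy)
      convert this using 1
      field_simp
    have h2 : HasDerivAt (fun y => P y⁻¹) (a₂ y⁻¹ * (-(y ^ 2)⁻¹)) y :=
      (hP y⁻¹ (by simpa using (hinv y hy).trans hκρ)).comp y (hasDerivAt_inv hy0)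
    have h3 : HasDerivAt L (1 + a₁ 0 * y⁻¹ - a₂ y⁻¹ * (-(y ^ 2)⁻¹)) y :=
      ((hasDerivAt_id y).add (h1.const_mul _)).sub h2
    have h4 : Complex.exp (L y) * (1 + a₁ 0 * y⁻¹ - a₂ y⁻¹ * (-(y ^ 2)⁻¹)) =
        a y⁻¹ * Complex.exp (L y) := by
      rw [hexp y⁻¹]
      ring
    exact h4 ▸ h3.cexp
  · obtain ⟨C, hC⟩ := exists_mul_log_le (k := ‖a₁ 0‖ + 1) (by positivity)
    refine ⟨Real.exp (C + ‖a₁ 0‖ * Real.pi + S), fun y hy => ?_⟩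
    have hy' := sector_subset_rayHalfPlane hy
    have hyn := hy.2
    have hypos : 0 < ‖y‖ := by linarith
    rw [le_div_iff₀ hypos, Complex.norm_exp]
    rw [show Real.exp (L y).re * ‖y‖ = Real.exp ((L y).re + Real.log ‖y‖) by
      rw [Real.exp_add, Real.exp_log hypos], Real.exp_le_exp]
    have h1 := norm_le_two_mul_neg_re one_pos le_rfl hy.1
    have h2 : (L y).re ≤ y.re + ‖a₁ 0‖ * (Real.log ‖y‖ + Real.pi) + S := by
      have e1 : (L y).re = y.re + (a₁ 0 * Complex.log (-y)).re - (P y⁻¹).re := by simp [hL]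
      have e2 : (a₁ 0 * Complex.log (-y)).re ≤ ‖a₁ 0‖ * (Real.log ‖y‖ + Real.pi) := by
        refine (Complex.re_le_norm _).trans ?_
        rw [norm_mul]
        have := norm_log_neg_le (y := y)
        rw [abs_of_nonneg (Real.log_nonneg (by linarith))] at this
        gcongr
      have e3 := (abs_le.1 ((Complex.abs_re_le_norm _).trans (hLP y hy'))).1
      linarith
    have h3 := hC ‖y‖ hypos.le
    have h4 : (‖a₁ 0‖ + 1) * Real.log ‖y‖ ≤ (‖a₁ 0‖ + 1) * Real.log (1 + 3 * ‖y‖) := by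
      gcongr
      linarith
    linarith
  · obtain ⟨C, hC⟩ := exists_mul_log_le (k := ‖a₁ 0‖) (by positivity)
    refine ⟨Real.exp (C + ‖a₁ 0‖ * (Real.log 6 + 2 * Real.pi) + 2 * S), (Real.exp_pos _).le,
      fun y hy t ht => ?_⟩
    have hy' := sector_subset_rayHalfPlane hy
    have hη' := rayPoint_mem hy' t
    set η := rayPoint y t with hη
    have hyn := hy.2
    have hypos : 0 < ‖y‖ := by linarith
    have hge := norm_rayPoint_ge hy.1 t
    have hle := norm_rayPoint_le y ht
    rw [← hη] at hge hle
    have hηpos : 0 < ‖η‖ := by linarith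
    rw [← Complex.exp_sub, Complex.norm_exp, ← Real.exp_add, Real.exp_le_exp]
    have h1 : |Real.log ‖y‖ - Real.log ‖η‖| ≤ Real.log 6 + Real.log (1 + 3 * t) := by
      rw [← Real.log_mul (by norm_num) (by positivity), ← Real.log_div hypos.ne' hηpos.ne',
        abs_le, ← Real.log_inv]
      constructor
      · apply Real.log_le_log (by positivity)
        rw [inv_le_comm₀ (by positivity) (by positivity), inv_div, div_le_iff₀ hypos]
        nlinarith
      · apply Real.log_le_log (by positivity)
        rw [div_le_iff₀ hηpos]
        nlinarith
    have h2 : ‖Complex.log (-y) - Complex.log (-η)‖ ≤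
        Real.log 6 + Real.log (1 + 3 * t) + 2 * Real.pi := by
      refine (Complex.norm_le_abs_re_add_abs_im _).trans ?_
      simp only [Complex.sub_re, Complex.sub_im, Complex.log_re, Complex.log_im, norm_neg]
      have e1 := Complex.abs_arg_le_pi (-y)
      have e2 := Complex.abs_arg_le_pi (-η)
      have e3 := abs_sub (Complex.arg (-y)) (Complex.arg (-η))
      linarith
    have e1 : (L y - L η).re = -t + (a₁ 0 * (Complex.log (-y) - Complex.log (-η))).re -
        (P y⁻¹).re + (P η⁻¹).re := by
      have : η.re = y.re + t := re_rayPoint y t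
      simp only [hL, mul_sub, Complex.sub_re, Complex.add_re, this]
      ring
    have e2 : (a₁ 0 * (Complex.log (-y) - Complex.log (-η))).re ≤
        ‖a₁ 0‖ * (Real.log 6 + Real.log (1 + 3 * t) + 2 * Real.pi) := by
      refine (Complex.re_le_norm _).trans ?_
      rw [norm_mul]
      gcongr
    have e3 := (abs_le.1 ((Complex.abs_re_le_norm _).trans (hLP y hy'))).1
    have e4 := (abs_le.1 ((Complex.abs_re_le_norm _).trans (hLP η hη'))).2
    have e5 := hC t ht
    rw [e1]
    linarith

open MeasureTheory

lemma hasDerivAt_rayPoint_left (y : ℂ) (t : ℝ) : HasDerivAt (fun y => rayPoint y t) 1 y :=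
  (hasDerivAt_id y).add_const _

lemma hasDerivAt_rayPoint_right (y : ℂ) (t : ℝ) :
    HasDerivAt (fun t : ℝ => rayPoint y t) (1 + 2 * Complex.I) t := by
  have : HasDerivAt (fun t : ℝ => (t : ℂ) * (1 + 2 * Complex.I)) (1 * (1 + 2 * Complex.I)) t :=
    (Complex.ofRealCLM.hasDerivAt (x := t)).mul_const _
  rw [one_mul] at this
  exact this.const_add y

/-- Differentiation under the integral sign along rays: the integral of `K` from `y` to `∞` in the
direction `1 + 2i` is a primitive of `-K`. -/
lemma hasDerivAt_integral_ray {K K' : ℂ → ℂ} {U : Set ℂ} (hU : IsOpen U) {C : ℂ → ℝ}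
    (hK : ∀ y ∈ U, ∀ t : ℝ, 0 ≤ t → HasDerivAt K (K' (rayPoint y t)) (rayPoint y t))
    (hK' : ∀ y ∈ U, ∀ t : ℝ, 0 ≤ t → ContinuousAt K' (rayPoint y t))
    (hC : ContinuousOn C U)
    (hb : ∀ y ∈ U, ∀ t : ℝ, 0 ≤ t → ‖K (rayPoint y t)‖ ≤ C y * Real.exp (-(t / 2)))
    (hb' : ∀ y ∈ U, ∀ t : ℝ, 0 ≤ t → ‖K' (rayPoint y t)‖ ≤ C y * Real.exp (-(t / 2)))
    {y : ℂ} (hy : y ∈ U) :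
    HasDerivAt (fun y => ∫ t in Ioi (0 : ℝ), K (rayPoint y t) * (1 + 2 * Complex.I)) (-K y) y := by
  set d : ℂ := 1 + 2 * Complex.I with hd
  have hexp : IntegrableOn (fun t : ℝ => Real.exp (-(t / 2))) (Ioi 0) := by
    have := exp_neg_integrableOn_Ioi 0 (b := 1 / 2) (by norm_num)
    refine this.congr_fun (fun t _ => ?_) measurableSet_Ioi
    simp only
    ring_nf
  have hcK : ∀ y ∈ U, ContinuousOn (fun t : ℝ => K (rayPoint y t) * d) (Ioi 0) := by
    intro y hy t ht
    have h1 : ContinuousAt (fun t : ℝ => K (rayPoint y t)) t :=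
      ContinuousAt.comp (g := K) (hK y hy t (le_of_lt ht)).continuousAt
        (hasDerivAt_rayPoint_right y t).continuousAt
    exact (h1.mul_const d).continuousWithinAt
  have hcK' : ContinuousOn (fun t : ℝ => K' (rayPoint y t) * d) (Ioi 0) := by
    intro t ht
    have h1 : ContinuousAt (fun t : ℝ => K' (rayPoint y t)) t :=
      ContinuousAt.comp (g := K') (hK' y hy t (le_of_lt ht))
        (hasDerivAt_rayPoint_right y t).continuousAt
    exact (h1.mul_const d).continuousWithinAt
  have hint : ∀ G : ℂ → ℂ, ContinuousOn (fun t : ℝ => G (rayPoint y t) * d) (Ioi 0) →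
      (∀ t : ℝ, 0 ≤ t → ‖G (rayPoint y t)‖ ≤ C y * Real.exp (-(t / 2))) →
      IntegrableOn (fun t : ℝ => G (rayPoint y t) * d) (Ioi 0) := by
    intro G hG hGb
    refine ((hexp.const_mul (C y)).mul_const ‖d‖).mono' (hG.aestronglyMeasurable
      measurableSet_Ioi) ?_
    filter_upwards [ae_restrict_mem measurableSet_Ioi] with t ht
    rw [norm_mul]
    gcongr
    exact hGb t (le_of_lt ht)
  -- the derivative is the integral of a total derivative along the ray
  have hFTC : ∫ t in Ioi (0 : ℝ), K' (rayPoint y t) * d = -K y := by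
    have hlim : Tendsto (fun t : ℝ => K (rayPoint y t)) atTop (𝓝 0) := by
      have h0 : Tendsto (fun t : ℝ => C y * Real.exp (-(t / 2))) atTop (𝓝 0) := by
        have : Tendsto (fun t : ℝ => t / 2) atTop atTop :=
          tendsto_id.atTop_div_const (by norm_num)
        simpa using (Real.tendsto_exp_neg_atTop_nhds_zero.comp this).const_mul (C y)
      apply squeeze_zero_norm' _ h0
      filter_upwards [eventually_ge_atTop 0] with t ht using hb y hy t ht
    have := integral_Ioi_of_hasDerivAt_of_tendsto' (a := 0) (m := 0)
      (f := fun t : ℝ => K (rayPoint y t)) (f' := fun t : ℝ => K' (rayPoint y t) * d)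
      (fun t ht => (hK y hy t ht).comp t (hasDerivAt_rayPoint_right y t))
      (hint K' hcK' (hb' y hy)) hlim
    rw [this]
    simp [rayPoint]
  rw [← hFTC]
  -- `C` is bounded near `y`
  have hCb : ∀ᶠ u in 𝓝 y, u ∈ U ∧ C u ≤ C y + 1 := by
    have h1 : ∀ᶠ u in 𝓝 y, C u < C y + 1 :=
      (hC.continuousAt (hU.mem_nhds hy)).eventually_lt continuousAt_const (by simp)
    filter_upwards [hU.mem_nhds hy, h1] with u hu hu' using ⟨hu, hu'.le⟩
  refine (hasDerivAt_integral_of_dominated_loc_of_deriv_le (s := {u | u ∈ U ∧ C u ≤ C y + 1})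
    (F := fun y t => K (rayPoint y t) * d) (F' := fun y t => K' (rayPoint y t) * d)
    (bound := fun t => (C y + 1) * Real.exp (-(t / 2)) * ‖d‖) hCb ?_
    (hint K (hcK y hy) (hb y hy)) (hcK'.aestronglyMeasurable measurableSet_Ioi) ?_
    ((hexp.const_mul _).mul_const _) ?_).2
  · filter_upwards [hU.mem_nhds hy] with u hu
    exact (hcK u hu).aestronglyMeasurable measurableSet_Ioi
  · filter_upwards [ae_restrict_mem measurableSet_Ioi] with t ht u hu
    rw [norm_mul]
    gcongr
    exact (hb' u hu.1 t (le_of_lt ht)).trans (by gcongr; exact hu.2)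
  · filter_upwards [ae_restrict_mem measurableSet_Ioi] with t ht u hu
    have := (hK u hu.1 t (le_of_lt ht)).comp u (hasDerivAt_rayPoint_left u t)
    rw [mul_one] at this
    exact this.mul_const d

/-- The equation `β' = a(1/y) β - c(1/y)` with `a(0) = 1` and `c(0) = 0` has a solution of order
`1 / y` on a sector of half-angle `π / 4`, and the homogeneous equation has a nowhere vanishing
solution of order `1 / y` there. -/
lemma exists_solution {a c : ℂ → ℂ} (ha : AnalyticAt ℂ a 0) (hc : AnalyticAt ℂ c 0)
    (ha0 : a 0 = 1) (hc0 : c 0 = 0) : ∃ R : ℝ, 0 < R ∧ ∃ E β : ℂ → ℂ, ∃ C : ℝ,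
      ∀ y ∈ sector 1 R, E y ≠ 0 ∧ HasDerivAt E (a y⁻¹ * E y) y ∧ ‖E y‖ ≤ C / ‖y‖ ∧
        HasDerivAt β (a y⁻¹ * β y - c y⁻¹) y ∧ ‖β y‖ ≤ C / ‖y‖ := by
  obtain ⟨κ₀, hκ₀, E, hE, ⟨C₁, hC₁⟩, C₂, hC₂0, hC₂⟩ := exists_homogeneous_solution ha ha0
  obtain ⟨ρ₁, hρ₁, M₁, hM₁, had, haM⟩ := ha.exists_ball_bound
  obtain ⟨ρ₂, hρ₂, M₂, hM₂, hcd, hcM⟩ := hc.exists_ball_bound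
  obtain ⟨ρ₃, hρ₃, M₃, hM₃, hcd', hcM'⟩ := hc.deriv.exists_ball_bound
  obtain ⟨κ, hκ, hκρ₁, hκρ₂, hκρ₃⟩ : ∃ κ : ℝ, κ₀ ≤ κ ∧ 3 / κ < ρ₁ ∧ 3 / κ < ρ₂ / 2 ∧
      3 / κ < ρ₃ := by
    have t : Tendsto (fun κ : ℝ => 3 / κ) atTop (𝓝 0) := tendsto_const_nhds.div_atTop tendsto_id
    exact ((eventually_ge_atTop κ₀).and ((t.eventually_lt_const hρ₁).and
      ((t.eventually_lt_const (half_pos hρ₂)).and (t.eventually_lt_const hρ₃)))).exists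
  have hκpos : 0 < κ := by linarith
  have hinv : ∀ y ∈ rayHalfPlane κ, ‖y⁻¹‖ < 3 / κ := by
    intro y hy
    have h1 := norm_of_mem_rayHalfPlane hy
    rw [norm_inv, inv_lt_comm₀ (by linarith) (by positivity), inv_div]
    exact h1
  have hsub : sector 1 (2 * κ) ⊆ sector 1 (2 * κ₀) := sector_mono one_pos le_rfl (by linarith)
  have hE' : ∀ y ∈ rayHalfPlane κ, E y ≠ 0 ∧ HasDerivAt E (a y⁻¹ * E y) y := fun y hy =>
    hE y (rayHalfPlane_anti hκ hy)
  have hcl : ∀ v : ℂ, ‖v‖ < ρ₂ / 2 → ‖c v‖ ≤ 2 * M₂ / ρ₂ * ‖v‖ := by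
    intro v hv
    have := norm_sub_le_of_mem_ball hcd hcM (s := ρ₂ / 2) (by linarith) (p := v) (q := 0)
      (by simpa using hv) (by simpa using hρ₂)
    rw [hc0, sub_zero, sub_zero] at this
    calc _ ≤ _ := this
      _ = _ := by field_simp; ring
  set K : ℂ → ℂ := fun η => c η⁻¹ / E η with hK
  set K' : ℂ → ℂ := fun η => (-(deriv c η⁻¹ * (η ^ 2)⁻¹) - c η⁻¹ * a η⁻¹) / E η with hK'
  have hat : ∀ {f : ℂ → ℂ} {ρ : ℝ}, DifferentiableOn ℂ f (Metric.ball 0 ρ) → ∀ η ∈ rayHalfPlane κ,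
      3 / κ ≤ ρ → DifferentiableAt ℂ f η⁻¹ := by
    intro f ρ hf η hη hρ
    exact hf.differentiableAt (Metric.isOpen_ball.mem_nhds (by simpa using (hinv η hη).trans_le hρ))
  have hKd : ∀ η ∈ rayHalfPlane κ, HasDerivAt K (K' η) η := by
    intro η hη
    have hη0 := ne_zero_of_mem_rayHalfPlane hκpos.le hη
    have h1 : HasDerivAt (fun η => c η⁻¹) (deriv c η⁻¹ * (-(η ^ 2)⁻¹)) η :=
      (hat hcd η hη (by linarith)).hasDerivAt.comp η (hasDerivAt_inv hη0)
    obtain ⟨hE0, hEd⟩ := hE' η hη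
    have h2 := h1.div hEd hE0
    have e : (deriv c η⁻¹ * (-(η ^ 2)⁻¹) * E η - c η⁻¹ * (a η⁻¹ * E η)) / E η ^ 2 = K' η := by
      simp only [hK']
      field_simp
    exact e ▸ h2
  have hK'c : ∀ η ∈ rayHalfPlane κ, ContinuousAt K' η := by
    intro η hη
    have hη0 := ne_zero_of_mem_rayHalfPlane hκpos.le hη
    obtain ⟨hE0, hEd⟩ := hE' η hη
    have hi : ContinuousAt (fun η : ℂ => η⁻¹) η := continuousAt_inv₀ hη0
    have h1 : ContinuousAt (fun η => deriv c η⁻¹) η :=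
      ContinuousAt.comp (g := deriv c) (hat hcd' η hη hκρ₃.le).continuousAt hi
    have h2 : ContinuousAt (fun η => c η⁻¹) η :=
      ContinuousAt.comp (g := c) (hat hcd η hη (by linarith)).continuousAt hi
    have h3 : ContinuousAt (fun η => a η⁻¹) η :=
      ContinuousAt.comp (g := a) (hat had η hη hκρ₁.le).continuousAt hi
    have h4 : ContinuousAt (fun η : ℂ => (η ^ 2)⁻¹) η :=
      (continuousAt_id.pow 2).inv₀ (pow_ne_zero 2 hη0)
    exact ((h1.mul h4).neg.sub (h2.mul h3)).div hEd.continuousAt hE0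
  have hcb : ∀ η ∈ rayHalfPlane κ, ‖c η⁻¹‖ ≤ M₂ := fun η hη =>
    hcM _ (by simpa using (hinv η hη).trans (by linarith))
  have hnum : ∀ η ∈ rayHalfPlane κ,
      ‖-(deriv c η⁻¹ * (η ^ 2)⁻¹) - c η⁻¹ * a η⁻¹‖ ≤ M₃ * (3 / κ) ^ 2 + M₂ * M₁ := by
    intro η hη
    refine (norm_sub_le _ _).trans ?_
    rw [norm_neg, norm_mul, norm_mul, ← inv_pow, norm_pow]
    have h1 : ‖deriv c η⁻¹‖ ≤ M₃ := hcM' _ (by simpa using (hinv η hη).trans hκρ₃)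
    have h2 : ‖a η⁻¹‖ ≤ M₁ := haM _ (by simpa using (hinv η hη).trans hκρ₁)
    have h3 := hcb η hη
    have h4 := (hinv η hη).le
    gcongr
  have hratio : ∀ y ∈ sector 1 (2 * κ), ∀ t : ℝ, 0 ≤ t → ∀ n : ℂ, ∀ B : ℝ, ‖n‖ ≤ B →
      ‖n / E (rayPoint y t)‖ ≤ B * (C₂ * ‖E y‖⁻¹) * Real.exp (-(t / 2)) := by
    intro y hy t ht n B hn
    have hE0 := (hE' y (sector_subset_rayHalfPlane hy)).1
    have h1 := hC₂ y (hsub hy) t ht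
    have e : n / E (rayPoint y t) = n * (E y)⁻¹ * (E y / E (rayPoint y t)) := by
      field_simp
    have hB : 0 ≤ B := (norm_nonneg n).trans hn
    rw [e, norm_mul, norm_mul, norm_inv]
    calc _ ≤ B * ‖E y‖⁻¹ * (C₂ * Real.exp (-(t / 2))) := by gcongr
      _ = _ := by ring
  set B : ℝ := M₂ + (M₃ * (3 / κ) ^ 2 + M₂ * M₁) with hB
  have hβ := fun y (hy : y ∈ sector 1 (2 * κ)) =>
    hasDerivAt_integral_ray (K := K) (K' := K') (U := sector 1 (2 * κ))
    (C := fun y => B * (C₂ * ‖E y‖⁻¹)) (isOpen_sector _ _)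
    (fun y hy t _ => hKd _ (rayPoint_mem (sector_subset_rayHalfPlane hy) t))
    (fun y hy t _ => hK'c _ (rayPoint_mem (sector_subset_rayHalfPlane hy) t))
    (fun y hy => by
      obtain ⟨hE0, hEd⟩ := hE' y (sector_subset_rayHalfPlane hy)
      exact (continuousAt_const.mul (continuousAt_const.mul
        (hEd.continuousAt.norm.inv₀ (norm_ne_zero_iff.2 hE0)))).continuousWithinAt)
    (fun y hy t ht => hratio y hy t ht _ _
      ((hcb _ (rayPoint_mem (sector_subset_rayHalfPlane hy) t)).trans
        (by rw [hB]; linarith [show 0 ≤ M₃ * (3 / κ) ^ 2 + M₂ * M₁ by positivity])))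
    (fun y hy t ht => hratio y hy t ht _ _
      ((hnum _ (rayPoint_mem (sector_subset_rayHalfPlane hy) t)).trans (by rw [hB]; linarith))) hy
  set G : ℂ → ℂ := fun y => ∫ t in Ioi (0 : ℝ), K (rayPoint y t) * (1 + 2 * Complex.I) with hG
  set C₃ : ℝ := 2 * M₂ / ρ₂ * 6 * C₂ * ‖(1 + 2 * Complex.I : ℂ)‖ * 2 with hC₃
  refine ⟨2 * κ, by positivity, E, fun y => E y * G y, max C₁ C₃, fun y hy => ?_⟩
  have hyH := sector_subset_rayHalfPlane hy
  obtain ⟨hE0, hEd⟩ := hE' y hyH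
  have hypos : 0 < ‖y‖ := by linarith [hy.2]
  refine ⟨hE0, hEd, (hC₁ y (hsub hy)).trans (by gcongr; exact le_max_left _ _), ?_, ?_⟩
  · have h1 := hEd.mul (hβ y hy)
    have e : a y⁻¹ * E y * G y + E y * -K y = a y⁻¹ * (E y * G y) - c y⁻¹ := by
      simp only [hK]
      field_simp
      ring
    exact e ▸ h1
  · have hb : ‖G y‖ ≤ ∫ t in Ioi (0 : ℝ), 2 * M₂ / ρ₂ * (6 / ‖y‖) * (C₂ * ‖E y‖⁻¹) *
        ‖(1 + 2 * Complex.I : ℂ)‖ * Real.exp (-(1 / 2) * t) := by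
      apply norm_integral_le_of_norm_le
      · exact (exp_neg_integrableOn_Ioi 0 (b := 1 / 2) (by norm_num)).const_mul _
      · filter_upwards [ae_restrict_mem measurableSet_Ioi] with t ht
        have ht0 : 0 ≤ t := le_of_lt ht
        have hη := rayPoint_mem hyH t
        have h1 : ‖c (rayPoint y t)⁻¹‖ ≤ 2 * M₂ / ρ₂ * (6 / ‖y‖) := by
          refine (hcl _ ((hinv _ hη).trans hκρ₂)).trans ?_
          gcongr
          rw [norm_inv, ← inv_div]
          have := norm_rayPoint_ge hy.1 t
          gcongr
        have h2 := hratio y hy t ht0 _ _ h1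
        rw [norm_mul]
        calc _ ≤ 2 * M₂ / ρ₂ * (6 / ‖y‖) * (C₂ * ‖E y‖⁻¹) * Real.exp (-(t / 2)) *
              ‖(1 + 2 * Complex.I : ℂ)‖ := by gcongr
          _ = _ := by rw [show -(t / 2) = -(1 / 2) * t by ring]; ring
    rw [integral_const_mul, integral_exp_mul_Ioi (by norm_num)] at hb
    have hEn : ‖E y‖ ≠ 0 := norm_ne_zero_iff.2 hE0
    rw [norm_mul]
    calc ‖E y‖ * ‖G y‖ ≤ ‖E y‖ * (2 * M₂ / ρ₂ * (6 / ‖y‖) * (C₂ * ‖E y‖⁻¹) *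
          ‖(1 + 2 * Complex.I : ℂ)‖ * (-Real.exp (-(1 / 2) * 0) / -(1 / 2))) := by gcongr
      _ = C₃ / ‖y‖ := by
        simp only [mul_zero, Real.exp_zero, hC₃]
        field_simp
      _ ≤ _ := by gcongr; exact le_max_right _ _

/-- `β` is a solution of order `1 / y` of `(1 + h(1/y)) β' - (1 - g(1/y)) β = -g(1/y)` on the
wide sector `sector 1 R`. -/
structure IsWideBeta (g h : ℂ → ℂ) (R C : ℝ) (β : ℂ → ℂ) : Prop where
  differentiableOn : DifferentiableOn ℂ β (sector 1 R)
  ode : ∀ y ∈ sector 1 R, (1 + h y⁻¹) * deriv β y - (1 - g y⁻¹) * β y = -g y⁻¹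
  bound : ∀ y ∈ sector 1 R, ‖β y‖ ≤ C / ‖y‖

lemma IsWideBeta.mono {g h : ℂ → ℂ} {R R' C : ℝ} {β : ℂ → ℂ} (hβ : IsWideBeta g h R C β)
    (hR : R ≤ R') : IsWideBeta g h R' C β :=
  have hsub : sector 1 R' ⊆ sector 1 R := sector_mono one_pos le_rfl hR
  ⟨hβ.differentiableOn.mono hsub, fun y hy => hβ.ode y (hsub hy), fun y hy => hβ.bound y (hsub hy)⟩

/-- Discs of radius `|y| / 20` about points of the cone of slope `3 / 4` lie in the cone of
slope `1`. -/
lemma ball_subset_sector_one {R : ℝ} {y : ℂ} (hy : y ∈ sector (3 / 4) (2 * R)) :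
    ∀ u ∈ Metric.ball y (‖y‖ / 20), u ∈ sector 1 R ∧ ‖y‖ / 2 ≤ ‖u‖ := by
  intro u hu
  rw [mem_ball_iff_norm] at hu
  have hy0 := norm_pos_iff.2 (ne_zero_of_mem_cone hy.1)
  have h1 : ‖y‖ / 2 < ‖u‖ := by
    have := norm_sub_norm_le y u
    rw [norm_sub_rev] at this
    linarith
  refine ⟨⟨mem_cone_of_norm_sub_le (κ := 1 / 20) (by norm_num) (by norm_num) (by norm_num)
    (by norm_num) hy.1 (by linarith), ?_⟩, h1.le⟩
  linarith [hy.2]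

lemma norm_deriv_le_of_norm_le_div {β : ℂ → ℂ} {R C : ℝ} (hd : DifferentiableOn ℂ β (sector 1 R))
    (hb : ∀ y ∈ sector 1 R, ‖β y‖ ≤ C / ‖y‖) {y : ℂ} (hy : y ∈ sector (3 / 4) (2 * R)) :
    ‖deriv β y‖ ≤ 40 * C / ‖y‖ ^ 2 := by
  have hy0 := norm_pos_iff.2 (ne_zero_of_mem_cone hy.1)
  have hball := ball_subset_sector_one hy
  have hC : 0 ≤ C := by
    have h1 := (norm_nonneg _).trans (hb y (hball y (Metric.mem_ball_self (by positivity))).1)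
    by_contra hneg
    exact absurd h1 (not_le.2 (div_neg_of_neg_of_pos (not_le.1 hneg) hy0))
  have := norm_fderiv_le_of_norm_le (M := C / (‖y‖ / 2)) (show 0 < ‖y‖ / 20 by positivity)
    (hd.mono fun u hu => (hball u hu).1) fun u hu =>
      (hb u (hball u hu).1).trans (by gcongr; exact (hball u hu).2)
  rw [← norm_deriv_eq_norm_fderiv] at this
  calc _ ≤ _ := this
    _ = _ := by field_simp; ring

lemma eventually_inv_of_eventually {p : ℂ → Prop} (hp : ∀ᶠ u in 𝓝 (0 : ℂ), u ≠ 0 → p u) :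
    ∀ᶠ R : ℝ in atTop, ∀ y : ℂ, R ≤ ‖y‖ → p y⁻¹ := by
  obtain ⟨δ, hδ, hpδ⟩ := Metric.eventually_nhds_iff_ball.1 hp
  filter_upwards [eventually_gt_atTop (1 / δ)] with R hR y hy
  have h1 : 0 < 1 / δ := by positivity
  have h2 : 0 < ‖y‖ := by linarith
  refine hpδ _ ?_ (inv_ne_zero (norm_pos_iff.1 h2))
  rw [mem_ball_zero_iff, norm_inv, inv_lt_comm₀ h2 hδ, ← one_div]
  linarith

section Beta

variable {F : ℂ × ℂ → ℂ × ℂ} {A : ℂ × ℂ → ℂ} {g h : ℂ → ℂ}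

/-- On a neighbourhood of infinity the equation for `β` is an explicit equation
`β' = a(1/y) β - c(1/y)`, all of whose solutions on the sector of half-angle `π / 8` extend to a
sector of half-angle `π / 4`, with the same decay. -/
lemma IsNormalForm.exists_wideBeta (hN : IsNormalForm F A g h)
    (hg : ∀ᶠ u in 𝓝 0, gFun F u = g u) (hh : ∀ᶠ u in 𝓝 0, u ≠ 0 → hFun F u = h u) :
    (∃ R β, IsBeta F R β) ∧ ∀ R β, IsBeta F R β → ∃ R₁ C β₁, R ≤ R₁ ∧ IsWideBeta g h R₁ C β₁ ∧
      EqOn β β₁ (sector tanEighth R₁) := by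
  have h1h : ContinuousAt (fun u => 1 + h u) 0 :=
    continuousAt_const.add hN.analyticAt_h.continuousAt
  have h1h0 : 1 + h 0 ≠ 0 := by simp [hN.h_zero]
  obtain ⟨R₂, hR₂, E, β₀, C₀, hsol⟩ := exists_solution
    ((analyticAt_const.sub hN.analyticAt_g).div (analyticAt_const.add hN.analyticAt_h) h1h0 :
      AnalyticAt ℂ (fun u => (1 - g u) / (1 + h u)) 0)
    (hN.analyticAt_g.div (analyticAt_const.add hN.analyticAt_h) h1h0 :
      AnalyticAt ℂ (fun u => g u / (1 + h u)) 0)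
    (by simp [hN.g_zero, hN.h_zero]) (by simp [hN.g_zero])
  have hev := eventually_inv_of_eventually (p := fun u => gFun F u = g u ∧ hFun F u = h u ∧
    1 + h u ≠ 0) (by
      filter_upwards [hg, hh, h1h.eventually_ne h1h0] with u h1 h2 h3 h4 using ⟨h1, h2 h4, h3⟩)
  obtain ⟨R₃, hR₃⟩ := (hev.and (eventually_ge_atTop R₂)).exists
  have hsub : sector 1 R₃ ⊆ sector 1 R₂ := sector_mono one_pos le_rfl hR₃.2
  have hwide : ∀ k : ℂ, IsWideBeta g h R₃ (C₀ + ‖k‖ * C₀) fun y => β₀ y + k * E y := by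
    intro k
    have hd : ∀ y ∈ sector 1 R₃, HasDerivAt (fun y => β₀ y + k * E y)
        (((1 - g y⁻¹) / (1 + h y⁻¹) * β₀ y - g y⁻¹ / (1 + h y⁻¹)) +
          k * ((1 - g y⁻¹) / (1 + h y⁻¹) * E y)) y := by
      intro y hy
      obtain ⟨-, h1, -, h2, -⟩ := hsol y (hsub hy)
      exact h2.add (h1.const_mul k)
    refine ⟨fun y hy => (hd y hy).differentiableAt.differentiableWithinAt, fun y hy => ?_,
      fun y hy => ?_⟩
    · rw [(hd y hy).deriv]
      obtain ⟨-, -, h3⟩ := hR₃.1 y hy.2.le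
      generalize h y⁻¹ = H at h3 ⊢
      generalize g y⁻¹ = G
      field_simp
      ring
    · obtain ⟨-, -, h1, -, h2⟩ := hsol y (hsub hy)
      calc _ ≤ ‖β₀ y‖ + ‖k * E y‖ := norm_add_le _ _
        _ ≤ C₀ / ‖y‖ + ‖k‖ * (C₀ / ‖y‖) := by rw [norm_mul]; gcongr
        _ = _ := by ring
  have ht := tanEighth_bounds
  constructor
  · have hw := hwide 0
    have hsub' : sectorU (2 * R₃) ⊆ sector (3 / 4) (2 * R₃) := by
      rw [sectorU_eq_sector (by linarith)]
      exact sector_mono tanEighth_pos (by linarith) le_rfl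
    have hsub1 : sectorU (2 * R₃) ⊆ sector 1 R₃ :=
      hsub'.trans (sector_mono (by norm_num) (by norm_num) (by linarith))
    refine ⟨2 * R₃, _, by linarith, hw.differentiableOn.mono hsub1, fun y hy => ?_,
      ⟨_, fun y hy => hw.bound y (hsub1 hy)⟩,
      ⟨_, fun y hy => norm_deriv_le_of_norm_le_div hw.differentiableOn hw.bound (hsub' hy)⟩⟩
    obtain ⟨h1, h2, -⟩ := hR₃.1 y (hsub1 hy).2.le
    rw [h1, h2]
    exact hw.ode y (hsub1 hy)
  · intro R β hβ
    set R₁ := max R R₃ with hR₁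
    have hpos := hβ.pos
    have hR₁R : R ≤ R₁ := le_max_left _ _
    have hsubU : sector tanEighth R₁ ⊆ sectorU R := by
      rw [sectorU_eq_sector hpos.le]
      exact sector_mono tanEighth_pos le_rfl hR₁R
    have hsub3 : sector tanEighth R₁ ⊆ sector 1 R₃ :=
      sector_mono tanEighth_pos (by linarith) (le_max_right _ _)
    have hopenU : IsOpen (sectorU R) := by
      rw [sectorU_eq_sector hpos.le]
      exact isOpen_sector _ _
    -- the difference of two solutions is a multiple of the homogeneous solution
    have hd : ∀ y ∈ sector tanEighth R₁, HasDerivAt (fun y => (β y - β₀ y) / E y) 0 y := by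
      intro y hy
      obtain ⟨h0, h1, -, h2, -⟩ := hsol y (hsub (hsub3 hy))
      obtain ⟨e1, e2, e3⟩ := hR₃.1 y (hsub3 hy).2.le
      have h3 : HasDerivAt β ((1 - g y⁻¹) / (1 + h y⁻¹) * β y - g y⁻¹ / (1 + h y⁻¹)) y := by
        have hode := hβ.ode y (hsubU hy)
        rw [e1, e2] at hode
        have h4 := (hβ.holo.differentiableAt (hopenU.mem_nhds (hsubU hy))).hasDerivAt
        have e : (1 - g y⁻¹) / (1 + h y⁻¹) * β y - g y⁻¹ / (1 + h y⁻¹) = deriv β y := by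
          generalize h y⁻¹ = H at e3 hode ⊢
          generalize g y⁻¹ = G at hode ⊢
          field_simp
          linear_combination -hode
        rwa [e]
      have h5 := (h3.sub h2).div h1 h0
      have e : (((1 - g y⁻¹) / (1 + h y⁻¹) * β y - g y⁻¹ / (1 + h y⁻¹) -
          ((1 - g y⁻¹) / (1 + h y⁻¹) * β₀ y - g y⁻¹ / (1 + h y⁻¹))) * E y -
          (β - β₀) y * ((1 - g y⁻¹) / (1 + h y⁻¹) * E y)) / E y ^ 2 = 0 := by
        simp only [Pi.sub_apply]
        field_simp
        ring
      exact e ▸ h5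
    obtain ⟨k, hk⟩ := (isOpen_sector tanEighth R₁).exists_is_const_of_deriv_eq_zero
      (isPreconnected_sector (by linarith))
      (fun y hy => (hd y hy).differentiableAt.differentiableWithinAt) fun y hy => (hd y hy).deriv
    refine ⟨R₁, _, _, hR₁R, (hwide k).mono (le_max_right _ _), fun y hy => ?_⟩
    have h0 := (hsol y (hsub (hsub3 hy))).1
    have h1 := hk y hy
    rw [div_eq_iff h0] at h1
    change β y = β₀ y + k * E y
    linear_combination h1

end Beta

open Asymptotics

/-! ### Asymptotic expansions in the wedge -/

/-- Pairs `(z, w)` with `z` and `w` in cones of slopes `t` and `t'`, and `|z| < 2 |w|`. -/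
def wedge (t t' : ℝ) : Set (ℂ × ℂ) := {p | p.1 ∈ cone t ∧ p.2 ∈ cone t' ∧ ‖p.1‖ < 2 * ‖p.2‖}

/-- The size of the terms whose sum along orbits converges. -/
noncomputable def wedgeError (p : ℂ × ℂ) : ℝ := ‖p.1‖ ^ 2 + ‖p.1‖ * ‖p.2‖ ^ 2

/-- The filter of neighbourhoods of the origin within the wedge in which orbits move. -/
noncomputable abbrev wedgeFilter : Filter (ℂ × ℂ) := 𝓝[wedge (1 / 2) (3 / 4)] 0

lemma eventually_mem_wedge : ∀ᶠ p in wedgeFilter, p ∈ wedge (1 / 2) (3 / 4) :=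
  self_mem_nhdsWithin

lemma tendsto_fst_wedge : Tendsto Prod.fst wedgeFilter (𝓝 (0 : ℂ)) :=
  (continuous_fst.tendsto' (0 : ℂ × ℂ) 0 rfl).mono_left nhdsWithin_le_nhds

lemma tendsto_snd_wedge : Tendsto Prod.snd wedgeFilter (𝓝 (0 : ℂ)) :=
  (continuous_snd.tendsto' (0 : ℂ × ℂ) 0 rfl).mono_left nhdsWithin_le_nhds

lemma fst_isBigO_one : (fun p : ℂ × ℂ => p.1) =O[wedgeFilter] (1 : ℂ × ℂ → ℂ) :=
  tendsto_fst_wedge.isBigO_one ℂ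

lemma snd_isBigO_one : (fun p : ℂ × ℂ => p.2) =O[wedgeFilter] (1 : ℂ × ℂ → ℂ) :=
  tendsto_snd_wedge.isBigO_one ℂ

lemma fst_sq_isBigO : (fun p : ℂ × ℂ => p.1 ^ 2) =O[wedgeFilter] wedgeError := by
  refine IsBigO.of_bound 1 (Eventually.of_forall fun p => ?_)
  rw [norm_pow, one_mul, wedgeError]
  exact (le_add_of_nonneg_right (by positivity)).trans (le_abs_self _)

lemma fst_mul_snd_sq_isBigO :
    (fun p : ℂ × ℂ => p.1 * p.2 ^ 2) =O[wedgeFilter] wedgeError := by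
  refine IsBigO.of_bound 1 (Eventually.of_forall fun p => ?_)
  rw [norm_mul, norm_pow, one_mul, wedgeError]
  exact (le_add_of_nonneg_left (by positivity)).trans (le_abs_self _)

lemma AnalyticAt.isBigO_wedge_one {f : ℂ → ℂ} (hf : AnalyticAt ℂ f 0) :
    (fun p : ℂ × ℂ => f p.2) =O[wedgeFilter] (1 : ℂ × ℂ → ℂ) :=
  (hf.continuousAt.tendsto.comp tendsto_snd_wedge).isBigO_one ℂ

lemma AnalyticAt.isBigO_wedge {f : ℂ → ℂ} (hf : AnalyticAt ℂ f 0) (hf0 : f 0 = 0) :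
    (fun p : ℂ × ℂ => f p.2) =O[wedgeFilter] (fun p => p.2) := by
  have := (hf.differentiableAt.isBigO_sub).comp_tendsto tendsto_snd_wedge
  simpa [hf0, Function.comp_def] using this

lemma AnalyticAt.isBigO_wedge_sq {f : ℂ → ℂ} (hf : AnalyticAt ℂ f 0) (hf0 : f 0 = 0) :
    (fun p : ℂ × ℂ => f p.2 - deriv f 0 * p.2) =O[wedgeFilter] (fun p => p.2 ^ 2) := by
  obtain ⟨C, hC⟩ := hf.exists_norm_sub_sub_le
  refine IsBigO.of_bound C ?_
  filter_upwards [tendsto_snd_wedge.eventually hC] with p hp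
  rw [hf0, sub_zero] at hp
  rwa [norm_pow]

section Expansion

variable {F : ℂ × ℂ → ℂ × ℂ} {A : ℂ × ℂ → ℂ} {g h : ℂ → ℂ}

lemma IsNormalForm.exists_fst_expansion (hN : IsNormalForm F A g h) : ∃ α₀ α₁ : ℂ,
    (fun p : ℂ × ℂ => (F p).1⁻¹ - p.1⁻¹ - (-1 + g p.2 + α₀ * p.1 + α₁ * (p.1 * p.2)))
      =O[wedgeFilter] wedgeError := by
  obtain ⟨α₀, α₁, C, hC⟩ := hN.analyticAt_A.exists_expansion_fst
  refine ⟨α₀, α₁, IsBigO.of_bound C ?_⟩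
  filter_upwards [nhdsWithin_le_nhds hC, nhdsWithin_le_nhds hN.fst, eventually_mem_wedge,
    tendsto_snd_wedge.eventually hN.A_zero] with p h1 h2 h3 h4
  rw [(h2 (ne_zero_of_mem_cone h3.1)).2]
  rw [h4] at h1
  have e : p.1⁻¹ + A p - p.1⁻¹ - (-1 + g p.2 + α₀ * p.1 + α₁ * (p.1 * p.2)) =
      A p - (-1 + g p.2) - p.1 * (α₀ + α₁ * p.2) := by ring
  rw [e, wedgeError]
  rwa [Real.norm_of_nonneg (by positivity)]

lemma IsNormalForm.snd_isBigO (hN : IsNormalForm F A g h) :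
    (fun p : ℂ × ℂ => (F p).2 - p.2 + p.1 * p.2 ^ 2 * (1 + h p.2)) =O[wedgeFilter]
      (fun p => p.1 ^ 2 * p.2 ^ 2) := by
  obtain ⟨C, hC⟩ := hN.snd
  refine IsBigO.of_bound (|C| * 9) ?_
  filter_upwards [nhdsWithin_le_nhds hC, eventually_mem_wedge] with p h1 h2
  have e : (F p).2 - p.2 + p.1 * p.2 ^ 2 * (1 + h p.2) =
      (F p).2 - (p.2 - p.1 * p.2 ^ 2 * (1 + h p.2)) := by ring
  rw [e]
  calc _ ≤ _ := h1
    _ ≤ |C| * (‖p.1‖ ^ 2 * (3 * ‖p.2‖) ^ 2) := by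
      gcongr
      · exact le_abs_self C
      · linarith [h2.2.2]
    _ = _ := by rw [norm_mul, norm_pow, norm_pow]; ring

lemma IsNormalForm.snd_sub_isBigO (hN : IsNormalForm F A g h) :
    (fun p : ℂ × ℂ => (F p).2 - p.2) =O[wedgeFilter] (fun p => p.1 * p.2 ^ 2) := by
  have h1 : (fun p : ℂ × ℂ => p.1 ^ 2 * p.2 ^ 2) =O[wedgeFilter] (fun p => p.1 * p.2 ^ 2) := by
    have := fst_isBigO_one.mul (isBigO_refl (fun p : ℂ × ℂ => p.1 * p.2 ^ 2) wedgeFilter)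
    refine this.congr (fun p => by ring) (fun p => by simp)
  have h2 : (fun p : ℂ × ℂ => p.1 * p.2 ^ 2 * (1 + h p.2)) =O[wedgeFilter]
      (fun p => p.1 * p.2 ^ 2) := by
    have := (isBigO_refl (fun p : ℂ × ℂ => p.1 * p.2 ^ 2) wedgeFilter).mul
      ((analyticAt_const.add hN.analyticAt_h).isBigO_wedge_one (f := fun w => 1 + h w))
    refine this.congr (fun p => rfl) (fun p => by simp)
  refine ((hN.snd_isBigO.trans h1).sub h2).congr (fun p => by ring) (fun p => rfl)

lemma IsNormalForm.eventually_norm_snd_ge (hN : IsNormalForm F A g h) :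
    ∀ᶠ p in wedgeFilter, ‖p.2‖ / 2 ≤ ‖(F p).2‖ := by
  have h1 : (fun p : ℂ × ℂ => (F p).2 - p.2) =o[wedgeFilter] (fun p => p.2) := by
    refine hN.snd_sub_isBigO.trans_isLittleO ?_
    have hlim : Tendsto (fun p : ℂ × ℂ => p.1 * p.2) wedgeFilter (𝓝 0) := by
      simpa using tendsto_fst_wedge.mul tendsto_snd_wedge
    have := ((isLittleO_one_iff ℂ).2 hlim).mul_isBigO
      (isBigO_refl (fun p : ℂ × ℂ => p.2) wedgeFilter)
    refine this.congr (fun p => by ring) (fun p => by simp)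
  filter_upwards [h1.bound (show (0 : ℝ) < 1 / 2 by norm_num)] with p hp
  have := norm_sub_norm_le p.2 (F p).2
  rw [norm_sub_rev] at this
  linarith

lemma IsNormalForm.snd_inv_isBigO (hN : IsNormalForm F A g h) :
    (fun p : ℂ × ℂ => (F p).2⁻¹ - p.2⁻¹ - p.1 * (1 + h p.2)) =O[wedgeFilter]
      (fun p => p.1 ^ 2) := by
  -- the common denominator is `w w₁`, of size `|w|²`
  have h1 : (fun p : ℂ × ℂ => -((F p).2 - p.2 + p.1 * p.2 ^ 2 * (1 + h p.2)) -
      p.1 * (1 + h p.2) * p.2 * ((F p).2 - p.2)) =O[wedgeFilter]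
      (fun p => p.1 ^ 2 * p.2 ^ 2) := by
    refine hN.snd_isBigO.neg_left.sub ?_
    have := (((isBigO_refl (fun p : ℂ × ℂ => p.1) wedgeFilter).mul
      ((analyticAt_const.add hN.analyticAt_h).isBigO_wedge_one (f := fun w => 1 + h w))).mul
      snd_isBigO_one).mul hN.snd_sub_isBigO
    refine this.congr (fun p => rfl) (fun p => ?_)
    simp only [Pi.one_apply]
    ring
  obtain ⟨C, hC⟩ := h1.bound
  refine IsBigO.of_bound (2 * C) ?_
  filter_upwards [hC, hN.eventually_norm_snd_ge, eventually_mem_wedge] with p h2 h3 h4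
  have hw : p.2 ≠ 0 := ne_zero_of_mem_cone h4.2.1
  have hwn := norm_pos_iff.2 hw
  have hw1n : 0 < ‖(F p).2‖ := by linarith
  have hw1 : (F p).2 ≠ 0 := norm_pos_iff.1 hw1n
  have e : (F p).2⁻¹ - p.2⁻¹ - p.1 * (1 + h p.2) =
      (-((F p).2 - p.2 + p.1 * p.2 ^ 2 * (1 + h p.2)) -
        p.1 * (1 + h p.2) * p.2 * ((F p).2 - p.2)) / (p.2 * (F p).2) := by
    generalize h p.2 = H
    field_simp
    ring
  rw [e, norm_div, norm_mul p.2, div_le_iff₀ (by positivity)]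
  refine h2.trans ?_
  rw [norm_mul, norm_pow, norm_pow]
  have hC0 : 0 ≤ C * ‖p.1‖ ^ 2 := by
    have h5 := (norm_nonneg _).trans h2
    rw [norm_mul, norm_pow, norm_pow, ← mul_assoc] at h5
    exact nonneg_of_mul_nonneg_left h5 (by positivity)
  calc C * (‖p.1‖ ^ 2 * ‖p.2‖ ^ 2) = 2 * (C * ‖p.1‖ ^ 2) * (‖p.2‖ * (‖p.2‖ / 2)) := by ring
    _ ≤ 2 * (C * ‖p.1‖ ^ 2) * (‖p.2‖ * ‖(F p).2‖) := by gcongr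
    _ = _ := by ring

lemma IsNormalForm.snd_inv_sub_isBigO (hN : IsNormalForm F A g h) :
    (fun p : ℂ × ℂ => (F p).2⁻¹ - p.2⁻¹) =O[wedgeFilter] (fun p => p.1) := by
  have h1 : (fun p : ℂ × ℂ => p.1 ^ 2) =O[wedgeFilter] (fun p => p.1) := by
    have := fst_isBigO_one.mul (isBigO_refl (fun p : ℂ × ℂ => p.1) wedgeFilter)
    exact this.congr (fun p => by ring) (fun p => by simp)
  have h2 : (fun p : ℂ × ℂ => p.1 * (1 + h p.2)) =O[wedgeFilter] (fun p => p.1) := by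
    have := (isBigO_refl (fun p : ℂ × ℂ => p.1) wedgeFilter).mul
      ((analyticAt_const.add hN.analyticAt_h).isBigO_wedge_one (f := fun w => 1 + h w))
    exact this.congr (fun p => rfl) (fun p => by simp)
  exact ((hN.snd_inv_isBigO.trans h1).add h2).congr (fun p => by ring) (fun p => rfl)

lemma wedgeError_tendsto : Tendsto wedgeError wedgeFilter (𝓝 0) := by
  have h1 : Continuous wedgeError := by
    unfold wedgeError
    fun_prop
  exact (h1.tendsto' 0 0 (by simp [wedgeError])).mono_left nhdsWithin_le_nhds

lemma IsNormalForm.fst_inv_sub_tendsto (hN : IsNormalForm F A g h) :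
    Tendsto (fun p : ℂ × ℂ => (F p).1⁻¹ - p.1⁻¹ + 1) wedgeFilter (𝓝 0) := by
  obtain ⟨α₀, α₁, hα⟩ := hN.exists_fst_expansion
  have h1 := hα.trans_tendsto wedgeError_tendsto
  have h2 : Tendsto (fun p : ℂ × ℂ => g p.2) wedgeFilter (𝓝 0) := by
    have := hN.analyticAt_g.continuousAt.tendsto.comp tendsto_snd_wedge
    rwa [hN.g_zero] at this
  have h3 : Tendsto (fun p : ℂ × ℂ => g p.2 + α₀ * p.1 + α₁ * (p.1 * p.2)) wedgeFilter (𝓝 0) := by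
    simpa using (h2.add (tendsto_fst_wedge.const_mul α₀)).add
      ((tendsto_fst_wedge.mul tendsto_snd_wedge).const_mul α₁)
  have := h1.add h3
  rw [add_zero] at this
  exact this.congr fun p => by ring

lemma IsNormalForm.snd_inv_sub_isLittleO (hN : IsNormalForm F A g h) :
    (fun p : ℂ × ℂ => (F p).2⁻¹ - (p.2⁻¹ + p.1)) =o[wedgeFilter] (fun p => p.1) := by
  have h1 : (fun p : ℂ × ℂ => p.1 ^ 2) =o[wedgeFilter] (fun p => p.1) := by
    have := ((isLittleO_one_iff ℂ).2 tendsto_fst_wedge).mul_isBigO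
      (isBigO_refl (fun p : ℂ × ℂ => p.1) wedgeFilter)
    exact this.congr (fun p => by ring) (fun p => by simp)
  have h2 : (fun p : ℂ × ℂ => h p.2 * p.1) =o[wedgeFilter] (fun p => p.1) := by
    have hlim : Tendsto (fun p : ℂ × ℂ => h p.2) wedgeFilter (𝓝 0) := by
      have := hN.analyticAt_h.continuousAt.tendsto.comp tendsto_snd_wedge
      rwa [hN.h_zero] at this
    have := ((isLittleO_one_iff ℂ).2 hlim).mul_isBigO
      (isBigO_refl (fun p : ℂ × ℂ => p.1) wedgeFilter)
    exact this.congr (fun p => rfl) (fun p => by simp)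
  exact ((hN.snd_inv_isBigO.trans_isLittleO h1).add h2).congr (fun p => by ring) (fun p => rfl)

end Expansion

/-! ### The approximate Fatou coordinate -/

/-- The approximate Fatou coordinate `x (1 + β(y)) + r log x + s log y` at `(z, w)`, with `x = 1/z`
and `y = 1/w`, where `log ζ` stands for the branch `Log (-ζ) + k` of the logarithm on the left
half-plane. -/
noncomputable def fatouApprox (β : ℂ → ℂ) (k r s : ℂ) (p : ℂ × ℂ) : ℂ :=
  p.1⁻¹ * (1 + β p.2⁻¹) + r * (Complex.log (-p.1⁻¹) + k) + s * (Complex.log (-p.2⁻¹) + k)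

/-- First-order expansion of `ζ ↦ Log (-ζ)` on the left half-plane. -/
lemma norm_log_neg_add_sub_le {ζ u : ℂ} (hζ : ζ.re < 0) (hu : ‖u‖ ≤ ‖ζ‖ / 2) :
    ‖Complex.log (-(ζ + u)) - Complex.log (-ζ) - u / ζ‖ ≤ ‖u / ζ‖ ^ 2 := by
  have hζ0 : ζ ≠ 0 := by
    rintro rfl
    simp at hζ
  have hζn := norm_pos_iff.2 hζ0
  set q := u / ζ with hq
  have hqn : ‖q‖ ≤ 1 / 2 := by
    rw [hq, norm_div, div_le_iff₀ hζn]
    linarith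
  have e : -(ζ + u) = -ζ * (1 + q) := by
    rw [hq]
    field_simp
  have hre : 0 < (1 + q).re := by
    have := neg_le_of_abs_le (Complex.abs_re_le_norm q)
    rw [Complex.add_re, Complex.one_re]
    linarith
  have h1q : 1 + q ≠ 0 := by
    intro h
    rw [h] at hre
    simp at hre
  have ha1 := abs_lt.1 (Complex.abs_arg_lt_pi_div_two_iff.2 (Or.inl (show 0 < (-ζ).re by
    rw [Complex.neg_re]; linarith)))
  have ha2 := abs_lt.1 (Complex.abs_arg_lt_pi_div_two_iff.2 (Or.inl hre))
  rw [e, Complex.log_mul (neg_ne_zero.2 hζ0) h1q ⟨by linarith, by linarith⟩]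
  have h1 := Complex.norm_log_one_add_sub_self_le (z := q) (by linarith)
  have h2 : (1 - ‖q‖)⁻¹ ≤ 2 := by
    rw [inv_le_comm₀ (by linarith) (by norm_num)]
    linarith
  calc _ = ‖Complex.log (1 + q) - q‖ := by congr 1; ring
    _ ≤ ‖q‖ ^ 2 * (1 - ‖q‖)⁻¹ / 2 := h1
    _ ≤ ‖q‖ ^ 2 * 2 / 2 := by gcongr
    _ = _ := by ring

lemma eventually_inv_mem_sector (R : ℝ) : ∀ᶠ p in wedgeFilter,
    p.1⁻¹ ∈ sector (1 / 2) R ∧ p.2⁻¹ ∈ sector (3 / 4) R := by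
  have hR : 0 < (|R| + 1)⁻¹ := by positivity
  have key : ∀ u : ℂ, u ≠ 0 → ‖u‖ < (|R| + 1)⁻¹ → R < ‖u⁻¹‖ := by
    intro u hu h
    rw [norm_inv]
    rw [lt_inv_comm₀ (norm_pos_iff.2 hu) (by positivity)] at h
    linarith [le_abs_self R]
  filter_upwards [eventually_mem_wedge,
    tendsto_fst_wedge.norm.eventually_lt_const (norm_zero.trans_lt hR),
    tendsto_snd_wedge.norm.eventually_lt_const (norm_zero.trans_lt hR)] with p h1 h2 h3
  exact ⟨⟨inv_mem_cone h1.1, key _ (ne_zero_of_mem_cone h1.1) h2⟩,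
    ⟨inv_mem_cone h1.2.1, key _ (ne_zero_of_mem_cone h1.2.1) h3⟩⟩

section Beta

variable {g h β : ℂ → ℂ} {R C : ℝ}

lemma IsWideBeta.isBigO (hβ : IsWideBeta g h R C β) :
    (fun p : ℂ × ℂ => β p.2⁻¹) =O[wedgeFilter] (fun p => p.2) := by
  refine IsBigO.of_bound C ?_
  filter_upwards [eventually_inv_mem_sector R] with p hp
  have := hβ.bound _ (sector_mono (by norm_num) (by norm_num) le_rfl hp.2)
  rwa [norm_inv, div_inv_eq_mul] at this

lemma IsWideBeta.deriv_isBigO (hβ : IsWideBeta g h R C β) :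
    (fun p : ℂ × ℂ => deriv β p.2⁻¹) =O[wedgeFilter] (fun p => p.2 ^ 2) := by
  refine IsBigO.of_bound (40 * C) ?_
  filter_upwards [eventually_inv_mem_sector (2 * R)] with p hp
  have := norm_deriv_le_of_norm_le_div hβ.differentiableOn hβ.bound hp.2
  rwa [norm_inv, inv_pow, div_inv_eq_mul, ← norm_pow] at this

/-- The leading coefficient of `β` is `g'(0)`, by the differential equation. -/
lemma IsWideBeta.sub_isBigO (hβ : IsWideBeta g h R C β) (hg : AnalyticAt ℂ g 0)
    (hh : AnalyticAt ℂ h 0) (hg0 : g 0 = 0) :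
    (fun p : ℂ × ℂ => β p.2⁻¹ - deriv g 0 * p.2) =O[wedgeFilter] (fun p => p.2 ^ 2) := by
  have h1 : (fun p : ℂ × ℂ => g p.2 * β p.2⁻¹) =O[wedgeFilter] (fun p => p.2 ^ 2) :=
    ((hg.isBigO_wedge hg0).mul hβ.isBigO).congr (fun _ => rfl) (fun p => by ring)
  have h2 : (fun p : ℂ × ℂ => (1 + h p.2) * deriv β p.2⁻¹) =O[wedgeFilter] (fun p => p.2 ^ 2) :=
    (((analyticAt_const.add hh).isBigO_wedge_one (f := fun w => 1 + h w)).mul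
      hβ.deriv_isBigO).congr (fun _ => rfl) (fun p => by simp)
  refine (((hg.isBigO_wedge_sq hg0).add h1).add h2).congr' ?_ EventuallyEq.rfl
  filter_upwards [eventually_inv_mem_sector R] with p hp
  have := hβ.ode _ (sector_mono (by norm_num) (by norm_num) le_rfl hp.2)
  rw [inv_inv] at this
  linear_combination this

/-- Cauchy's estimate on discs of radius comparable to `|y|` gives `β'' = O(1/y³)`. -/
lemma IsWideBeta.taylor_isBigO (hβ : IsWideBeta g h R C β) {f : ℂ × ℂ → ℂ}
    (hf : f =O[wedgeFilter] (fun p => p.1)) :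
    (fun p : ℂ × ℂ => β (p.2⁻¹ + f p) - β p.2⁻¹ - deriv β p.2⁻¹ * f p) =O[wedgeFilter]
      (fun p => p.1 ^ 2 * p.2 ^ 3) := by
  obtain ⟨K, hK⟩ := hf.bound
  have hlim : Tendsto (fun p => ‖f p‖) wedgeFilter (𝓝 0) := by
    simpa using (hf.trans_tendsto tendsto_fst_wedge).norm
  have hK' : ∀ᶠ p in wedgeFilter, ‖f p‖ < 1 / 80 := hlim.eventually_lt_const (by norm_num)
  refine IsBigO.of_bound (8 * (2 * |C|) * 20 ^ 2 * K ^ 2) ?_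
  filter_upwards [hK, hK', eventually_inv_mem_sector (2 * R), eventually_inv_mem_sector 1]
    with p h1 h2 h3 h4
  set y := p.2⁻¹ with hy
  have hy1 : 1 < ‖y‖ := h4.2.2
  have hball := ball_subset_sector_one h3.2
  have := norm_sub_sub_deriv_mul_le (M := |C| / (‖y‖ / 2)) (h := f p)
    (show 0 < ‖y‖ / 20 by positivity) (hβ.differentiableOn.mono fun u hu => (hball u hu).1)
    (fun u hu => (hβ.bound u (hball u hu).1).trans (by
      have := (hball u hu).2
      gcongr
      exact le_abs_self C)) (by linarith)
  calc _ ≤ _ := this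
    _ ≤ 8 * (|C| / (‖y‖ / 2)) / (‖y‖ / 20) ^ 2 * (K * ‖p.1‖) ^ 2 := by gcongr
    _ = _ := by
      have e : ‖p.2‖ = ‖y‖⁻¹ := by rw [hy, norm_inv, inv_inv]
      rw [norm_mul, norm_pow, norm_pow, e]
      field_simp

end Beta

/-- With suitable coefficients `r` and `s`, the approximate Fatou coordinate decreases by one at
each step, up to terms whose sums along orbits converge. The equation for `β` makes the error
vanish at order zero in `z`; `r` and `s` remove the terms in `z` and `z w`. -/
lemma IsNormalForm.exists_fatouApprox {F : ℂ × ℂ → ℂ × ℂ} {A : ℂ × ℂ → ℂ} {g h : ℂ → ℂ}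
    (hN : IsNormalForm F A g h) : ∃ r s : ℂ, ∀ (β : ℂ → ℂ) (R C : ℝ), IsWideBeta g h R C β → ∀ k,
      (fun p => fatouApprox β k r s (F p) - fatouApprox β k r s p + 1)
        =O[wedgeFilter] wedgeError := by
  obtain ⟨α₀, α₁, hα⟩ := hN.exists_fst_expansion
  set g₁ := deriv g 0 with hg₁
  set r := α₀ with hr
  set s := -(α₁ + 2 * α₀ * g₁) with hs
  refine ⟨r, s, fun β R C hβ k => ?_⟩
  set X : ℂ × ℂ → ℂ := fun p => (F p).1⁻¹ - p.1⁻¹ with hX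
  set Y : ℂ × ℂ → ℂ := fun p => (F p).2⁻¹ - p.2⁻¹ with hY
  set ex : ℂ × ℂ → ℂ := fun p => X p - (-1 + g p.2 + α₀ * p.1 + α₁ * (p.1 * p.2)) with hex
  set ey : ℂ × ℂ → ℂ := fun p => Y p - p.1 * (1 + h p.2) with hey
  set B : ℂ × ℂ → ℂ := fun p => β p.2⁻¹ with hB
  set B' : ℂ × ℂ → ℂ := fun p => deriv β p.2⁻¹ with hB'
  set eβ : ℂ × ℂ → ℂ := fun p => β (F p).2⁻¹ - B p - B' p * Y p with heβ
  set eb : ℂ × ℂ → ℂ := fun p => B p - g₁ * p.2 with heb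
  set eg : ℂ × ℂ → ℂ := fun p => g p.2 - g₁ * p.2 with heg
  set lx : ℂ × ℂ → ℂ := fun p =>
    Complex.log (-(F p).1⁻¹) - Complex.log (-p.1⁻¹) - X p * p.1 with hlx
  set ly : ℂ × ℂ → ℂ := fun p =>
    Complex.log (-(F p).2⁻¹) - Complex.log (-p.2⁻¹) - Y p * p.2 with hly
  -- sizes of the individual quantities
  have z1 := fst_isBigO_one
  have w1 := snd_isBigO_one
  have zz := isBigO_refl (fun p : ℂ × ℂ => p.1) wedgeFilter
  have ww := isBigO_refl (fun p : ℂ × ℂ => p.2) wedgeFilter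
  have hexO : ex =O[wedgeFilter] wedgeError := hα
  have hex1 : ex =O[wedgeFilter] (1 : ℂ × ℂ → ℂ) :=
    (hexO.trans_tendsto wedgeError_tendsto).isBigO_one ℂ
  have heyO : ey =O[wedgeFilter] (fun p => p.1 ^ 2) := hN.snd_inv_isBigO
  have hXO : X =O[wedgeFilter] (1 : ℂ × ℂ → ℂ) := by
    have h1 := (hN.fst_inv_sub_tendsto.isBigO_one ℂ).sub
      (isBigO_refl (1 : ℂ × ℂ → ℂ) wedgeFilter)
    exact h1.congr (fun p => by simp [hX]) (fun p => rfl)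
  have hYO : Y =O[wedgeFilter] (fun p => p.1) := hN.snd_inv_sub_isBigO
  have hBO : B =O[wedgeFilter] (fun p => p.2) := hβ.isBigO
  have hB1 : B =O[wedgeFilter] (1 : ℂ × ℂ → ℂ) := hBO.trans w1
  have hB'O : B' =O[wedgeFilter] (fun p => p.2 ^ 2) := hβ.deriv_isBigO
  have hebO : eb =O[wedgeFilter] (fun p => p.2 ^ 2) :=
    hβ.sub_isBigO hN.analyticAt_g hN.analyticAt_h hN.g_zero
  have hegO : eg =O[wedgeFilter] (fun p => p.2 ^ 2) := hN.analyticAt_g.isBigO_wedge_sq hN.g_zero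
  have hhO := hN.analyticAt_h.isBigO_wedge hN.h_zero
  have heβO : eβ =O[wedgeFilter] (fun p => p.1 ^ 2 * p.2 ^ 3) := by
    refine (hβ.taylor_isBigO hYO).congr (fun p => ?_) (fun p => rfl)
    simp only [hY, heβ, hB, hB', add_sub_cancel]
  have hlog : ∀ (ζ f : ℂ × ℂ → ℂ), f =O[wedgeFilter] (1 : ℂ × ℂ → ℂ) →
      Tendsto ζ wedgeFilter (𝓝 0) → (∀ᶠ p in wedgeFilter, ζ p ∈ cone (3 / 4)) →
      (fun p => Complex.log (-((ζ p)⁻¹ + f p)) - Complex.log (-(ζ p)⁻¹) - f p * ζ p)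
        =O[wedgeFilter] (fun p => (f p * ζ p) ^ 2) := by
    intro ζ f hf hζ hζc
    refine IsBigO.of_bound 1 ?_
    have hlim : Tendsto (fun p => ‖f p * ζ p‖) wedgeFilter (𝓝 0) := by
      have h1 : (fun p => f p * ζ p) =O[wedgeFilter] ζ :=
        (hf.mul (isBigO_refl ζ wedgeFilter)).congr (fun _ => rfl) (fun p => by simp)
      simpa using (h1.trans_tendsto hζ).norm
    filter_upwards [hζc, hlim.eventually_lt_const (show (0 : ℝ) < 1 / 2 by norm_num)]
      with p h1 h2
    have h3 := inv_mem_cone h1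
    have h4 := norm_pos_iff.2 (ne_zero_of_mem_cone h1)
    have := norm_log_neg_add_sub_le (u := f p) (re_neg_of_mem_cone (by norm_num) h3) (by
      rw [norm_inv]
      rw [norm_mul] at h2
      field_simp
      linarith)
    rwa [div_inv_eq_mul, ← norm_pow, ← one_mul ‖(f p * ζ p) ^ 2‖] at this
  have hlxO : lx =O[wedgeFilter] (fun p => p.1 ^ 2) := by
    have h1 := hlog (fun p => p.1) X hXO tendsto_fst_wedge
      (eventually_mem_wedge.mono fun p hp => cone_mono (by norm_num) (by norm_num) hp.1)
    have h2 : (fun p : ℂ × ℂ => (X p * p.1) ^ 2) =O[wedgeFilter] (fun p => p.1 ^ 2) :=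
      ((hXO.mul zz).pow 2).congr (fun _ => rfl) (fun p => by simp)
    refine (h1.trans h2).congr (fun p => ?_) (fun p => rfl)
    simp only [hlx, hX, add_sub_cancel]
  have hlyO : ly =O[wedgeFilter] (fun p => p.1 ^ 2) := by
    have h1 := hlog (fun p => p.2) Y (hYO.trans z1) tendsto_snd_wedge
      (eventually_mem_wedge.mono fun p hp => hp.2.1)
    have h2 : (fun p : ℂ × ℂ => (Y p * p.2) ^ 2) =O[wedgeFilter] (fun p => p.1 ^ 2) :=
      ((hYO.mul w1).pow 2).congr (fun _ => rfl) (fun p => by simp)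
    refine (h1.trans h2).congr (fun p => ?_) (fun p => rfl)
    simp only [hly, hY, add_sub_cancel]
  -- the two kinds of error terms
  have E1 := fst_sq_isBigO
  have E2 := fst_mul_snd_sq_isBigO
  have t1 : (fun p => ex p * (1 + B p)) =O[wedgeFilter] wedgeError :=
    (hexO.mul ((isBigO_refl (1 : ℂ × ℂ → ℂ) wedgeFilter).add hB1).norm_right).congr
      (fun _ => rfl) (fun p => by simp)
  have t2 : (fun p => p.1⁻¹ * B' p * ey p) =O[wedgeFilter] wedgeError := by
    refine IsBigO.trans ?_ E2
    have := ((isBigO_refl (fun p : ℂ × ℂ => p.1⁻¹) wedgeFilter).mul hB'O).mul heyO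
    refine this.congr' EventuallyEq.rfl ?_
    filter_upwards [eventually_mem_wedge] with p hp
    have := ne_zero_of_mem_cone hp.1
    field_simp
  have t3 : (fun p => X p * B' p * Y p) =O[wedgeFilter] wedgeError :=
    (((hXO.mul hB'O).mul hYO).congr (fun _ => rfl)
      (fun p => by rw [Pi.one_apply]; ring)).trans E2
  have t4 : (fun p => (p.1⁻¹ + X p) * eβ p) =O[wedgeFilter] wedgeError := by
    have h1 : (fun p => p.1⁻¹ * eβ p) =O[wedgeFilter] wedgeError := by
      refine IsBigO.trans ?_ E2
      have h2 := ((isBigO_refl (fun p : ℂ × ℂ => p.1⁻¹) wedgeFilter).mul heβO)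
      have h3 : (fun p : ℂ × ℂ => p.1⁻¹ * (p.1 ^ 2 * p.2 ^ 3)) =ᶠ[wedgeFilter]
          fun p => p.1 * p.2 ^ 2 * p.2 := by
        filter_upwards [eventually_mem_wedge] with p hp
        have := ne_zero_of_mem_cone hp.1
        field_simp
      refine (h2.congr' EventuallyEq.rfl h3).trans ?_
      exact ((isBigO_refl (fun p : ℂ × ℂ => p.1 * p.2 ^ 2) wedgeFilter).mul w1).congr
        (fun _ => rfl) (fun p => by simp)
    have h2 : (fun p => X p * eβ p) =O[wedgeFilter] wedgeError := by
      refine IsBigO.trans ?_ E1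
      have h3 := hXO.mul heβO
      have h4 : (fun p : ℂ × ℂ => p.1 ^ 2 * p.2 ^ 3) =O[wedgeFilter] (fun p => p.1 ^ 2) :=
        ((isBigO_refl (fun p : ℂ × ℂ => p.1 ^ 2) wedgeFilter).mul (w1.pow 3)).congr
          (fun _ => rfl) (fun p => by simp)
      exact (h3.congr (fun _ => rfl) (fun p => by rw [Pi.one_apply, one_mul])).trans h4
    exact (h1.add h2).congr (fun p => by ring) (fun _ => rfl)
  have t5 : (fun p => p.1 * eb p) =O[wedgeFilter] wedgeError := (zz.mul hebO).trans E2
  have t6 : (fun p => p.1 * p.2 * B p) =O[wedgeFilter] wedgeError :=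
    (((zz.mul ww).mul hBO).congr (fun _ => rfl) (fun p => by ring)).trans E2
  have t7 : (fun p => p.1 * eg p) =O[wedgeFilter] wedgeError := (zz.mul hegO).trans E2
  have t8 : (fun p : ℂ × ℂ => p.1 ^ 2 * p.2) =O[wedgeFilter] wedgeError :=
    (((isBigO_refl (fun p : ℂ × ℂ => p.1 ^ 2) wedgeFilter).mul w1).congr
      (fun _ => rfl) (fun p => by simp)).trans E1
  have t9 : (fun p => p.1 * ex p) =O[wedgeFilter] wedgeError :=
    (z1.norm_right.mul hexO).congr (fun _ => rfl) (fun p => by simp)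
  have t10 : (fun p : ℂ × ℂ => p.1 * p.2 * h p.2) =O[wedgeFilter] wedgeError :=
    (((zz.mul ww).mul hhO).congr (fun _ => rfl) (fun p => by ring)).trans E2
  have t11 : (fun p => p.2 * ey p) =O[wedgeFilter] wedgeError :=
    ((w1.mul heyO).congr (fun _ => rfl) (fun p => by simp)).trans E1
  have t12 := hlxO.trans E1
  have t13 := hlyO.trans E1
  have total := ((((((t1.add t2).add t3).add t4).add (t5.const_mul_left α₀)).add
    (t6.const_mul_left α₁)).add (((((t7.add (E1.const_mul_left α₀)).add
      (t8.const_mul_left α₁)).add t9).add t12).const_mul_left r)).add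
    (((t10.add t11).add t13).const_mul_left s)
  refine total.congr' ?_ EventuallyEq.rfl
  filter_upwards [eventually_inv_mem_sector R, eventually_mem_wedge] with p hp hpw
  have hode := hβ.ode _ (sector_mono (by norm_num) (by norm_num) le_rfl hp.2)
  rw [inv_inv] at hode
  have hz : p.1⁻¹ * p.1 = 1 := inv_mul_cancel₀ (ne_zero_of_mem_cone hpw.1)
  have e1 : (F p).1⁻¹ = p.1⁻¹ + X p := by simp [hX]
  have e2 : β (F p).2⁻¹ = B p + B' p * Y p + eβ p := by simp only [heβ]; ring
  have e3 : Complex.log (-(F p).1⁻¹) = Complex.log (-p.1⁻¹) + X p * p.1 + lx p := by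
    simp only [hlx]; ring
  have e4 : Complex.log (-(F p).2⁻¹) = Complex.log (-p.2⁻¹) + Y p * p.2 + ly p := by
    simp only [hly]; ring
  have e5 : X p = ex p + (-1 + g p.2 + α₀ * p.1 + α₁ * (p.1 * p.2)) := by
    simp only [hex]; ring
  have e6 : Y p = ey p + p.1 * (1 + h p.2) := by simp only [hey]; ring
  have e7 : β p.2⁻¹ = B p := rfl
  have e8 : deriv β p.2⁻¹ = B' p := rfl
  have e9 : B p = eb p + g₁ * p.2 := by simp only [heb]; ring
  have e10 : g p.2 = eg p + g₁ * p.2 := by simp only [heg]; ring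
  rw [e7, e8] at hode
  simp only [fatouApprox]
  rw [e3, e4, e1, e2, e7]
  clear_value X Y ex ey B B' eβ eb eg lx ly
  rw [hs, hr]
  linear_combination -(1 + B p + α₀ * p.1) * e5 -
    (p.1⁻¹ * B' p - (α₁ + 2 * α₀ * g₁) * p.2) * e6 - B' p * (1 + h p.2) * hz - hode -
    α₀ * p.1 * e9 - α₀ * p.1 * e10

/-! ### Limits of almost Abel functions -/

section Abel

variable {X : Type*} {T : X → X} {Φ : X → ℂ} {lam : X → ℝ} {W : Set X}

lemma antitone_iterate_of_le (hmaps : MapsTo T W W) (hdec : ∀ p ∈ W, lam (T p) ≤ lam p) {p : X}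
    (hp : p ∈ W) : Antitone fun n => lam (T^[n] p) := by
  refine antitone_nat_of_succ_le fun n => ?_
  rw [Function.iterate_succ_apply']
  exact hdec _ (hmaps.iterate n hp)

lemma norm_add_natCast_sub_le (hmaps : MapsTo T W W)
    (hstep : ∀ p ∈ W, ‖Φ (T p) - Φ p + 1‖ ≤ lam p - lam (T p)) {p : X} (hp : p ∈ W) {m n : ℕ}
    (hmn : m ≤ n) :
    ‖(Φ (T^[n] p) + n) - (Φ (T^[m] p) + m)‖ ≤ lam (T^[m] p) - lam (T^[n] p) := by
  induction n, hmn using Nat.le_induction with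
  | base => simp
  | succ n hmn ih =>
    have h1 := hstep _ (hmaps.iterate n hp)
    rw [Function.iterate_succ_apply']
    have e : Φ (T (T^[n] p)) + ((n + 1 : ℕ) : ℂ) - (Φ (T^[m] p) + m) =
        (Φ (T (T^[n] p)) - Φ (T^[n] p) + 1) + ((Φ (T^[n] p) + n) - (Φ (T^[m] p) + m)) := by
      push_cast
      ring
    rw [e]
    exact (norm_add_le _ _).trans (by linarith)

variable [TopologicalSpace X]

lemma tendstoLocallyUniformlyOn_iterate_zero (hmaps : MapsTo T W W) (hcont : ContinuousOn T W)
    (hl : ContinuousOn lam W) (hdec : ∀ p ∈ W, lam (T p) ≤ lam p)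
    (hlim : ∀ p ∈ W, Tendsto (fun n => lam (T^[n] p)) atTop (𝓝 0)) :
    TendstoLocallyUniformlyOn (fun n p => lam (T^[n] p)) 0 atTop W := by
  have hiter : ∀ n : ℕ, ContinuousOn (T^[n]) W := by
    intro n
    induction n with
    | zero => exact continuousOn_id
    | succ n ih => rw [Function.iterate_succ']; exact hcont.comp ih (hmaps.iterate n)
  exact Antitone.tendstoLocallyUniformlyOn_of_forall_tendsto
    (fun n => hl.comp (hiter n) (hmaps.iterate n))
    (fun p hp => antitone_iterate_of_le hmaps hdec hp) continuousOn_const hlim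

/-- If `Φ ∘ T = Φ - 1` up to an error dominated by the decrease of `lam` along orbits of `T`, and
`lam` tends to zero along orbits, then `Φ ∘ Tⁿ + n` converges. -/
lemma exists_abel_limit (hmaps : MapsTo T W W) (hcont : ContinuousOn T W)
    (hl : ContinuousOn lam W) (hstep : ∀ p ∈ W, ‖Φ (T p) - Φ p + 1‖ ≤ lam p - lam (T p))
    (hlim : ∀ p ∈ W, Tendsto (fun n => lam (T^[n] p)) atTop (𝓝 0)) :
    ∃ Ψ : X → ℂ, (∀ p ∈ W, ‖Ψ p - Φ p‖ ≤ lam p) ∧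
      TendstoLocallyUniformlyOn (fun (n : ℕ) p => Φ (T^[n] p) + n) Ψ atTop W := by
  have hdec : ∀ p ∈ W, lam (T p) ≤ lam p := fun p hp =>
    sub_nonneg.1 ((norm_nonneg _).trans (hstep p hp))
  have hanti := fun p hp => antitone_iterate_of_le (p := p) hmaps hdec hp
  have hnonneg : ∀ p ∈ W, ∀ n, 0 ≤ lam (T^[n] p) := fun p hp =>
    (hanti p hp).le_of_tendsto (hlim p hp)
  have hle : ∀ p ∈ W, ∀ m n : ℕ, m ≤ n →
      ‖(Φ (T^[n] p) + n) - (Φ (T^[m] p) + m)‖ ≤ lam (T^[m] p) := fun p hp m n hmn =>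
    (norm_add_natCast_sub_le hmaps hstep hp hmn).trans (sub_le_self _ (hnonneg p hp n))
  have hex : ∀ p, ∃ a, p ∈ W → Tendsto (fun n : ℕ => Φ (T^[n] p) + n) atTop (𝓝 a) := by
    intro p
    by_cases hp : p ∈ W
    · have hc : CauchySeq fun n : ℕ => Φ (T^[n] p) + n := by
        refine cauchySeq_of_le_tendsto_0' (fun n => lam (T^[n] p)) (fun m n hmn => ?_) (hlim p hp)
        rw [dist_comm, dist_eq_norm]
        exact hle p hp m n hmn
      obtain ⟨a, ha⟩ := cauchySeq_tendsto_of_complete hc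
      exact ⟨a, fun _ => ha⟩
    · exact ⟨0, fun h => absurd h hp⟩
  choose Ψ hΨ using hex
  have hbound : ∀ p ∈ W, ∀ m : ℕ, ‖Ψ p - (Φ (T^[m] p) + m)‖ ≤ lam (T^[m] p) := by
    intro p hp m
    refine le_of_tendsto ((hΨ p hp).sub_const _).norm ?_
    filter_upwards [eventually_ge_atTop m] with n hn
    exact hle p hp m n hn
  refine ⟨Ψ, fun p hp => by simpa using hbound p hp 0, ?_⟩
  have h0 := tendstoLocallyUniformlyOn_iterate_zero hmaps hcont hl hdec hlim
  rw [Metric.tendstoLocallyUniformlyOn_iff] at h0 ⊢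
  intro ε hε p hp
  obtain ⟨t, ht, h⟩ := h0 ε hε p hp
  refine ⟨t ∩ W, inter_mem ht self_mem_nhdsWithin, h.mono fun n hn q hq => ?_⟩
  have h1 := hn q hq.1
  rw [Pi.zero_apply, dist_comm, dist_zero_right] at h1
  rw [dist_eq_norm]
  exact (hbound q hq.2 n).trans_lt ((le_abs_self _).trans_lt h1)

end Abel

/-! ### Orbits in the wedge -/

/-- The part of the wedge within the polydisc of radius `δ`. -/
def smallWedge (t t' δ : ℝ) : Set (ℂ × ℂ) := {p | p ∈ wedge t t' ∧ ‖p.1‖ < δ ∧ ‖p.2‖ < δ}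

lemma isOpen_smallWedge (t t' δ : ℝ) : IsOpen (smallWedge t t' δ) := by
  have h1 : IsOpen (wedge t t') :=
    ((isOpen_cone t).preimage continuous_fst).inter
      (((isOpen_cone t').preimage continuous_snd).inter
        (isOpen_lt continuous_fst.norm (continuous_const.mul continuous_snd.norm)))
  exact h1.inter ((isOpen_lt continuous_fst.norm continuous_const).inter
    (isOpen_lt continuous_snd.norm continuous_const))

lemma smallWedge_mono {t t' u u' δ δ' : ℝ} (ht : 0 < t) (ht' : 0 < t') (htu : t ≤ u)
    (htu' : t' ≤ u') (hδ : δ ≤ δ') : smallWedge t t' δ ⊆ smallWedge u u' δ' :=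
  fun _ hp => ⟨⟨cone_mono ht htu hp.1.1, cone_mono ht' htu' hp.1.2.1, hp.1.2.2⟩,
    hp.2.1.trans_le hδ, hp.2.2.trans_le hδ⟩

/-- In coordinates `x = 1/z`, `y = 1/w`, the map is close to `(x, y) ↦ (x - 1, y + 1/x)` on the
wedge of radius `δ`. -/
structure IsNearModel (F : ℂ × ℂ → ℂ × ℂ) (δ : ℝ) : Prop where
  pos : 0 < δ
  le : δ ≤ 1 / 10
  fst : ∀ p ∈ smallWedge (1 / 2) (3 / 4) δ, ‖(F p).1⁻¹ - p.1⁻¹ + 1‖ ≤ 1 / 40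
  snd : ∀ p ∈ smallWedge (1 / 2) (3 / 4) δ, ‖(F p).2⁻¹ - (p.2⁻¹ + p.1)‖ ≤ 1 / 40 * ‖p.1‖

section Model

variable {F : ℂ × ℂ → ℂ × ℂ} {δ : ℝ}

lemma IsNearModel.mono (hF : IsNearModel F δ) {δ' : ℝ} (h0 : 0 < δ') (h : δ' ≤ δ) :
    IsNearModel F δ' :=
  have hsub := smallWedge_mono (t := 1 / 2) (t' := 3 / 4) (by norm_num) (by norm_num) le_rfl
    le_rfl h
  ⟨h0, h.trans hF.le, fun p hp => hF.fst p (hsub hp), fun p hp => hF.snd p (hsub hp)⟩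

lemma eventually_wedgeFilter_iff {P : ℂ × ℂ → Prop} :
    (∀ᶠ p in wedgeFilter, P p) ↔ ∃ δ > 0, ∀ p ∈ smallWedge (1 / 2) (3 / 4) δ, P p := by
  rw [eventually_nhdsWithin_iff, Metric.eventually_nhds_iff]
  refine exists_congr fun δ => and_congr_right fun _ => ⟨fun h p hp => h ?_ hp.1, ?_⟩
  · rw [dist_zero_right, Prod.norm_def]
    exact max_lt hp.2.1 hp.2.2
  · intro h p hp hw
    rw [dist_zero_right, Prod.norm_def, max_lt_iff] at hp
    exact h p ⟨hw, hp⟩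

lemma IsNormalForm.exists_isNearModel {A : ℂ × ℂ → ℂ} {g h : ℂ → ℂ}
    (hN : IsNormalForm F A g h) : ∃ δ, IsNearModel F δ := by
  have h1 : ∀ᶠ p in wedgeFilter, ‖(F p).1⁻¹ - p.1⁻¹ + 1‖ < 1 / 40 :=
    hN.fst_inv_sub_tendsto.norm.eventually_lt_const (by simp)
  have h2 := hN.snd_inv_sub_isLittleO.bound (show (0 : ℝ) < 1 / 40 by norm_num)
  obtain ⟨δ, hδ, h⟩ := eventually_wedgeFilter_iff.1 (h1.and h2)
  have hsub := smallWedge_mono (t := 1 / 2) (t' := 3 / 4) (by norm_num) (by norm_num) le_rfl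
    le_rfl (min_le_left δ (1 / 10))
  exact ⟨min δ (1 / 10), by positivity, min_le_right _ _, fun p hp => (h p (hsub hp)).1.le,
    fun p hp => (h p (hsub hp)).2⟩

/-- Slopes for which the wedge is forward invariant under maps close to the model. -/
structure AreAdmissibleSlopes (t t' : ℝ) : Prop where
  lt : 1 / 39 < t
  le : t ≤ 1 / 2
  le' : t' ≤ 3 / 4
  add_le : t + 1 / 20 ≤ t' * (19 / 20)

lemma areAdmissibleSlopes_wide : AreAdmissibleSlopes (1 / 2) (3 / 4) := by
  constructor <;> norm_num

lemma areAdmissibleSlopes_narrow : AreAdmissibleSlopes (1 / 5) (3 / 10) := by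
  constructor <;> norm_num

/-- The change of the moduli of `x = 1/z` and `y = 1/w` in one step. -/
structure IsWedgeStep (p q : ℂ × ℂ) : Prop where
  fst_ge : ‖p.1‖⁻¹ + 1 / 5 ≤ ‖q.1‖⁻¹
  fst_le : ‖q.1‖⁻¹ ≤ ‖p.1‖⁻¹ + 2
  snd_ge : ‖p.2‖⁻¹ + ‖p.1‖ / 5 ≤ ‖q.2‖⁻¹
  snd_le : ‖q.2‖⁻¹ ≤ ‖p.2‖⁻¹ + 2 * ‖p.1‖

/-- The increments of `x` and `y` are close to `-1` and `z`, hence lie in the cones of slopes `t`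
and `t'`, which are closed under addition. The condition `|y| < 2 |x|` persists because `|x|`
grows by a definite amount, and `|y|` by a multiple of the small number `|z|`. -/
lemma IsNearModel.step (hF : IsNearModel F δ) {t t' : ℝ} (hs : AreAdmissibleSlopes t t')
    {p : ℂ × ℂ} (hp : p ∈ smallWedge t t' δ) :
    F p ∈ smallWedge t t' δ ∧ IsWedgeStep p (F p) := by
  obtain ⟨hs1, hs2, hs3, hs4⟩ := hs
  have ht : 0 < t := by linarith
  have ht' : 0 < t' := by linarith
  have hp' : p ∈ smallWedge (1 / 2) (3 / 4) δ := smallWedge_mono ht ht' hs2 hs3 le_rfl hp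
  have h1 := hF.fst p hp'
  have h2 := hF.snd p hp'
  obtain ⟨⟨hz, hw, hzw⟩, hzδ, hwδ⟩ := hp
  have hzn := norm_pos_iff.2 (ne_zero_of_mem_cone hz)
  have hwn := norm_pos_iff.2 (ne_zero_of_mem_cone hw)
  have hx := inv_mem_cone hz
  have hy := inv_mem_cone hw
  -- the increment of `x`
  set e := (F p).1⁻¹ - p.1⁻¹ + 1 with he
  have hx1 : (F p).1⁻¹ = p.1⁻¹ + (-1 + e) := by rw [he]; ring
  have hre := (Complex.abs_re_le_norm e).trans h1
  have him := (Complex.abs_im_le_norm e).trans h1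
  have hec : -1 + e ∈ cone t := by
    change |(-1 + e).im| < -t * (-1 + e).re
    rw [Complex.add_im, Complex.add_re, Complex.neg_im, Complex.neg_re, Complex.one_im,
      Complex.one_re, neg_zero, zero_add]
    have := (abs_le.1 hre).2
    nlinarith
  have hen : 39 / 40 ≤ ‖-1 + e‖ := by
    have := norm_sub_norm_le (-1 : ℂ) (-e)
    rw [norm_neg, norm_one, norm_neg, sub_neg_eq_add] at this
    linarith
  have hen' : ‖-1 + e‖ ≤ 41 / 40 := by
    have := norm_add_le (-1 : ℂ) e
    rw [norm_neg, norm_one] at this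
    linarith
  have hx1c : (F p).1⁻¹ ∈ cone t := hx1 ▸ add_mem_cone hx hec
  have hge : ‖p.1‖⁻¹ + 1 / 5 ≤ ‖(F p).1‖⁻¹ := by
    have := norm_add_ge_of_mem_cone (cone_mono ht (by linarith) hx)
      (cone_mono ht (by linarith) hec)
    rw [← hx1, norm_inv, norm_inv] at this
    linarith
  have hle : ‖(F p).1‖⁻¹ ≤ ‖p.1‖⁻¹ + 2 := by
    have := norm_add_le p.1⁻¹ (-1 + e)
    rw [← hx1, norm_inv, norm_inv] at this
    linarith
  -- the increment of `y`
  set f := (F p).2⁻¹ - (p.2⁻¹ + p.1) with hf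
  have hy1 : (F p).2⁻¹ = p.2⁻¹ + (p.1 + f) := by rw [hf]; ring
  have hfc : p.1 + f ∈ cone t' :=
    mem_cone_of_norm_sub_le (κ := 1 / 40) ht (by linarith) ht' (by linarith) hz
      (by rwa [add_sub_cancel_left])
  have hfn : 39 / 40 * ‖p.1‖ ≤ ‖p.1 + f‖ := by
    have := norm_sub_norm_le p.1 (-f)
    rw [norm_neg, sub_neg_eq_add] at this
    linarith
  have hfn' : ‖p.1 + f‖ ≤ 41 / 40 * ‖p.1‖ := by
    have := norm_add_le p.1 f
    linarith
  have hy1c : (F p).2⁻¹ ∈ cone t' := hy1 ▸ add_mem_cone hy hfc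
  have hge' : ‖p.2‖⁻¹ + ‖p.1‖ / 5 ≤ ‖(F p).2‖⁻¹ := by
    have := norm_add_ge_of_mem_cone (cone_mono ht' hs3 hy) (cone_mono ht' hs3 hfc)
    rw [← hy1, norm_inv, norm_inv] at this
    linarith
  have hle' : ‖(F p).2‖⁻¹ ≤ ‖p.2‖⁻¹ + 41 / 40 * ‖p.1‖ := by
    have := norm_add_le p.2⁻¹ (p.1 + f)
    rw [← hy1, norm_inv, norm_inv] at this
    linarith
  have hz1c := inv_mem_cone_iff.1 hx1c
  have hw1c := inv_mem_cone_iff.1 hy1c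
  have hz1n := norm_pos_iff.2 (ne_zero_of_mem_cone hz1c)
  have hw1n := norm_pos_iff.2 (ne_zero_of_mem_cone hw1c)
  have hδ := hF.le
  refine ⟨⟨⟨hz1c, hw1c, ?_⟩, ?_, ?_⟩, hge, hle, hge', by linarith⟩
  · have h3 : ‖p.2‖⁻¹ < 2 * ‖p.1‖⁻¹ := by
      rw [inv_lt_iff_one_lt_mul₀ hwn]
      calc (1 : ℝ) = ‖p.1‖ * ‖p.1‖⁻¹ := (mul_inv_cancel₀ hzn.ne').symm
        _ < 2 * ‖p.2‖ * ‖p.1‖⁻¹ := by gcongr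
        _ = _ := by ring
    have h4 : ‖(F p).2‖⁻¹ < 2 * ‖(F p).1‖⁻¹ := by linarith
    calc ‖(F p).1‖ = ‖(F p).2‖⁻¹ * (‖(F p).1‖ * ‖(F p).2‖) := by field_simp
      _ < 2 * ‖(F p).1‖⁻¹ * (‖(F p).1‖ * ‖(F p).2‖) := by gcongr
      _ = _ := by field_simp
  · refine lt_of_le_of_lt ?_ hzδ
    rw [← inv_le_inv₀ hzn hz1n]
    linarith
  · refine lt_of_le_of_lt ?_ hwδ
    rw [← inv_le_inv₀ hwn hw1n]
    linarith

lemma IsNearModel.mapsTo (hF : IsNearModel F δ) {t t' : ℝ} (hs : AreAdmissibleSlopes t t') :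
    MapsTo F (smallWedge t t' δ) (smallWedge t t' δ) := fun _ hp => (hF.step hs hp).1

/-- One step decreases `|z| + |w|` by at least a fixed multiple of `|z|² + |z| |w|²`. -/
lemma IsNearModel.wedgeError_le (hF : IsNearModel F δ) {p : ℂ × ℂ}
    (hp : p ∈ smallWedge (1 / 2) (3 / 4) δ) :
    wedgeError p ≤ 10 * ((‖p.1‖ + ‖p.2‖) - (‖(F p).1‖ + ‖(F p).2‖)) := by
  obtain ⟨hq, h1, h2, h3, h4⟩ := hF.step areAdmissibleSlopes_wide hp
  have a0 := norm_pos_iff.2 (ne_zero_of_mem_cone hp.1.1)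
  have b0 := norm_pos_iff.2 (ne_zero_of_mem_cone hp.1.2.1)
  have c0 := norm_pos_iff.2 (ne_zero_of_mem_cone hq.1.1)
  have d0 := norm_pos_iff.2 (ne_zero_of_mem_cone hq.1.2.1)
  have ha := hp.2.1
  have hb := hp.2.2
  have hδ := hF.le
  rw [wedgeError]
  generalize ‖p.1‖ = a at *
  generalize ‖p.2‖ = b at *
  generalize ‖(F p).1‖ = c at *
  generalize ‖(F p).2‖ = d at *
  have e1 : a ≤ c * (1 + 2 * a) := by
    calc a = a * c * c⁻¹ := by field_simp
      _ ≤ a * c * (a⁻¹ + 2) := by gcongr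
      _ = _ := by field_simp
  have e2 : a * c / 5 ≤ a - c := by
    have : a * c * (a⁻¹ + 1 / 5) ≤ a * c * c⁻¹ := by gcongr
    have i1 : a * c * (a⁻¹ + 1 / 5) = c + a * c / 5 := by field_simp
    have i2 : a * c * c⁻¹ = a := by field_simp
    linarith
  have e3 : b ≤ d * (1 + 2 * a * b) := by
    calc b = b * d * d⁻¹ := by field_simp
      _ ≤ b * d * (b⁻¹ + 2 * a) := by gcongr
      _ = _ := by field_simp
  have e4 : b * d * a / 5 ≤ b - d := by
    have : b * d * (b⁻¹ + a / 5) ≤ b * d * d⁻¹ := by gcongr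
    have i1 : b * d * (b⁻¹ + a / 5) = d + b * d * a / 5 := by field_simp
    have i2 : b * d * d⁻¹ = b := by field_simp
    linarith
  have e5 : a ≤ 2 * c := by nlinarith
  have e6 : b ≤ 2 * d := by
    have : a * b ≤ 1 / 10 * (1 / 10) := mul_le_mul (by linarith) (by linarith) b0.le (by norm_num)
    nlinarith
  have e7 : a ^ 2 ≤ 2 * (a * c) := by nlinarith
  have e8 : a * b ^ 2 ≤ 2 * (b * d * a) := by
    have : a * b * b ≤ a * b * (2 * d) := by gcongr
    linarith
  linarith

end Model

section Orbits

variable {F : ℂ × ℂ → ℂ × ℂ} {δ : ℝ} {p : ℂ × ℂ}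

lemma IsNearModel.inv_norm_fst_iterate (hF : IsNearModel F δ)
    (hp : p ∈ smallWedge (1 / 2) (3 / 4) δ) (n : ℕ) :
    ‖p.1‖⁻¹ + n / 5 ≤ ‖(F^[n] p).1‖⁻¹ ∧ ‖(F^[n] p).1‖⁻¹ ≤ ‖p.1‖⁻¹ + 2 * n := by
  induction n with
  | zero => simp
  | succ n ih =>
    have h := (hF.step areAdmissibleSlopes_wide
      ((hF.mapsTo areAdmissibleSlopes_wide).iterate n hp)).2
    rw [Function.iterate_succ_apply']
    push_cast
    constructor
    · linarith [h.fst_ge]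
    · linarith [h.fst_le]

lemma IsNearModel.tendsto_fst_iterate (hF : IsNearModel F δ)
    (hp : p ∈ smallWedge (1 / 2) (3 / 4) δ) :
    Tendsto (fun n => ‖(F^[n] p).1‖) atTop (𝓝 0) := by
  have h1 : Tendsto (fun n : ℕ => ‖p.1‖⁻¹ + (n : ℝ) / 5) atTop atTop :=
    tendsto_atTop_add_const_left _ _ (tendsto_natCast_atTop_atTop.atTop_div_const (by norm_num))
  have h2 := tendsto_atTop_mono (fun n => (hF.inv_norm_fst_iterate hp n).1) h1
  exact h2.inv_tendsto_atTop.congr fun n => inv_inv _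

/-- The moduli of `1/w` along an orbit grow at least like the harmonic series. -/
lemma IsNearModel.tendsto_inv_norm_snd_iterate (hF : IsNearModel F δ)
    (hp : p ∈ smallWedge (1 / 2) (3 / 4) δ) :
    Tendsto (fun n => ‖(F^[n] p).2‖⁻¹) atTop atTop := by
  have a0 := norm_pos_iff.2 (ne_zero_of_mem_cone hp.1.1)
  set c : ℝ := (5 * (‖p.1‖⁻¹ + 2))⁻¹ with hc
  have hc0 : 0 < c := by positivity
  have h1 : ∀ n : ℕ, c * ∑ k ∈ Finset.range n, (1 / ((k : ℝ) + 1)) ≤ ‖(F^[n] p).2‖⁻¹ := by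
    intro n
    induction n with
    | zero => simp
    | succ n ih =>
      have hq := (hF.mapsTo areAdmissibleSlopes_wide).iterate n hp
      have h := (hF.step areAdmissibleSlopes_wide hq).2.snd_ge
      have h2 := (hF.inv_norm_fst_iterate hp n).2
      have b0 := norm_pos_iff.2 (ne_zero_of_mem_cone hq.1.1)
      rw [Function.iterate_succ_apply', Finset.sum_range_succ, mul_add]
      have h3 : c * (1 / ((n : ℝ) + 1)) ≤ ‖(F^[n] p).1‖ / 5 := by
        have h4 : ‖(F^[n] p).1‖⁻¹ ≤ (‖p.1‖⁻¹ + 2) * (n + 1) := by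
          have : 0 ≤ ‖p.1‖⁻¹ * n := by positivity
          linarith
        have h5 := inv_anti₀ (inv_pos.2 b0) h4
        rw [inv_inv] at h5
        calc c * (1 / ((n : ℝ) + 1)) = ((‖p.1‖⁻¹ + 2) * (n + 1))⁻¹ / 5 := by
              rw [hc]
              field_simp
          _ ≤ _ := by gcongr
      linarith
  exact tendsto_atTop_mono h1
    (Real.tendsto_sum_range_one_div_nat_succ_atTop.const_mul_atTop hc0)

lemma IsNearModel.tendsto_snd_iterate (hF : IsNearModel F δ)
    (hp : p ∈ smallWedge (1 / 2) (3 / 4) δ) :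
    Tendsto (fun n => ‖(F^[n] p).2‖) atTop (𝓝 0) := by
  exact (hF.tendsto_inv_norm_snd_iterate hp).inv_tendsto_atTop.congr fun n => inv_inv _

lemma IsNearModel.exists_iterate_fst_mem_cone (hF : IsNearModel F δ)
    (hp : p ∈ smallWedge (1 / 2) (3 / 4) δ) : ∃ n, (F^[n] p).1 ∈ cone (1 / 5) := by
  have h1 : ∀ n : ℕ, ‖(F^[n] p).1⁻¹ - p.1⁻¹ + n‖ ≤ n / 40 := by
    intro n
    induction n with
    | zero => simp
    | succ n ih =>
      have h := hF.fst _ ((hF.mapsTo areAdmissibleSlopes_wide).iterate n hp)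
      rw [Function.iterate_succ_apply']
      have e : (F (F^[n] p)).1⁻¹ - p.1⁻¹ + ((n + 1 : ℕ) : ℂ) =
          ((F (F^[n] p)).1⁻¹ - (F^[n] p).1⁻¹ + 1) + ((F^[n] p).1⁻¹ - p.1⁻¹ + n) := by
        push_cast
        ring
      rw [e]
      refine (norm_add_le _ _).trans ?_
      push_cast
      linarith
  obtain ⟨n, hn⟩ := exists_nat_gt (8 * ‖p.1⁻¹‖)
  refine ⟨n, inv_mem_cone_iff.1 ?_⟩
  have h2 := (Complex.abs_re_le_norm _).trans (h1 n)
  have h3 := (Complex.abs_im_le_norm _).trans (h1 n)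
  have h4 := abs_le.1 (Complex.abs_re_le_norm p.1⁻¹)
  have h5 := abs_le.1 (Complex.abs_im_le_norm p.1⁻¹)
  rw [Complex.add_re, Complex.sub_re, Complex.natCast_re, abs_le] at h2
  rw [Complex.add_im, Complex.sub_im, Complex.natCast_im, add_zero, abs_le] at h3
  change |(F^[n] p).1⁻¹.im| < -(1 / 5) * (F^[n] p).1⁻¹.re
  rw [abs_lt]
  constructor <;> linarith [h2.1, h2.2, h3.1, h3.2, h4.1, h4.2, h5.1, h5.2]

/-- Once `z` lies in a narrow cone, the increments of `1/w` do too, and they dominate in the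
long run. -/
lemma IsNearModel.exists_iterate_snd_mem_cone (hF : IsNearModel F δ)
    (hp : p ∈ smallWedge (1 / 5) (3 / 4) δ) : ∃ n, (F^[n] p).2 ∈ cone (3 / 10) := by
  have hs : AreAdmissibleSlopes (1 / 5) (3 / 4) := by constructor <;> norm_num
  have hsub : smallWedge (1 / 5) (3 / 4) δ ⊆ smallWedge (1 / 2) (3 / 4) δ :=
    smallWedge_mono (by norm_num) (by norm_num) (by norm_num) le_rfl le_rfl
  have hinc : ∀ q ∈ smallWedge (1 / 5) (3 / 4) δ, (F q).2⁻¹ - q.2⁻¹ ∈ cone (27 / 100) := by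
    intro q hq
    have h := hF.snd q (hsub hq)
    refine mem_cone_of_norm_sub_le (t := 1 / 5) (κ := 1 / 40) (by norm_num) (by norm_num)
      (by norm_num) (by norm_num) hq.1.1 ?_
    convert h using 2
    ring
  have h1 : ∀ n : ℕ, (F^[n + 1] p).2⁻¹ - p.2⁻¹ ∈ cone (27 / 100) := by
    intro n
    induction n with
    | zero => simpa using hinc p hp
    | succ n ih =>
      have h := hinc _ ((hF.mapsTo hs).iterate (n + 1) hp)
      rw [Function.iterate_succ_apply' F (n + 1)]
      convert add_mem_cone h ih using 1
      ring
  have h2 := (tendsto_add_atTop_iff_nat 1).2 (hF.tendsto_inv_norm_snd_iterate (hsub hp))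
  obtain ⟨n, hn⟩ := (h2.eventually_gt_atTop (100 * ‖p.2⁻¹‖)).exists
  refine ⟨n + 1, inv_mem_cone_iff.1 ?_⟩
  have h3 := h1 n
  rw [← norm_inv] at hn
  generalize (F^[n + 1] p).2⁻¹ = y at *
  have h4 := norm_le_two_mul_neg_re (by norm_num) (by norm_num) h3
  have h5 : |(y - p.2⁻¹).im| < -(27 / 100) * (y - p.2⁻¹).re := h3
  have h6 := norm_sub_norm_le y p.2⁻¹
  have h7 := abs_le.1 (Complex.abs_re_le_norm p.2⁻¹)
  have h8 := abs_le.1 (Complex.abs_im_le_norm p.2⁻¹)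
  rw [Complex.sub_im, abs_lt] at h5
  rw [Complex.sub_re] at h4 h5
  have h9 : 0 ≤ ‖p.2⁻¹‖ := norm_nonneg _
  change |y.im| < -(3 / 10) * y.re
  rw [abs_lt]
  constructor <;> linarith [h5.1, h5.2, h7.1, h7.2, h8.1, h8.2]

/-- Orbits are absorbed by arbitrarily small narrow wedges. -/
lemma IsNearModel.exists_iterate_mem_smallWedge (hF : IsNearModel F δ)
    (hp : p ∈ smallWedge (1 / 2) (3 / 4) δ) {δ' : ℝ} (hδ' : 0 < δ') :
    ∃ n, F^[n] p ∈ smallWedge (1 / 5) (3 / 10) δ' := by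
  have hs : AreAdmissibleSlopes (1 / 5) (3 / 4) := by constructor <;> norm_num
  have hm := hF.mapsTo areAdmissibleSlopes_wide
  obtain ⟨k, hk⟩ := hF.exists_iterate_fst_mem_cone hp
  have h1 : F^[k] p ∈ smallWedge (1 / 5) (3 / 4) δ :=
    ⟨⟨hk, (hm.iterate k hp).1.2⟩, (hm.iterate k hp).2⟩
  obtain ⟨l, hl⟩ := hF.exists_iterate_snd_mem_cone h1
  have h2 : F^[l] (F^[k] p) ∈ smallWedge (1 / 5) (3 / 10) δ :=
    have := (hF.mapsTo hs).iterate l h1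
    ⟨⟨this.1.1, hl, this.1.2.2⟩, this.2⟩
  have h3 := smallWedge_mono (t := 1 / 5) (t' := 3 / 10) (u := 1 / 2) (u' := 3 / 4) (by norm_num)
    (by norm_num) (by norm_num) (by norm_num) le_rfl h2
  obtain ⟨m, hm1, hm2⟩ := (((hF.tendsto_fst_iterate h3).eventually_lt_const hδ').and
    ((hF.tendsto_snd_iterate h3).eventually_lt_const hδ')).exists
  refine ⟨m + (l + k), ?_⟩
  rw [Function.iterate_add_apply, Function.iterate_add_apply]
  exact ⟨((hF.mapsTo areAdmissibleSlopes_narrow).iterate m h2).1, hm1, hm2⟩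

/-- Near a point of the wedge, all orbits enter a given narrow wedge at a common time. -/
lemma IsNearModel.eventually_iterate_mem_smallWedge (hF : IsNearModel F δ) (hc : Continuous F)
    (hp : p ∈ smallWedge (1 / 2) (3 / 4) δ) {δ' : ℝ} (hδ' : 0 < δ') (hδδ' : δ' ≤ δ) :
    ∃ N, ∀ᶠ q in 𝓝 p, ∀ n ≥ N, F^[n] q ∈ smallWedge (1 / 5) (3 / 10) δ' := by
  obtain ⟨N, hN⟩ := hF.exists_iterate_mem_smallWedge hp hδ'
  refine ⟨N, ?_⟩
  filter_upwards [(hc.iterate N).continuousAt.preimage_mem_nhds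
    ((isOpen_smallWedge _ _ _).mem_nhds hN)] with q hq n hn
  obtain ⟨m, rfl⟩ := Nat.exists_eq_add_of_le' hn
  rw [Function.iterate_add_apply]
  exact ((hF.mono hδ' hδδ').mapsTo areAdmissibleSlopes_narrow).iterate m hq

end Orbits

/-! ### The Fatou coordinate on the wedge -/

/-- `Ψ` is the limit of `fatouApprox β k r s ∘ Fⁿ + n` on the wedge of radius `δ`. -/
structure IsFatouLimit (F : ℂ × ℂ → ℂ × ℂ) (β : ℂ → ℂ) (k r s : ℂ) (δ K : ℝ) (Ψ : ℂ × ℂ → ℂ) :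
    Prop where
  isNearModel : IsNearModel F δ
  nonneg : 0 ≤ K
  norm_sub_le : ∀ p ∈ smallWedge (1 / 2) (3 / 4) δ,
    ‖Ψ p - fatouApprox β k r s p‖ ≤ K * (‖p.1‖ + ‖p.2‖)
  tendsto : TendstoLocallyUniformlyOn (fun (n : ℕ) p => fatouApprox β k r s (F^[n] p) + n) Ψ atTop
    (smallWedge (1 / 2) (3 / 4) δ)
  tendsto_zero : TendstoLocallyUniformlyOn (fun (n : ℕ) p => ‖(F^[n] p).1‖ + ‖(F^[n] p).2‖)
    0 atTop (smallWedge (1 / 2) (3 / 4) δ)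
  differentiableOn_approx :
    DifferentiableOn ℂ (fatouApprox β k r s) (smallWedge (1 / 2) (3 / 4) δ)
  differentiableOn : DifferentiableOn ℂ Ψ (smallWedge (1 / 2) (3 / 4) δ)

lemma differentiableOn_fatouApprox {g h β : ℂ → ℂ} {R C δ : ℝ} (hβ : IsWideBeta g h R C β)
    (k r s : ℂ) (hδ : δ ≤ (|R| + 1)⁻¹) :
    DifferentiableOn ℂ (fatouApprox β k r s) (smallWedge (1 / 2) (3 / 4) δ) := by
  intro p hp
  have hz := ne_zero_of_mem_cone hp.1.1
  have hw := ne_zero_of_mem_cone hp.1.2.1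
  have hwn := norm_pos_iff.2 hw
  have hyR : p.2⁻¹ ∈ sector 1 R := by
    refine ⟨inv_mem_cone (cone_mono (by norm_num) (by norm_num) hp.1.2.1), ?_⟩
    have := (lt_inv_comm₀ hwn (by positivity)).1 (hp.2.2.trans_le hδ)
    rw [norm_inv]
    linarith [le_abs_self R]
  have slit : ∀ t : ℝ, 0 < t → ∀ u ∈ cone t, -u⁻¹ ∈ Complex.slitPlane := fun t ht u hu =>
    Or.inl (by
      rw [Complex.neg_re]
      linarith [re_neg_of_mem_cone ht (inv_mem_cone hu)])
  have d1 : DifferentiableAt ℂ (fun p : ℂ × ℂ => p.1⁻¹) p := differentiableAt_fst.inv hz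
  have d2 : DifferentiableAt ℂ (fun p : ℂ × ℂ => p.2⁻¹) p := differentiableAt_snd.inv hw
  have d3 : DifferentiableAt ℂ (fun p : ℂ × ℂ => β p.2⁻¹) p :=
    (hβ.differentiableOn.differentiableAt ((isOpen_sector 1 R).mem_nhds hyR)).comp p d2
  have d4 := d1.neg.clog (slit _ (by norm_num) _ hp.1.1)
  have d5 := d2.neg.clog (slit _ (by norm_num) _ hp.1.2.1)
  exact (((d1.mul (d3.const_add 1)).add ((d4.add_const k).const_mul r)).add
    ((d5.add_const k).const_mul s)).differentiableWithinAt

/-- The coefficients `r` and `s` depend on the germ only, and not on the choice of `β` and of the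
branch of the logarithm. -/
lemma IsNormalForm.exists_isFatouLimit {F : ℂ × ℂ → ℂ × ℂ} {A : ℂ × ℂ → ℂ} {g h : ℂ → ℂ}
    (hN : IsNormalForm F A g h) (hF : Differentiable ℂ F) : ∃ r s : ℂ,
      ∀ (β : ℂ → ℂ) (R C : ℝ), IsWideBeta g h R C β → ∀ k, ∃ δ K Ψ,
        IsFatouLimit F β k r s δ K Ψ := by
  obtain ⟨r, s, hrs⟩ := hN.exists_fatouApprox
  refine ⟨r, s, fun β R C hβ k => ?_⟩
  obtain ⟨K, hK0, hK⟩ := (hrs β R C hβ k).exists_pos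
  obtain ⟨δ₁, hδ₁, h1⟩ := eventually_wedgeFilter_iff.1 hK.bound
  obtain ⟨δ₂, hδ₂⟩ := hN.exists_isNearModel
  have h2 := hδ₂.pos
  set δ := min (min δ₁ δ₂) (|R| + 1)⁻¹ with hδ
  have hM : IsNearModel F δ := hδ₂.mono (by positivity) ((min_le_left _ _).trans (min_le_right _ _))
  have hm := hM.mapsTo areAdmissibleSlopes_wide
  have hstep : ∀ p ∈ smallWedge (1 / 2) (3 / 4) δ,
      ‖fatouApprox β k r s (F p) - fatouApprox β k r s p + 1‖ ≤
        10 * K * (‖p.1‖ + ‖p.2‖) - 10 * K * (‖(F p).1‖ + ‖(F p).2‖) := by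
    intro p hp
    have h3 := h1 p (smallWedge_mono (by norm_num) (by norm_num) le_rfl le_rfl
      ((min_le_left _ _).trans (min_le_left _ _)) hp)
    have h4 := hM.wedgeError_le hp
    have h5 : ‖wedgeError p‖ = wedgeError p :=
      Real.norm_of_nonneg (by unfold wedgeError; positivity)
    rw [h5] at h3
    calc _ ≤ _ := h3
      _ ≤ K * (10 * ((‖p.1‖ + ‖p.2‖) - (‖(F p).1‖ + ‖(F p).2‖))) := by gcongr
      _ = _ := by ring
  have hcont : Continuous fun p : ℂ × ℂ => 10 * K * (‖p.1‖ + ‖p.2‖) := by fun_prop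
  have hlim : ∀ p ∈ smallWedge (1 / 2) (3 / 4) δ,
      Tendsto (fun n => 10 * K * (‖(F^[n] p).1‖ + ‖(F^[n] p).2‖)) atTop (𝓝 0) := by
    intro p hp
    simpa using ((hM.tendsto_fst_iterate hp).add (hM.tendsto_snd_iterate hp)).const_mul (10 * K)
  have hd := differentiableOn_fatouApprox hβ k r s (min_le_right _ _ : δ ≤ _)
  obtain ⟨Ψ, hΨ1, hΨ2⟩ := exists_abel_limit hm hF.continuous.continuousOn hcont.continuousOn
    hstep hlim
  have hdec : ∀ p ∈ smallWedge (1 / 2) (3 / 4) δ, ‖(F p).1‖ + ‖(F p).2‖ ≤ ‖p.1‖ + ‖p.2‖ := by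
    intro p hp
    have h3 := hM.wedgeError_le hp
    have h4 : 0 ≤ wedgeError p := by unfold wedgeError; positivity
    linarith
  refine ⟨δ, 10 * K, Ψ, hM, by positivity, hΨ1, hΨ2,
    tendstoLocallyUniformlyOn_iterate_zero (lam := fun p : ℂ × ℂ => ‖p.1‖ + ‖p.2‖) hm
      hF.continuous.continuousOn (by fun_prop) hdec
      (fun p hp => by
        simpa using (hM.tendsto_fst_iterate hp).add (hM.tendsto_snd_iterate hp)), hd, ?_⟩
  refine differentiableOn_of_tendstoLocallyUniformlyOn (isOpen_smallWedge _ _ _)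
    (fun n => ?_) hΨ2
  exact (hd.comp (hF.iterate n).differentiableOn (hm.iterate n)).add_const _

lemma IsFatouLimit.mono {F : ℂ × ℂ → ℂ × ℂ} {β : ℂ → ℂ} {k r s : ℂ} {δ δ' K : ℝ} {Ψ : ℂ × ℂ → ℂ}
    (h : IsFatouLimit F β k r s δ K Ψ) (h0 : 0 < δ') (hδ : δ' ≤ δ) :
    IsFatouLimit F β k r s δ' K Ψ :=
  have hsub := smallWedge_mono (t := 1 / 2) (t' := 3 / 4) (by norm_num) (by norm_num) le_rfl
    le_rfl hδ
  ⟨h.isNearModel.mono h0 hδ, h.nonneg, fun p hp => h.norm_sub_le p (hsub hp),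
    h.tendsto.mono hsub, h.tendsto_zero.mono hsub, h.differentiableOn_approx.mono hsub,
    h.differentiableOn.mono hsub⟩

/-! ### The derivative of the Fatou coordinate -/

/-- In coordinates `x = 1/z`, `y = 1/w`, the Fatou coordinate has derivative close to one along
directions `(1, c)` with `|c| |x| ≤ |y|`: apart from `x` itself, its terms vary little on discs of
radius `|x| / 40`. -/
lemma IsFatouLimit.exists_norm_fderiv_add_one_le {F : ℂ × ℂ → ℂ × ℂ} {g h β : ℂ → ℂ}
    {k r s : ℂ} {δ K R C : ℝ} {Ψ : ℂ × ℂ → ℂ} (hΨ : IsFatouLimit F β k r s δ K Ψ)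
    (hβ : IsWideBeta g h R C β) : ∃ δ' > 0, δ' ≤ δ ∧
      ∀ z ∈ cone (5 / 12), ∀ w ∈ cone (1 / 2), ‖z‖ < δ' → ‖w‖ < δ' → ‖z‖ < 3 / 2 * ‖w‖ →
      ∀ b : ℂ, ‖b‖ ≤ 1 / 2 → ‖fderiv ℂ Ψ (z, w) (z ^ 2, z ^ 2 * b) + 1‖ ≤ 1 / 2 := by
  have hδ0 := hΨ.isNearModel.pos
  have hK0 := hΨ.nonneg
  have hδ10 := hΨ.isNearModel.le
  set L := 2 * K * δ + ‖r‖ + ‖s‖ + 2 * |C| with hL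
  have hL0 : 0 ≤ L := by positivity
  refine ⟨min (min (δ / 2) (2 * (|R| + 1))⁻¹) (80 * (L + 1))⁻¹, by positivity,
    (min_le_left _ _).trans ((min_le_left _ _).trans (by linarith)), ?_⟩
  intro z hz w hw hzδ hwδ hzw b hb
  obtain ⟨⟨hz1, hz2⟩, hz3⟩ : (‖z‖ < δ / 2 ∧ ‖z‖ < (2 * (|R| + 1))⁻¹) ∧ ‖z‖ < (80 * (L + 1))⁻¹ := by
    simpa only [lt_min_iff] using hzδ
  obtain ⟨⟨hw1, hw2⟩, hw3⟩ : (‖w‖ < δ / 2 ∧ ‖w‖ < (2 * (|R| + 1))⁻¹) ∧ ‖w‖ < (80 * (L + 1))⁻¹ := by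
    simpa only [lt_min_iff] using hwδ
  have hz0 := ne_zero_of_mem_cone hz
  have hw0 := ne_zero_of_mem_cone hw
  have hzn := norm_pos_iff.2 hz0
  have hwn := norm_pos_iff.2 hw0
  set x := z⁻¹ with hx
  set y := w⁻¹ with hy
  have hxc : x ∈ cone (5 / 12) := inv_mem_cone hz
  have hyc : y ∈ cone (1 / 2) := inv_mem_cone hw
  have hx0 := ne_zero_of_mem_cone hxc
  have hy0 := ne_zero_of_mem_cone hyc
  have hxn := norm_pos_iff.2 hx0
  have hyn := norm_pos_iff.2 hy0
  have hxz : ‖z‖ = ‖x‖⁻¹ := by rw [hx, norm_inv, inv_inv]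
  have hyw : ‖w‖ = ‖y‖⁻¹ := by rw [hy, norm_inv, inv_inv]
  have hyx : ‖y‖ < 3 / 2 * ‖x‖ := by
    rw [hxz, hyw, inv_lt_iff_one_lt_mul₀ hxn] at hzw
    calc ‖y‖ = ‖y‖ * 1 := (mul_one _).symm
      _ < ‖y‖ * (‖x‖ * (3 / 2 * ‖y‖⁻¹)) := by gcongr; linarith
      _ = _ := by field_simp
  set c := b * z ^ 2 / w ^ 2 with hc
  have hcn : ‖c‖ * ‖x‖ ≤ ‖y‖ := by
    rw [hc, norm_div, norm_mul, norm_pow, norm_pow, hxz, hyw]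
    have : ‖b‖ * ‖x‖⁻¹ ^ 2 / ‖y‖⁻¹ ^ 2 * ‖x‖ = ‖b‖ * (‖y‖ / ‖x‖) * ‖y‖ := by field_simp
    rw [this]
    have h1 : ‖y‖ / ‖x‖ ≤ 2 := by
      rw [div_le_iff₀ hxn]
      linarith
    calc ‖b‖ * (‖y‖ / ‖x‖) * ‖y‖ ≤ 1 / 2 * 2 * ‖y‖ := by gcongr
      _ = _ := by ring
  -- the restriction of `Ψ` to the disc in the direction `(1, c)` in the coordinates `(x, y)`
  set path : ℂ → ℂ × ℂ := fun t => ((x + t)⁻¹, (y + c * t)⁻¹) with hpath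
  have hgeom : ∀ t ∈ Metric.ball (0 : ℂ) (‖x‖ / 40), ‖t‖ ≤ 1 / 40 * ‖x‖ ∧
      ‖c * t‖ ≤ 1 / 40 * ‖y‖ := by
    intro t ht
    have h1 : ‖t‖ < ‖x‖ / 40 := by simpa using ht
    refine ⟨by linarith, ?_⟩
    rw [norm_mul]
    calc ‖c‖ * ‖t‖ ≤ ‖c‖ * (‖x‖ / 40) := by gcongr
      _ ≤ _ := by linarith
  have hmem : ∀ t ∈ Metric.ball (0 : ℂ) (‖x‖ / 40), x + t ∈ cone (1 / 2) ∧
      y + c * t ∈ cone (3 / 4) ∧ 39 / 40 * ‖x‖ ≤ ‖x + t‖ ∧ ‖x + t‖ ≤ 41 / 40 * ‖x‖ ∧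
      39 / 40 * ‖y‖ ≤ ‖y + c * t‖ ∧ ‖y + c * t‖ ≤ 41 / 40 * ‖y‖ := by
    intro t ht
    obtain ⟨h1, h2⟩ := hgeom t ht
    have h3 := norm_sub_norm_le x (-t)
    have h4 := norm_sub_norm_le y (-(c * t))
    have h5 := norm_add_le x t
    have h6 := norm_add_le y (c * t)
    rw [norm_neg, sub_neg_eq_add] at h3 h4
    refine ⟨mem_cone_of_norm_sub_le (κ := 1 / 40) (by norm_num) (by norm_num) (by norm_num)
      (by norm_num) hxc (by rwa [add_sub_cancel_left]), mem_cone_of_norm_sub_le (κ := 1 / 40)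
      (by norm_num) (by norm_num) (by norm_num) (by norm_num) hyc (by rwa [add_sub_cancel_left]),
      ?_, ?_, ?_, ?_⟩ <;> linarith
  have hbig : ∀ u : ℝ, 0 < u → ∀ v : ℝ, 0 < v → u⁻¹ < v / 2 → v⁻¹ < 39 / 40 * u := by
    intro u hu v hv huv
    have h1 : u * u⁻¹ = 1 := mul_inv_cancel₀ hu.ne'
    rw [inv_lt_iff_one_lt_mul₀ hv]
    nlinarith
  have hpathmem : ∀ t ∈ Metric.ball (0 : ℂ) (‖x‖ / 40),
      path t ∈ smallWedge (1 / 2) (3 / 4) δ := by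
    intro t ht
    obtain ⟨h1, h2, h3, h4, h5, h6⟩ := hmem t ht
    have hxt := norm_pos_iff.2 (ne_zero_of_mem_cone h1)
    have hyt := norm_pos_iff.2 (ne_zero_of_mem_cone h2)
    refine ⟨⟨inv_mem_cone h1, inv_mem_cone h2, ?_⟩, ?_, ?_⟩
    · change ‖(x + t)⁻¹‖ < 2 * ‖(y + c * t)⁻¹‖
      rw [norm_inv, norm_inv, ← div_eq_mul_inv, lt_div_iff₀ hyt, inv_mul_lt_iff₀ hxt]
      linarith
    · change ‖(x + t)⁻¹‖ < δ
      rw [norm_inv, inv_lt_comm₀ hxt hδ0]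
      exact (hbig _ hxn _ hδ0 (hxz ▸ hz1)).trans_le h3
    · change ‖(y + c * t)⁻¹‖ < δ
      rw [norm_inv, inv_lt_comm₀ hyt hδ0]
      exact (hbig _ hyn _ hδ0 (hyw ▸ hw1)).trans_le h5
  set c₀ := r * (Complex.log (-x) + k) + s * (Complex.log (-y) + k) with hc₀
  set f : ℂ → ℂ := fun t => Ψ (path t) - (x + t) - c₀ with hf
  have hpathd : ∀ t ∈ Metric.ball (0 : ℂ) (‖x‖ / 40), DifferentiableAt ℂ path t := by
    intro t ht
    obtain ⟨h1, h2, -⟩ := hmem t ht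
    exact ((differentiableAt_const x).add differentiableAt_id).inv (ne_zero_of_mem_cone h1)
      |>.prodMk (((differentiableAt_const y).add ((differentiableAt_const c).mul
        differentiableAt_id)).inv (ne_zero_of_mem_cone h2))
  have hfd : DifferentiableOn ℂ f (Metric.ball 0 (‖x‖ / 40)) := by
    intro t ht
    have h1 := (hΨ.differentiableOn.differentiableAt
      ((isOpen_smallWedge _ _ _).mem_nhds (hpathmem t ht))).comp t (hpathd t ht)
    exact ((h1.sub (differentiableAt_id.const_add x)).sub_const c₀).differentiableWithinAt
  set M := 2 * K * δ + ‖r‖ + ‖s‖ + 2 * |C| * (‖x‖ * ‖w‖) with hM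
  have hlog : ∀ ζ u : ℂ, ζ.re < 0 → ‖u‖ ≤ 1 / 40 * ‖ζ‖ →
      ‖Complex.log (-(ζ + u)) - Complex.log (-ζ)‖ ≤ 1 := by
    intro ζ u hζ hu
    have h1 := norm_log_neg_add_sub_le hζ (hu.trans (by linarith [norm_nonneg ζ]))
    have h2 : ‖u / ζ‖ ≤ 1 / 40 := by
      rw [norm_div]
      exact div_le_of_le_mul₀ (norm_nonneg _) (by norm_num) hu
    have h3 := norm_le_norm_sub_add (Complex.log (-(ζ + u)) - Complex.log (-ζ)) (u / ζ)
    have h4 : ‖u / ζ‖ ^ 2 ≤ (1 / 40) ^ 2 := by gcongr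
    linarith
  have hfM : ∀ t ∈ Metric.ball (0 : ℂ) (‖x‖ / 40), ‖f t‖ ≤ M := by
    intro t ht
    obtain ⟨h1, h2, h3, h4, h5, h6⟩ := hmem t ht
    obtain ⟨h7, h8⟩ := hgeom t ht
    have h9 := hpathmem t ht
    have e : f t = (Ψ (path t) - fatouApprox β k r s (path t)) + (x + t) * β (y + c * t) +
        r * (Complex.log (-(x + t)) - Complex.log (-x)) +
        s * (Complex.log (-(y + c * t)) - Complex.log (-y)) := by
      simp only [hf, fatouApprox, hpath, inv_inv, hc₀]
      ring
    have b1 : ‖Ψ (path t) - fatouApprox β k r s (path t)‖ ≤ 2 * K * δ := by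
      refine (hΨ.norm_sub_le _ h9).trans ?_
      have := h9.2
      calc K * (‖(path t).1‖ + ‖(path t).2‖) ≤ K * (δ + δ) := by
            gcongr
            · exact this.1.le
            · exact this.2.le
        _ = _ := by ring
    have hyt := norm_pos_iff.2 (ne_zero_of_mem_cone h2)
    have b2 : ‖(x + t) * β (y + c * t)‖ ≤ 2 * |C| * (‖x‖ * ‖w‖) := by
      have hsec : y + c * t ∈ sector 1 R := by
        refine ⟨cone_mono (by norm_num) (by norm_num) h2, ?_⟩
        have := hbig _ hyn (|R| + 1)⁻¹ (by positivity) (by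
          rw [← hyw]
          refine hw2.trans_le (le_of_eq ?_)
          field_simp)
        rw [inv_inv] at this
        linarith [le_abs_self R]
      rw [norm_mul]
      calc ‖x + t‖ * ‖β (y + c * t)‖ ≤ (41 / 40 * ‖x‖) * (|C| / (39 / 40 * ‖y‖)) := by
            gcongr
            refine (hβ.bound _ hsec).trans ?_
            gcongr
            exact le_abs_self C
        _ = 41 / 39 * (|C| * (‖x‖ * ‖w‖)) := by
            rw [hyw]
            field_simp
        _ ≤ _ := by
            have : 0 ≤ |C| * (‖x‖ * ‖w‖) := by positivity
            linarith
    have b3 := mul_le_mul_of_nonneg_left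
      (hlog x t (re_neg_of_mem_cone (by norm_num) hxc) h7) (norm_nonneg r)
    have b4 := mul_le_mul_of_nonneg_left
      (hlog y (c * t) (re_neg_of_mem_cone (by norm_num) hyc) h8) (norm_nonneg s)
    rw [← norm_mul, mul_one] at b3 b4
    rw [e]
    refine (norm_add_le _ _).trans ((add_le_add (norm_add_le _ _) le_rfl).trans ?_)
    have := norm_add_le (Ψ (path t) - fatouApprox β k r s (path t)) ((x + t) * β (y + c * t))
    linarith
  have hcauchy := norm_fderiv_le_of_norm_le (show 0 < ‖x‖ / 40 by positivity) hfd hfM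
  rw [← norm_deriv_eq_norm_fderiv] at hcauchy
  -- the derivative in the original coordinates
  have h0 : (0 : ℂ) ∈ Metric.ball (0 : ℂ) (‖x‖ / 40) := Metric.mem_ball_self (by positivity)
  have hp0 : path 0 = (z, w) := by simp [hpath, hx, hy]
  have hpd : HasDerivAt path (-z ^ 2, -(z ^ 2 * b)) 0 := by
    have d1 : HasDerivAt (fun t : ℂ => (x + t)⁻¹) (-z ^ 2) 0 := by
      have h1 : HasDerivAt (fun t : ℂ => (x + t)⁻¹) _ 0 :=
        ((hasDerivAt_id (0 : ℂ)).const_add x).inv (by simpa using hx0)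
      refine h1.congr_deriv ?_
      simp [hx]
    have d2 : HasDerivAt (fun t : ℂ => (y + c * t)⁻¹) (-(z ^ 2 * b)) 0 := by
      have h1 : HasDerivAt (fun t : ℂ => (y + c * t)⁻¹) _ 0 :=
        (((hasDerivAt_id (0 : ℂ)).const_mul c).const_add y).inv (by simpa using hy0)
      refine h1.congr_deriv ?_
      simp only [id, mul_zero, add_zero, mul_one, hy, hc]
      field_simp
    exact d1.prodMk d2
  have hΨd : HasFDerivAt Ψ (fderiv ℂ Ψ (z, w)) (path 0) := by
    rw [hp0]
    exact (hΨ.differentiableOn.differentiableAt ((isOpen_smallWedge _ _ _).mem_nhds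
      (hp0 ▸ hpathmem 0 h0))).hasFDerivAt
  have hfd0 := ((hΨd.comp_hasDerivAt 0 hpd).sub
    ((hasDerivAt_id (0 : ℂ)).const_add x)).sub_const c₀
  have hfd1 : HasDerivAt f (fderiv ℂ Ψ (z, w) (-z ^ 2, -(z ^ 2 * b)) - 1) 0 := hfd0
  rw [hfd1.deriv] at hcauchy
  have e1 : ((-z ^ 2, -(z ^ 2 * b)) : ℂ × ℂ) = -(z ^ 2, z ^ 2 * b) := rfl
  rw [e1, map_neg, ← neg_add', norm_neg] at hcauchy
  refine hcauchy.trans ?_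
  have e2 : M / (‖x‖ / 40) = 40 * ((2 * K * δ + ‖r‖ + ‖s‖) * ‖z‖ + 2 * |C| * ‖w‖) := by
    rw [hM, hxz]
    field_simp
  rw [e2]
  have hq : (0 : ℝ) < (80 * (L + 1))⁻¹ := by positivity
  calc 40 * ((2 * K * δ + ‖r‖ + ‖s‖) * ‖z‖ + 2 * |C| * ‖w‖)
      ≤ 40 * ((2 * K * δ + ‖r‖ + ‖s‖) * (80 * (L + 1))⁻¹ + 2 * |C| * (80 * (L + 1))⁻¹) := by
        gcongr
    _ = 40 * (L * (80 * (L + 1))⁻¹) := by rw [hL]; ring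
    _ ≤ 40 * ((L + 1) * (80 * (L + 1))⁻¹) := by gcongr; linarith
    _ = 1 / 2 := by field_simp; norm_num

/-! ### Biholomorphisms -/

/-- The inverse function theorem for injective holomorphic maps with injective derivative. -/
lemma isBiholomorphismOntoImage_of_injOn {f : ℂ × ℂ → ℂ × ℂ} {D : Set (ℂ × ℂ)} (hD : IsOpen D)
    (hf : DifferentiableOn ℂ f D) (hinj : InjOn f D)
    (hker : ∀ p ∈ D, ∀ v, fderiv ℂ f p v = 0 → v = 0) : IsBiholomorphismOntoImage f D := by
  have hequiv : ∀ p ∈ D, ∃ e : (ℂ × ℂ) ≃L[ℂ] (ℂ × ℂ),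
      HasStrictFDerivAt f (e : (ℂ × ℂ) →L[ℂ] (ℂ × ℂ)) p := by
    intro p hp
    have h1 : Function.Injective (fderiv ℂ f p : (ℂ × ℂ) →ₗ[ℂ] (ℂ × ℂ)) :=
      (injective_iff_map_eq_zero _).2 fun v hv => hker p hp v hv
    refine ⟨(LinearEquiv.ofInjectiveEndo _ h1).toContinuousLinearEquiv, ?_⟩
    have h2 : ((LinearEquiv.ofInjectiveEndo _ h1).toContinuousLinearEquiv :
        (ℂ × ℂ) →L[ℂ] (ℂ × ℂ)) = fderiv ℂ f p := ContinuousLinearMap.ext fun _ => rfl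
    rw [h2]
    exact hasStrictFDerivAt_of_differentiableOn hD hf hp
  have hnhds : ∀ p ∈ D, ∀ U ∈ 𝓝 p, f '' U ∈ 𝓝 (f p) := by
    intro p hp U hU
    obtain ⟨e, he⟩ := hequiv p hp
    rw [← he.map_nhds_eq_of_equiv]
    exact image_mem_map hU
  refine ⟨hD, hf, hinj, ?_, Function.invFunOn f D, ?_, fun p hp => hinj.leftInvOn_invFunOn hp⟩
  · rw [isOpen_iff_mem_nhds]
    rintro _ ⟨p, hp, rfl⟩
    exact hnhds p hp D (hD.mem_nhds hp)
  · rintro _ ⟨p, hp, rfl⟩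
    obtain ⟨e, he⟩ := hequiv p hp
    have hk : Function.invFunOn f D (f p) = p := hinj.leftInvOn_invFunOn hp
    have hcont : ContinuousAt (Function.invFunOn f D) (f p) := by
      intro U hU
      rw [hk] at hU
      rw [Filter.mem_map]
      filter_upwards [hnhds p hp _ (inter_mem hU (hD.mem_nhds hp))]
      rintro _ ⟨q, hq, rfl⟩
      rw [mem_preimage, hinj.leftInvOn_invFunOn hq.2]
      exact hq.1
    have hright : ∀ᶠ q in 𝓝 (f p), f (Function.invFunOn f D q) = q := by
      filter_upwards [hnhds p hp D (hD.mem_nhds hp)]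
      rintro _ ⟨q, hq, rfl⟩
      rw [hinj.leftInvOn_invFunOn hq]
    exact (HasFDerivAt.of_local_left_inverse hcont (by rw [hk]; exact he.hasFDerivAt)
      hright).differentiableAt.differentiableWithinAt

/-! ### Branches of the logarithm -/

/-- On the connected set `U_R` a branch of the logarithm differs from `Log (-ζ)` by a constant. -/
lemma IsLogBranch.exists_eq_add {R : ℝ} (hR : 0 < R) {l : ℂ → ℂ} (hl : IsLogBranch R l) :
    ∃ k, ∀ ζ ∈ sector tanEighth R, l ζ = Complex.log (-ζ) + k := by
  rw [IsLogBranch, sectorU_eq_sector hR.le] at hl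
  obtain ⟨hc, he⟩ := hl
  rcases (sector tanEighth R).eq_empty_or_nonempty with hS | ⟨ζ₀, hζ₀⟩
  · exact ⟨0, by simp [hS]⟩
  set d : ℂ → ℂ := fun ζ => l ζ - Complex.log (-ζ) with hd
  have hdc : ContinuousOn d (sector tanEighth R) := by
    refine hc.sub (ContinuousOn.clog (by fun_prop) fun ζ hζ => Or.inl ?_)
    rw [Complex.neg_re]
    linarith [re_neg_of_mem_cone tanEighth_pos hζ.1]
  have hde : ∀ ζ ∈ sector tanEighth R, Complex.exp (d ζ) = -1 := by
    intro ζ hζ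
    have h0 := ne_zero_of_mem_cone hζ.1
    rw [hd, Complex.exp_sub, he ζ hζ, Complex.exp_log (neg_ne_zero.2 h0)]
    field_simp
  refine ⟨d ζ₀, fun ζ hζ => ?_⟩
  suffices h : d ζ = d ζ₀ by
    rw [← h, hd]
    ring
  -- `d - d ζ₀` takes values in `2πi ℤ`, so it vanishes wherever its modulus is below one
  have hsmall : ∀ a ∈ sector tanEighth R, ∀ b ∈ sector tanEighth R,
      ‖d a - d b‖ < 1 → d a = d b := by
    intro a ha b hb hab
    have h1 : Complex.exp (d a - d b) = 1 := by
      rw [Complex.exp_sub, hde a ha, hde b hb, div_self (by norm_num)]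
    obtain ⟨n, hn⟩ := Complex.exp_eq_one_iff.1 h1
    rcases eq_or_ne n 0 with rfl | hn0
    · rw [Int.cast_zero, zero_mul] at hn
      exact sub_eq_zero.1 hn
    · exfalso
      have h2 : (1 : ℝ) ≤ |(n : ℝ)| := by exact_mod_cast Int.one_le_abs hn0
      rw [hn, norm_mul, Complex.norm_intCast] at hab
      have h3 : ‖2 * (Real.pi : ℂ) * Complex.I‖ = 2 * Real.pi := by
        simp [abs_of_pos Real.pi_pos]
      rw [h3] at hab
      nlinarith [Real.pi_gt_three]
  have hdisc : IsDiscrete (d '' sector tanEighth R) := by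
    refine isDiscrete_iff_discreteTopology.2 (discreteTopology_subtype_iff'.2 ?_)
    rintro _ ⟨a, ha, rfl⟩
    refine ⟨Metric.ball (d a) 1, Metric.isOpen_ball, ?_⟩
    ext u
    constructor
    · rintro ⟨hu, b, hb, rfl⟩
      exact hsmall b hb a ha (by simpa [dist_eq_norm] using hu)
    · rintro rfl
      exact ⟨Metric.mem_ball_self one_pos, a, ha, rfl⟩
  exact (isPreconnected_sector (t := tanEighth) hR.le).constant_of_mapsTo hdisc hdc
    (mapsTo_image _ _) hζ hζ₀

/-! ### Straightening the parabolic curve -/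

section Curve

variable {F : ℂ × ℂ → ℂ × ℂ} {g h β γ : ℂ → ℂ} {k r s : ℂ} {δ K R C G ε₀ : ℝ} {Ψ : ℂ × ℂ → ℂ}

/-- Since `γ(z) = O(z³)`, the function `fatouApprox` is not affected in the limit by replacing
`1/w` with `1/(w - γ(z))`. -/
lemma IsWideBeta.exists_norm_sub_fatouApprox_le (hβ : IsWideBeta g h R C β) (hε₀ : 0 < ε₀)
    (hγ : ∀ z ∈ sectorV ε₀, ‖γ z‖ ≤ G * ‖z‖ ^ 3) (k r s : ℂ) :
    ∃ δ > 0, ∃ M, ∀ q ∈ smallWedge (1 / 5) (3 / 10) δ,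
      q.1⁻¹ ∈ sector tanEighth R ∧ (q.2 - γ q.1)⁻¹ ∈ sector tanEighth R ∧
      ‖q.1⁻¹ + r * (Complex.log (-q.1⁻¹) + k) + s * (Complex.log (-(q.2 - γ q.1)⁻¹) + k) +
        q.1⁻¹ * β (q.2 - γ q.1)⁻¹ - fatouApprox β k r s q‖ ≤ M * (‖q.1‖ + ‖q.2‖) := by
  have ht := tanEighth_bounds
  refine ⟨min (min (1 / 10) ε₀) (min (2 * (|R| + 1))⁻¹ (100 * (|G| + 1))⁻¹), by positivity,
    16 * ‖s‖ * |G| + 640 * |C| * |G|, ?_⟩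
  rintro ⟨z, w⟩ ⟨⟨hz, hw, hzw⟩, hzδ, hwδ⟩
  dsimp only at hz hw hzw hzδ hwδ ⊢
  simp only [lt_min_iff] at hzδ hwδ
  obtain ⟨⟨hz1, hz2⟩, hz3, hz4⟩ := hzδ
  obtain ⟨⟨hw1, hw2⟩, hw3, hw4⟩ := hwδ
  have hz0 := ne_zero_of_mem_cone hz
  have hw0 := ne_zero_of_mem_cone hw
  have hzn := norm_pos_iff.2 hz0
  have hwn := norm_pos_iff.2 hw0
  have hzV : z ∈ sectorV ε₀ := mem_sectorV_iff.2 ⟨cone_mono (by norm_num) (by linarith) hz, hz2⟩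
  have hG : ‖γ z‖ ≤ 4 * |G| * ‖z‖ * ‖w‖ ^ 2 := by
    calc ‖γ z‖ ≤ G * ‖z‖ ^ 3 := hγ z hzV
      _ ≤ |G| * (‖z‖ * (2 * ‖w‖) ^ 2) := by
        rw [show ‖z‖ ^ 3 = ‖z‖ * ‖z‖ ^ 2 by ring]
        gcongr
        exact le_abs_self G
      _ = _ := by ring
  have hGz : |G| * ‖z‖ ≤ 1 / 100 := by
    have h1 := (lt_inv_comm₀ hzn (by positivity)).1 hz4
    have h2 : ‖z‖ * ‖z‖⁻¹ = 1 := mul_inv_cancel₀ hzn.ne'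
    nlinarith
  have hγw : ‖γ z‖ ≤ 1 / 160 * ‖w‖ := by
    calc ‖γ z‖ ≤ 4 * |G| * ‖z‖ * ‖w‖ ^ 2 := hG
      _ = 4 * (|G| * ‖z‖) * ‖w‖ * ‖w‖ := by ring
      _ ≤ 4 * (1 / 100) * (1 / 10) * ‖w‖ := by gcongr
      _ ≤ _ := by linarith
  have hvn : ‖w‖ / 2 ≤ ‖w - γ z‖ := by
    have := norm_sub_norm_le w (γ z)
    linarith
  have hv0 : w - γ z ≠ 0 := norm_pos_iff.1 (by linarith)
  set x := z⁻¹ with hx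
  set y := w⁻¹ with hy
  set u := (w - γ z)⁻¹ - y with hu
  have hy'' : (w - γ z)⁻¹ = y + u := by rw [hu]; ring
  have hyc : y ∈ cone (3 / 10) := inv_mem_cone hw
  have hyn := norm_pos_iff.2 (ne_zero_of_mem_cone hyc)
  have hyw : ‖w‖ = ‖y‖⁻¹ := by rw [hy, norm_inv, inv_inv]
  have hueq : u = γ z / (w * (w - γ z)) := by
    rw [hu, hy]
    field_simp
    ring
  have hun : ‖u‖ ≤ 2 * ‖γ z‖ / ‖w‖ ^ 2 := by
    rw [hueq, norm_div, norm_mul]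
    calc ‖γ z‖ / (‖w‖ * ‖w - γ z‖) ≤ ‖γ z‖ / (‖w‖ * (‖w‖ / 2)) := by gcongr
      _ = _ := by field_simp
  have hu1 : ‖u‖ ≤ 8 * |G| * ‖z‖ := by
    calc ‖u‖ ≤ 2 * ‖γ z‖ / ‖w‖ ^ 2 := hun
      _ ≤ 2 * (4 * |G| * ‖z‖ * ‖w‖ ^ 2) / ‖w‖ ^ 2 := by gcongr
      _ = _ := by field_simp; ring
  have hu2 : ‖u‖ ≤ 1 / 80 * ‖y‖ := by
    calc ‖u‖ ≤ 2 * ‖γ z‖ / ‖w‖ ^ 2 := hun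
      _ ≤ 2 * (1 / 160 * ‖w‖) / ‖w‖ ^ 2 := by gcongr
      _ = _ := by rw [hyw]; field_simp; norm_num
  have hxR : R < ‖x‖ := by
    have h1 := (lt_inv_comm₀ hzn (by positivity)).1 hz3
    rw [hx, norm_inv]
    linarith [le_abs_self R, abs_nonneg R]
  have hyR : 2 * (|R| + 1) < ‖y‖ := by
    rw [hy, norm_inv]
    exact (lt_inv_comm₀ hwn (by positivity)).1 hw3
  have hyuc : y + u ∈ cone tanEighth := cone_mono (by norm_num) ht.1.le
    (mem_cone_of_norm_sub_le (t' := 2 / 5) (κ := 1 / 80) (by norm_num) (by norm_num) (by norm_num)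
      (by norm_num) hyc (by rwa [add_sub_cancel_left]))
  have hyun : ‖y‖ / 2 ≤ ‖y + u‖ := by
    have := norm_sub_norm_le y (-u)
    rw [norm_neg, sub_neg_eq_add] at this
    linarith
  refine ⟨⟨cone_mono (by norm_num) (by linarith) (inv_mem_cone hz), hxR⟩, ?_, ?_⟩
  · rw [hy'']
    exact ⟨hyuc, by linarith [le_abs_self R, abs_nonneg R]⟩
  rw [hy'']
  have e : x + r * (Complex.log (-x) + k) + s * (Complex.log (-(y + u)) + k) + x * β (y + u) -
      fatouApprox β k r s (z, w) =
      s * (Complex.log (-(y + u)) - Complex.log (-y)) + x * (β (y + u) - β y) := by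
    simp only [fatouApprox, ← hx, ← hy]
    ring
  rw [e]
  have b1 : ‖s * (Complex.log (-(y + u)) - Complex.log (-y))‖ ≤ 16 * ‖s‖ * |G| * ‖z‖ := by
    have h1 := norm_log_neg_add_sub_le (re_neg_of_mem_cone (by norm_num) hyc)
      (hu2.trans (by linarith))
    have h2 : ‖u / y‖ ≤ 8 * |G| * ‖z‖ := by
      rw [norm_div, div_eq_mul_inv, ← hyw]
      calc ‖u‖ * ‖w‖ ≤ 8 * |G| * ‖z‖ * 1 := by
            gcongr
            linarith
        _ = _ := mul_one _
    have h3 : ‖u / y‖ ≤ 1 := by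
      rw [norm_div]
      exact div_le_one_of_le₀ (by linarith) hyn.le
    have h4 := norm_le_norm_sub_add (Complex.log (-(y + u)) - Complex.log (-y)) (u / y)
    have h5 : ‖u / y‖ ^ 2 ≤ ‖u / y‖ := pow_le_of_le_one (norm_nonneg _) h3 two_ne_zero
    rw [norm_mul]
    calc ‖s‖ * ‖Complex.log (-(y + u)) - Complex.log (-y)‖ ≤ ‖s‖ * (2 * (8 * |G| * ‖z‖)) := by
          gcongr
          linarith
      _ = _ := by ring
  have b2 : ‖x * (β (y + u) - β y)‖ ≤ 640 * |C| * |G| * ‖w‖ := by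
    have hball := ball_subset_sector_one (R := R) (y := y)
      ⟨cone_mono (by norm_num) (by norm_num) hyc, by linarith [le_abs_self R]⟩
    have h1 := norm_sub_le_of_mem_ball (M := |C| / (‖y‖ / 2)) (r := ‖y‖ / 20) (s := ‖y‖ / 40)
      (hβ.differentiableOn.mono fun v hv => (hball v hv).1)
      (fun v hv => (hβ.bound v (hball v hv).1).trans (by
        have := (hball v hv).2
        gcongr
        exact le_abs_self C)) (by linarith) (p := y + u) (q := y)
      (by rw [mem_ball_iff_norm, add_sub_cancel_left]; linarith)
      (Metric.mem_ball_self (by positivity))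
    rw [add_sub_cancel_left] at h1
    rw [norm_mul]
    calc ‖x‖ * ‖β (y + u) - β y‖
        ≤ ‖z‖⁻¹ * (|C| / (‖y‖ / 2) / (‖y‖ / 20 - ‖y‖ / 40) * (8 * |G| * ‖z‖)) := by
          rw [hx, norm_inv]
          gcongr
          refine h1.trans ?_
          have : 0 < ‖y‖ / 20 - ‖y‖ / 40 := by linarith
          gcongr
      _ = 640 * |C| * |G| * ‖w‖ * ‖w‖ := by
          rw [hyw]
          have : ‖y‖ / 20 - ‖y‖ / 40 = ‖y‖ / 40 := by ring
          rw [this]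
          field_simp
          ring
      _ ≤ 640 * |C| * |G| * ‖w‖ * 1 := by
          gcongr
          linarith
      _ = _ := mul_one _
  calc _ ≤ _ := norm_add_le _ _
    _ ≤ 16 * ‖s‖ * |G| * ‖z‖ + 640 * |C| * |G| * ‖w‖ := add_le_add b1 b2
    _ ≤ 16 * ‖s‖ * |G| * (‖z‖ + ‖w‖) + 640 * |C| * |G| * (‖z‖ + ‖w‖) := by
        gcongr <;> linarith
    _ = _ := by ring

end Curve

section Curve

variable {F : ℂ × ℂ → ℂ × ℂ} {g h β γ : ℂ → ℂ} {k r s : ℂ} {δ K R C G G' ε₀ ε : ℝ}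
  {Ψ : ℂ × ℂ → ℂ}

/-- Estimates for the pairs `(z, w)` with `w = v + γ(z)`, where `z` and `v` are small elements of
the sector and `|z| < (13 / 12) |v|`. -/
lemma exists_radius_curve (hε₀ : 0 < ε₀) (hγ : ∀ z ∈ sectorV ε₀, ‖γ z‖ ≤ G * ‖z‖ ^ 3)
    (hγ' : ∀ z ∈ sectorV ε₀, ‖deriv γ z‖ ≤ G' * ‖z‖ ^ 2) (hδ : 0 < δ) : ∃ ε > 0, ε ≤ ε₀ ∧
      ∀ z ∈ cone tanEighth, ∀ v ∈ cone tanEighth, ‖v‖ < ε → ‖z‖ < 13 / 12 * ‖v‖ →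
        z ∈ sectorV ε₀ ∧ v + γ z ∈ cone (1 / 2) ∧ ‖z‖ < δ ∧ ‖v + γ z‖ < δ ∧
        ‖z‖ < 3 / 2 * ‖v + γ z‖ ∧ ‖deriv γ z‖ ≤ 1 / 2 := by
  have ht := tanEighth_bounds
  refine ⟨min (min (1 / 10) (ε₀ / 2)) (min (δ / 2) (100 * (|G| + |G'| + 1))⁻¹), by positivity,
    (min_le_left _ _).trans ((min_le_right _ _).trans (by linarith)), ?_⟩
  intro z hz v hv hvε hzv
  simp only [lt_min_iff] at hvε
  obtain ⟨⟨h1, h2⟩, h3, h4⟩ := hvε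
  have hzn := norm_pos_iff.2 (ne_zero_of_mem_cone hz)
  have hvn := norm_pos_iff.2 (ne_zero_of_mem_cone hv)
  have hzV : z ∈ sectorV ε₀ := mem_sectorV_iff.2 ⟨hz, by linarith⟩
  have hG : (|G| + |G'|) * ‖v‖ ≤ 1 / 100 := by
    have h5 := (lt_inv_comm₀ hvn (by positivity)).1 h4
    have h6 : ‖v‖ * ‖v‖⁻¹ = 1 := mul_inv_cancel₀ hvn.ne'
    nlinarith
  have hG1 : |G| * ‖v‖ ≤ 1 / 100 := by
    have : 0 ≤ |G'| * ‖v‖ := by positivity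
    linarith
  have hG2 : |G'| * ‖v‖ ≤ 1 / 100 := by
    have : 0 ≤ |G| * ‖v‖ := by positivity
    linarith
  have hγv : ‖γ z‖ ≤ 1 / 100 * ‖v‖ := by
    calc ‖γ z‖ ≤ G * ‖z‖ ^ 3 := hγ z hzV
      _ ≤ |G| * (13 / 12 * ‖v‖) ^ 3 := by
        gcongr
        exact le_abs_self G
      _ = (13 / 12) ^ 3 * (|G| * ‖v‖) * ‖v‖ * ‖v‖ := by ring
      _ ≤ (13 / 12) ^ 3 * (1 / 100) * (1 / 10) * ‖v‖ := by gcongr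
      _ ≤ _ := by linarith
  have h5 := norm_add_le v (γ z)
  have h6 := norm_sub_norm_le v (-γ z)
  rw [norm_neg, sub_neg_eq_add] at h6
  refine ⟨hzV, mem_cone_of_norm_sub_le (t := 5 / 12) (κ := 1 / 100) (by norm_num) (by norm_num)
    (by norm_num) (by norm_num) (cone_mono tanEighth_pos ht.2.le hv)
    (by rwa [add_sub_cancel_left]), by linarith, by linarith, by linarith, ?_⟩
  calc ‖deriv γ z‖ ≤ G' * ‖z‖ ^ 2 := hγ' z hzV
    _ ≤ |G'| * (13 / 12 * ‖v‖) ^ 2 := by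
      gcongr
      exact le_abs_self G'
    _ = (13 / 12) ^ 2 * (|G'| * ‖v‖) * ‖v‖ := by ring
    _ ≤ (13 / 12) ^ 2 * (1 / 100) * (1 / 10) := by gcongr
    _ ≤ _ := by norm_num

/-- `Ψ` is nearly `1/z` along the translates `w = v + γ(z)` of the curve. -/
structure IsNearlyStraight (γ : ℂ → ℂ) (ε₀ ε δ : ℝ) (Ψ : ℂ × ℂ → ℂ) : Prop where
  mem : ∀ z ∈ cone tanEighth, ∀ v ∈ cone tanEighth, ‖v‖ < ε → ‖z‖ < 13 / 12 * ‖v‖ →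
    z ∈ sectorV ε₀ ∧ (z, v + γ z) ∈ smallWedge (1 / 2) (3 / 4) δ
  norm_fderiv_add_one_le : ∀ z ∈ cone tanEighth, ∀ v ∈ cone tanEighth, ‖v‖ < ε →
    ‖z‖ < 13 / 12 * ‖v‖ →
    ‖fderiv ℂ Ψ (z, v + γ z) (z ^ 2, z ^ 2 * deriv γ z) + 1‖ ≤ 1 / 2

lemma IsFatouLimit.exists_isNearlyStraight (hΨ : IsFatouLimit F β k r s δ K Ψ)
    (hβ : IsWideBeta g h R C β) (hε₀ : 0 < ε₀) (hγ : ∀ z ∈ sectorV ε₀, ‖γ z‖ ≤ G * ‖z‖ ^ 3)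
    (hγ' : ∀ z ∈ sectorV ε₀, ‖deriv γ z‖ ≤ G' * ‖z‖ ^ 2) :
    ∃ ε > 0, ε ≤ ε₀ ∧ IsNearlyStraight γ ε₀ ε δ Ψ := by
  obtain ⟨δ', hδ', hδδ', h1⟩ := hΨ.exists_norm_fderiv_add_one_le hβ
  obtain ⟨ε, hε, hεε₀, h2⟩ := exists_radius_curve hε₀ hγ hγ' hδ'
  refine ⟨ε, hε, hεε₀, fun z hz v hv hvε hzv => ?_, fun z hz v hv hvε hzv => ?_⟩
  · obtain ⟨a1, a2, a3, a4, a5, -⟩ := h2 z hz v hv hvε hzv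
    refine ⟨a1, ⟨cone_mono tanEighth_pos (by linarith [tanEighth_bounds.2]) hz,
      cone_mono (by norm_num) (by norm_num) a2, ?_⟩, a3.trans_le hδδ', a4.trans_le hδδ'⟩
    change ‖z‖ < 2 * ‖v + γ z‖
    linarith [norm_nonneg (v + γ z)]
  · obtain ⟨-, a2, a3, a4, a5, a6⟩ := h2 z hz v hv hvε hzv
    exact h1 z (cone_mono tanEighth_pos tanEighth_bounds.2.le hz) _ a2 a3 a4 a5 _ a6

/-- Along a translate of the curve, `Ψ - 1/z` is a contraction in the coordinate `1/z`. The domain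
of the estimate is convex in this coordinate. -/
lemma IsNearlyStraight.norm_sub_le (hS : IsNearlyStraight γ ε₀ ε δ Ψ)
    (hγ : DifferentiableOn ℂ γ (sectorV ε₀))
    (hΨ : DifferentiableOn ℂ Ψ (smallWedge (1 / 2) (3 / 4) δ)) {z z' v : ℂ}
    (hz : z ∈ cone tanEighth) (hz' : z' ∈ cone tanEighth) (hv : v ∈ cone tanEighth)
    (hvε : ‖v‖ < ε) (hzv : ‖z‖ < ‖v‖) (hzv' : ‖z'‖ < ‖v‖) :
    ‖(Ψ (z, v + γ z) - z⁻¹) - (Ψ (z', v + γ z') - z'⁻¹)‖ ≤ 1 / 2 * ‖z⁻¹ - z'⁻¹‖ := by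
  have ht := tanEighth_bounds
  have hvn := norm_pos_iff.2 (ne_zero_of_mem_cone hv)
  set S : Set ℂ := cone tanEighth ∩ {x | x.re < -(12 / 13) * ‖v‖⁻¹} with hSdef
  have hconv : Convex ℝ S :=
    (convex_cone _).inter (convex_halfSpace_lt Complex.reLm.isLinear _)
  have hmem : ∀ u ∈ cone tanEighth, ‖u‖ < ‖v‖ → u⁻¹ ∈ S := by
    intro u hu huv
    have hun := norm_pos_iff.2 (ne_zero_of_mem_cone hu)
    have h1 : u⁻¹ ∈ cone (5 / 12) := cone_mono tanEighth_pos ht.2.le (inv_mem_cone hu)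
    have h2 := re_neg_of_mem_cone (by norm_num) h1
    have h3 : |u⁻¹.im| < -(5 / 12) * u⁻¹.re := h1
    have h4 : ‖v‖⁻¹ < ‖u⁻¹‖ := by
      rw [norm_inv]
      exact inv_strictAnti₀ hun huv
    refine ⟨inv_mem_cone hu, ?_⟩
    -- the cosine of the half-angle of the cone of slope `5 / 12` is `12 / 13`
    have h5 : ‖u⁻¹‖ ≤ 13 / 12 * -u⁻¹.re := by
      apply le_of_sq_le_sq _ (by linarith)
      rw [Complex.sq_norm, Complex.normSq_apply]
      have := sq_abs u⁻¹.im
      have := abs_nonneg u⁻¹.im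
      nlinarith
    change u⁻¹.re < -(12 / 13) * ‖v‖⁻¹
    linarith
  have hgood : ∀ x ∈ S, x ≠ 0 ∧ x⁻¹ ∈ cone tanEighth ∧ ‖x⁻¹‖ < 13 / 12 * ‖v‖ := by
    intro x hx
    have hx0 := ne_zero_of_mem_cone hx.1
    refine ⟨hx0, inv_mem_cone hx.1, ?_⟩
    have h1 : x.re < -(12 / 13) * ‖v‖⁻¹ := hx.2
    have h2 := neg_le_of_abs_le (Complex.abs_re_le_norm x)
    rw [norm_inv, inv_lt_comm₀ (norm_pos_iff.2 hx0) (by positivity), mul_inv]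
    norm_num
    linarith
  have hderiv : ∀ x ∈ S, ∃ d : ℂ, HasDerivAt (fun x : ℂ => Ψ (x⁻¹, v + γ x⁻¹) - x) d x ∧
      ‖d‖ ≤ 1 / 2 := by
    intro x hx
    obtain ⟨hx0, hxc, hxv⟩ := hgood x hx
    obtain ⟨m1, m2⟩ := hS.mem _ hxc _ hv hvε hxv
    have d0 : HasDerivAt (fun x : ℂ => x⁻¹) (-(x⁻¹ ^ 2)) x := by
      simpa [inv_pow] using hasDerivAt_inv hx0
    have d1 : HasDerivAt γ (deriv γ x⁻¹) x⁻¹ :=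
      (hγ.differentiableAt ((isOpen_sectorV ε₀).mem_nhds m1)).hasDerivAt
    have d2 : HasDerivAt (fun x : ℂ => v + γ x⁻¹) (deriv γ x⁻¹ * -(x⁻¹ ^ 2)) x :=
      (d1.comp x d0).const_add v
    have d3 : HasFDerivAt Ψ (fderiv ℂ Ψ (x⁻¹, v + γ x⁻¹)) (x⁻¹, v + γ x⁻¹) :=
      (hΨ.differentiableAt ((isOpen_smallWedge _ _ _).mem_nhds m2)).hasFDerivAt
    have d4 := (d3.comp_hasDerivAt x (d0.prodMk d2)).sub (hasDerivAt_id x)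
    refine ⟨_, d4, ?_⟩
    have e : ((-(x⁻¹ ^ 2), deriv γ x⁻¹ * -(x⁻¹ ^ 2)) : ℂ × ℂ) =
        -(x⁻¹ ^ 2, x⁻¹ ^ 2 * deriv γ x⁻¹) := by
      ext
      · rfl
      · simp only [Prod.snd_neg]
        ring
    rw [e, map_neg, ← neg_add', norm_neg]
    exact hS.norm_fderiv_add_one_le _ hxc _ hv hvε hxv
  choose! d hd hdn using hderiv
  have := hconv.norm_image_sub_le_of_norm_hasDerivWithin_le
    (fun x hx => (hd x hx).hasDerivWithinAt) hdn (hmem z' hz' hzv') (hmem z hz hzv)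
  simpa only [inv_inv] using this

lemma isOpen_domainD (hγ : DifferentiableOn ℂ γ (sectorV ε₀)) (hε : ε ≤ ε₀) :
    IsOpen (domainD γ ε) := by
  have h1 : IsOpen {p : ℂ × ℂ | p.1 ∈ sectorV ε₀} := (isOpen_sectorV ε₀).preimage continuous_fst
  have hc : ContinuousOn (fun p : ℂ × ℂ => (p.1, p.2 - γ p.1)) {p : ℂ × ℂ | p.1 ∈ sectorV ε₀} :=
    continuousOn_fst.prodMk (continuousOn_snd.sub
      (hγ.continuousOn.comp continuousOn_fst fun _ hp => hp))
  have h2 : IsOpen {q : ℂ × ℂ | q.1 ∈ sectorV ε ∧ q.2 ∈ sectorV ε ∧ ‖q.1‖ < ‖q.2‖} :=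
    ((isOpen_sectorV ε).preimage continuous_fst).inter
      (((isOpen_sectorV ε).preimage continuous_snd).inter
        (isOpen_lt continuous_fst.norm continuous_snd.norm))
  convert hc.isOpen_inter_preimage h1 h2 using 1
  ext p
  constructor
  · intro hp
    exact ⟨mem_sectorV_iff.2 ⟨(mem_sectorV_iff.1 hp.1).1,
      (mem_sectorV_iff.1 hp.1).2.trans_le hε⟩, hp⟩
  · exact fun hp => hp.2

lemma IsNearlyStraight.domainD_subset (hS : IsNearlyStraight γ ε₀ ε δ Ψ) {p : ℂ × ℂ}
    (hp : p ∈ domainD γ ε) : p.1 ∈ sectorV ε₀ ∧ p ∈ smallWedge (1 / 2) (3 / 4) δ := by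
  obtain ⟨h1, h2, h3⟩ := hp
  rw [mem_sectorV_iff] at h1 h2
  have := hS.mem p.1 h1.1 _ h2.1 h2.2 (by linarith [norm_nonneg p.1])
  rwa [sub_add_cancel] at this

/-- `(Ψ, 1/(w - γ(z)))` is injective because `Ψ` is on the translates of the curve, and its
derivative is injective because the derivative of `Ψ` along the translates does not vanish. -/
lemma IsNearlyStraight.isBiholomorphismOntoImage (hS : IsNearlyStraight γ ε₀ ε δ Ψ)
    (hε : ε ≤ ε₀) (hγ : DifferentiableOn ℂ γ (sectorV ε₀))
    (hΨ : DifferentiableOn ℂ Ψ (smallWedge (1 / 2) (3 / 4) δ)) :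
    IsBiholomorphismOntoImage (fun p => (Ψ p, (p.2 - γ p.1)⁻¹)) (domainD γ ε) := by
  have hD := isOpen_domainD hγ hε
  have hv0 : ∀ p ∈ domainD γ ε, p.2 - γ p.1 ≠ 0 := fun p hp =>
    ne_zero_of_mem_cone (mem_sectorV_iff.1 hp.2.1).1
  have hderiv : ∀ p ∈ domainD γ ε, HasFDerivAt (fun p => (Ψ p, (p.2 - γ p.1)⁻¹))
      ((fderiv ℂ Ψ p).prod (-((p.2 - γ p.1) ^ 2)⁻¹ • (ContinuousLinearMap.snd ℂ ℂ ℂ -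
        deriv γ p.1 • ContinuousLinearMap.fst ℂ ℂ ℂ))) p := by
    intro p hp
    obtain ⟨h1, h2⟩ := hS.domainD_subset hp
    have d1 : HasFDerivAt Ψ (fderiv ℂ Ψ p) p :=
      (hΨ.differentiableAt ((isOpen_smallWedge _ _ _).mem_nhds h2)).hasFDerivAt
    have d2 : HasDerivAt γ (deriv γ p.1) p.1 :=
      (hγ.differentiableAt ((isOpen_sectorV ε₀).mem_nhds h1)).hasDerivAt
    have d3 := hasFDerivAt_snd (𝕜 := ℂ) (p := p).sub (d2.comp_hasFDerivAt p hasFDerivAt_fst)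
    exact d1.prodMk ((hasDerivAt_inv (hv0 p hp)).comp_hasFDerivAt p d3)
  refine isBiholomorphismOntoImage_of_injOn hD
    (fun p hp => (hderiv p hp).differentiableAt.differentiableWithinAt) ?_ ?_
  · rintro ⟨z, w⟩ hp ⟨z', w'⟩ hq hpq
    obtain ⟨e1, e2⟩ := Prod.mk.inj hpq
    dsimp only at e1 e2
    have e3 : w - γ z = w' - γ z' := inv_injective e2
    obtain ⟨p1, p2, p3⟩ := hp
    obtain ⟨q1, -, q3⟩ := hq
    dsimp only at p1 p2 p3 q1 q3
    rw [mem_sectorV_iff] at p1 p2 q1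
    rw [← e3] at q3
    have h1 := hS.norm_sub_le hγ hΨ p1.1 q1.1 p2.1 p2.2 p3 q3
    have e4 : w - γ z + γ z' = w' := by rw [e3, sub_add_cancel]
    rw [e4, sub_add_cancel, e1, sub_sub_sub_cancel_left, norm_sub_rev] at h1
    have h2 : z⁻¹ = z'⁻¹ := by
      rw [← sub_eq_zero, ← norm_eq_zero]
      linarith [norm_nonneg (z⁻¹ - z'⁻¹)]
    obtain rfl : z = z' := inv_injective h2
    rw [← e4, sub_add_cancel]
  · rintro ⟨z, w⟩ hp ⟨a, b⟩ hab
    rw [(hderiv _ hp).fderiv] at hab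
    obtain ⟨e1, e2⟩ := Prod.mk.inj hab
    have hv := hv0 _ hp
    have e3 : b = deriv γ z * a := by
      simpa [hv, sub_eq_zero] using e2
    obtain ⟨p1, p2, p3⟩ := hp
    dsimp only at p1 p2 p3 hv e1
    rw [mem_sectorV_iff] at p1 p2
    have h1 := hS.norm_fderiv_add_one_le z p1.1 _ p2.1 p2.2 (by linarith [norm_nonneg z])
    rw [sub_add_cancel] at h1
    have e5 : fderiv ℂ Ψ (z, w) (a, b) = 0 := e1
    have ha : a = 0 := by
      by_contra ha
      have e4 : ((z ^ 2, z ^ 2 * deriv γ z) : ℂ × ℂ) = (z ^ 2 / a) • (a, b) := by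
        rw [e3]
        ext
        · simp [ha]
        · simp only [Prod.smul_snd, smul_eq_mul]
          field_simp
      rw [e4, map_smul, e5, smul_zero, zero_add, norm_one] at h1
      norm_num at h1
    rw [e3, ha, mul_zero]
    rfl

end Curve

/-! ### Convergence and conclusion -/

section Final

variable {F : ℂ × ℂ → ℂ × ℂ} {g h β β₁ γ l : ℂ → ℂ} {k r s : ℂ} {δ K R R₀ C G ε₀ : ℝ}
  {Ψ : ℂ × ℂ → ℂ}

/-- The limit is taken on the whole wedge, where the entries of the sequence are meaningful only
after the orbit has entered the narrow wedge; this happens at a common time near each point. -/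
lemma IsFatouLimit.tendstoLocallyUniformlyOn_psiApprox (hΨ : IsFatouLimit F β₁ k r s δ K Ψ)
    (hF : Continuous F) (hβ : IsWideBeta g h R C β₁) (hR : R₀ ≤ R)
    (hββ : EqOn β β₁ (sector tanEighth R))
    (hl : ∀ ζ ∈ sector tanEighth R₀, l ζ = Complex.log (-ζ) + k)
    (hε₀ : 0 < ε₀) (hγ : ∀ z ∈ sectorV ε₀, ‖γ z‖ ≤ G * ‖z‖ ^ 3) :
    TendstoLocallyUniformlyOn (psiApprox F γ β l r s) Ψ atTop (smallWedge (1 / 2) (3 / 4) δ) := by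
  obtain ⟨δ', hδ', M, hM⟩ := hβ.exists_norm_sub_fatouApprox_le hε₀ hγ k r s
  have hMF := hΨ.isNearModel
  -- once an orbit is in the narrow wedge, the two approximations are close
  have hclose : ∀ (n : ℕ) (q : ℂ × ℂ), F^[n] q ∈ smallWedge (1 / 5) (3 / 10) δ' →
      ‖psiApprox F γ β l r s n q - (fatouApprox β₁ k r s (F^[n] q) + n)‖ ≤
        |M| * (‖(F^[n] q).1‖ + ‖(F^[n] q).2‖) := by
    intro n q hq
    obtain ⟨h1, h2, h3⟩ := hM _ hq
    have h4 : sector tanEighth R ⊆ sector tanEighth R₀ := sector_mono tanEighth_pos le_rfl hR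
    simp only [psiApprox, one_div]
    rw [hl _ (h4 h1), hl _ (h4 h2), hββ h2]
    refine le_trans (le_of_eq ?_) (h3.trans ?_)
    · congr 1
      ring
    · gcongr
      exact le_abs_self M
  have hlim := hΨ.tendsto
  have hzero := hΨ.tendsto_zero
  rw [Metric.tendstoLocallyUniformlyOn_iff] at hlim hzero ⊢
  intro η hη p hp
  obtain ⟨t, ht, ht'⟩ := hlim (η / 2) (by positivity) p hp
  obtain ⟨u, hu, hu'⟩ := hzero (η / (2 * (|M| + 1))) (by positivity) p hp
  obtain ⟨N, hN⟩ := hMF.eventually_iterate_mem_smallWedge hF hp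
    (lt_min hδ' hMF.pos) (min_le_right δ' δ)
  refine ⟨t ∩ u ∩ {q | ∀ n ≥ N, F^[n] q ∈ smallWedge (1 / 5) (3 / 10) (min δ' δ)},
    inter_mem (inter_mem ht hu) (mem_nhdsWithin_of_mem_nhds hN), ?_⟩
  filter_upwards [ht', hu', eventually_ge_atTop N] with n h1 h2 h3 q hq
  have h4 := h1 q hq.1.1
  have h5 := h2 q hq.1.2
  have h6 := hclose n q (smallWedge_mono (by norm_num) (by norm_num) le_rfl le_rfl
    (min_le_left _ _) (hq.2 n h3))
  rw [Pi.zero_apply, dist_zero_left, Real.norm_of_nonneg (by positivity),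
    lt_div_iff₀ (by positivity)] at h5
  have h7 : |M| * (‖(F^[n] q).1‖ + ‖(F^[n] q).2‖) < η / 2 := by
    have : 0 ≤ ‖(F^[n] q).1‖ + ‖(F^[n] q).2‖ := by positivity
    rcases this.eq_or_lt with h0 | h0
    · rw [← h0, mul_zero]
      positivity
    · nlinarith
  rw [← dist_eq_norm, dist_comm] at h6
  calc dist (Ψ q) (psiApprox F γ β l r s n q)
      ≤ dist (Ψ q) (fatouApprox β₁ k r s (F^[n] q) + n) +
        dist (fatouApprox β₁ k r s (F^[n] q) + n) (psiApprox F γ β l r s n q) :=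
        dist_triangle _ _ _
    _ < η := by linarith

/-- Passing from `p` to `F p` shifts the sequence by one and subtracts one from its entries. -/
lemma psi_apply_eq {F : ℂ × ℂ → ℂ × ℂ} {p : ℂ × ℂ} {a : ℂ}
    (h : Tendsto (fun n => psiApprox F γ β l r s n p) atTop (𝓝 a)) :
    psi F γ β l r s p = a ∧ psi F γ β l r s (F p) = a - 1 := by
  refine ⟨h.limUnder_eq, Tendsto.limUnder_eq ?_⟩
  refine (((tendsto_add_atTop_iff_nat 1).2 h).sub_const 1).congr fun n => ?_
  simp only [psiApprox, Function.iterate_succ_apply]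
  push_cast
  ring

lemma IsBiholomorphismOntoImage.congr {f f' : ℂ × ℂ → ℂ × ℂ} {D : Set (ℂ × ℂ)}
    (hf : IsBiholomorphismOntoImage f D) (h : EqOn f' f D) : IsBiholomorphismOntoImage f' D := by
  obtain ⟨h1, h2, h3, h4, k, h5, h6⟩ := hf
  rw [← h.image_eq] at h4 h5
  exact ⟨h1, h2.congr h, h3.congr h.symm, h4, k, h5, fun p hp => by rw [h hp, h6 p hp]⟩

end Final

theorem mainTheorem8 (F : ℂ × ℂ → ℂ × ℂ) (hF : IsAutC2 F) (hgerm : HasGerm F) :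
    (∃ (ε₀ : ℝ) (γ : ℂ → ℂ), IsParabolicCurve F ε₀ γ) ∧
    (∃ (R₀ : ℝ) (β : ℂ → ℂ), IsBeta F R₀ β) ∧
    ∀ (ε₀ : ℝ) (γ : ℂ → ℂ), IsParabolicCurve F ε₀ γ →
    ∀ (R₀ : ℝ) (β : ℂ → ℂ), IsBeta F R₀ β →
    ∀ l : ℂ → ℂ, IsLogBranch R₀ l →
    ∃ r s : ℂ, ∃ ε₁ : ℝ, 0 < ε₁ ∧ ε₁ ≤ ε₀ ∧ ε₁ ≤ 1 / R₀ ∧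
      ∀ ε : ℝ, 0 < ε → ε ≤ ε₁ →
        TendstoLocallyUniformlyOn (psiApprox F γ β l r s) (psi F γ β l r s) atTop
          (domainD γ ε) ∧
        (∀ p ∈ domainD γ ε, psi F γ β l r s (F p) = psi F γ β l r s p - 1) ∧
        IsBiholomorphismOntoImage (Theta F γ β l r s) (domainD γ ε) := by
  obtain ⟨A, g, h, hN, hg, hh⟩ := hgerm.exists_isNormalForm
  obtain ⟨hex, hext⟩ := hN.exists_wideBeta hg hh
  refine ⟨hN.exists_isParabolicCurve hF.1, hex, fun ε₀ γ hγ R₀ β hβ l hl => ?_⟩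
  obtain ⟨R, C, β₁, hR, hβ₁, hββ⟩ := hext R₀ β hβ
  obtain ⟨k, hk⟩ := hl.exists_eq_add hβ.pos
  obtain ⟨r, s, hrs⟩ := hN.exists_isFatouLimit hF.1
  obtain ⟨δ, K, Ψ, hΨ⟩ := hrs β₁ R C hβ₁ k
  obtain ⟨G, hG⟩ := hγ.bound
  obtain ⟨G', hG'⟩ := hγ.bound_deriv
  obtain ⟨ε₁, hε₁, hε₁₀, hS⟩ := hΨ.exists_isNearlyStraight hβ₁ hγ.pos hG hG'
  have hlim := hΨ.tendstoLocallyUniformlyOn_psiApprox hF.1.continuous hβ₁ hR hββ hk hγ.pos hG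
  have hR₀ := hβ.pos
  refine ⟨r, s, min ε₁ (1 / R₀), by positivity, (min_le_left _ _).trans hε₁₀, min_le_right _ _,
    fun ε _ hε => ?_⟩
  have hSε : IsNearlyStraight γ ε₀ ε δ Ψ := by
    have hεε₁ : ε ≤ ε₁ := hε.trans (min_le_left _ _)
    exact ⟨fun z hz v hv hvε => hS.mem z hz v hv (hvε.trans_le hεε₁),
      fun z hz v hv hvε => hS.norm_fderiv_add_one_le z hz v hv (hvε.trans_le hεε₁)⟩
  have hsub : domainD γ ε ⊆ smallWedge (1 / 2) (3 / 4) δ := fun p hp =>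
    (hSε.domainD_subset hp).2
  have hpsi : ∀ p ∈ domainD γ ε, psi F γ β l r s p = Ψ p ∧
      psi F γ β l r s (F p) = Ψ p - 1 := fun p hp =>
    psi_apply_eq (hlim.tendsto_at (hsub hp))
  refine ⟨(hlim.mono hsub).congr_right fun p hp => (hpsi p hp).1.symm, fun p hp => ?_, ?_⟩
  · rw [(hpsi p hp).1, (hpsi p hp).2]
  · refine (hSε.isBiholomorphismOntoImage (hε.trans ((min_le_left _ _).trans hε₁₀)) hγ.holo
      hΨ.differentiableOn).congr fun p hp => ?_
    rw [Theta, (hpsi p hp).1, one_div]
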